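/- **Theorem (Whitehead theorem).** Let $\mathbf{k}$ be a field of characteristic $0$. *Definitions.* For homogeneous elements $a_1,\dots,a_k$ of a $\mathbb Z$-graded vector space and $\tau\in S_k$, let $\mathrm{sgn}(\tau)=\pm1$ be the Koszul sign determined by $a_{\tau(1)}\cdots a_{\tau(k)}=\mathrm{sgn}(\tau)\,a_1\cdots a_k$ in the graded symmetric algebra $SC=\bigoplus_k S^kC$. A *strict $L_\infty[1]$-algebra* is a $\mathbb Z$-graded $\mathbf{k}$-vector space $C$ with degree $1$ linear maps $l_k:S^kC\to C$ $(k\ge 0)$, $l_0=0$, such that for all homogeneous $a_1,\dots,a_k$ $$\sum_{i=0}^{k}\sum_{\tau\in \mathrm{Sh}(i,k-i)}\mathrm{sgn}(\tau)\,l_{k-i+1}\big(l_i(a_{\tau(1)},\dots,a_{\tau(i)}),a_{\tau(i+1)},\dots,a_{\tau(k)}\big)=0,$$ where $\mathrm{Sh}(i,k-i)$ is the set of $(i,k-i)$-unshuffles. A (strict) *$L_\infty[1]$-morphism* $f:C\to C'$ is a family of degree $0$ linear maps $f_k:S^kC\to C'$ $(k\ge0)$, $f_0=0$, such that for all homogeneous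 $a_1,\dots,a_k$ $$\sum_{i=0}^{k}\sum_{\tau\in \mathrm{Sh}(i,k-i)}\mathrm{sgn}(\tau)\,f_{k-i+1}\big(l_i(a_{\tau(1)},\dots,a_{\tau(i)}),a_{\tau(i+1)},\dots,a_{\tau(k)}\big)$$ $$=\sum_{\substack{t\ge0,\ j_1,\dots,j_t\ge1\\ j_1+\cdots+j_t=k}}\ \sum_{\tau\in S_k}\frac{\mathrm{sgn}(\tau)}{t!\,j_1!\cdots j_t!}\,l'_t\big(f_{j_1}(a_{\tau(1)},\dots,a_{\tau(j_1)}),\dots,f_{j_t}(a_{\tau(k-j_t+1)},\dots,a_{\tau(k)})\big).$$ The composite $g\circ f$ of $f:C\to C'$ and $g:C'\to C''$ is the $L_\infty[1]$-morphism whose component $(g\circ f)_k(a_1,\dots,a_k)$ is the last expression with $l'_t$ replaced by $g_t$; the identity morphism has $(\mathrm{id}_C)_1=\mathrm{id}$ and all other components $0$. A *chain map* is a degree $0$ linear map commuting with the differentials $l_1$; it is a *quasi-isomorphism* if it induces an isomorphism on the cohomology $\ker l_1/\operatorname{im} l_1$. An $L_\infty[1]$-morphism $f$ is a *quasi-isomorphism*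 if the chain map $f_1$ is one. A *model of $\Delta^1\times C$* is a strict $L_\infty[1]$-algebra $\mathfrak C$ with $L_\infty[1]$-morphisms $\mathrm{Eval}_0,\mathrm{Eval}_1:\mathfrak C\to C$ and a chain map $\mathrm{Incl}:C\to\mathfrak C$ such that $\mathrm{Eval}_0,\mathrm{Eval}_1,\mathrm{Incl}$ are quasi-isomorphisms, $(\mathrm{Eval}_j)_1\circ\mathrm{Incl}=\mathrm{id}_C$ for $j=0,1$, and $(\mathrm{Eval}_0)_1\oplus(\mathrm{Eval}_1)_1:\mathfrak C\to C\oplus C$ is surjective. Two $L_\infty[1]$-morphisms $f_0,f_1:C\to C'$ are *homotopic* if there are a model $\mathfrak C'$ of $\Delta^1\times C'$ and an $L_\infty[1]$-morphism $h:C\to\mathfrak C'$ with $f_j=\mathrm{Eval}_j\circ h$ for $j=0,1$. An $L_\infty[1]$-morphism $f:C\to C'$ is a *homotopy equivalence* if there is an $L_\infty[1]$-morphism $g:C'\to C$ such that $g\circ f$ is homotopic to $\mathrm{id}_C$ and $f\circ g$ is homotopic to $\mathrm{id}_{C'}$. *Statement.* Let $C_1,C_2$ be strict $L_\infty[1]$-algebras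 over $\mathbf{k}$. Every quasi-isomorphism of $L_\infty[1]$-algebras $f:C_1\to C_2$ is a homotopy equivalence. -/

import Mathlib

universe u v w x

open Equiv (Perm)

/-- The Koszul sign `sgn(τ)` of a permutation `τ` of homogeneous elements `a₁, …, a_k` of degrees
`d₁, …, d_k`, characterized by `a_{τ(1)} ⋯ a_{τ(k)} = sgn(τ) a₁ ⋯ a_k` in the graded symmetric
algebra: each inversion of `τ` contributes `(-1)^{|a||a'|}` for the two elements it exchanges. -/
def koszulSign {k : ℕ} (d : Fin k → ℤ) (τ : Perm (Fin k)) : ℤˣ :=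
  ∏ p : Fin k, ∏ q : Fin k,
    if p < q ∧ τ q < τ p then Int.negOnePow (d (τ p) * d (τ q)) else 1

/-- The set `Sh(i, k - i)` of `(i, k-i)`-unshuffles: permutations increasing on the first `i` and on
the last `k - i` indices. -/
def unshuffles (i k : ℕ) : Finset (Perm (Fin k)) :=
  Finset.univ.filter fun τ =>
    ∀ p q : Fin k, p < q → ((q : ℕ) < i ∨ i ≤ (p : ℕ)) → τ p < τ q

theorem unshuffles_self (k : ℕ) : unshuffles k k = {1} := by
  ext τ
  simp only [unshuffles, Finset.mem_filter, Finset.mem_univ, true_and, Finset.mem_singleton]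
  constructor
  · intro h
    have hm : StrictMono τ := fun p q hpq => h p q hpq (Or.inl q.isLt)
    have := Subsingleton.elim (hm.orderIsoOfSurjective τ τ.surjective) (OrderIso.refl (Fin k))
    ext x
    exact congrArg Fin.val (DFunLike.congr_fun this x)
  · rintro rfl p q h _
    simpa using h

theorem koszulSign_one {k : ℕ} (d : Fin k → ℤ) : koszulSign d 1 = 1 := by
  unfold koszulSign
  refine Finset.prod_eq_one fun p _ => Finset.prod_eq_one fun q _ => ?_
  rw [if_neg]
  rintro ⟨h, h'⟩
  exact absurd h (not_lt.mpr (le_of_lt h'))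

section Formulas

variable {K : Type u} [Field K] {V : Type v} [AddCommGroup V] [Module K V]
  {W : Type w} [AddCommGroup W] [Module K W]

/-- For families `l_i` of `i`-ary operations on `V` and `f_m` of `m`-ary maps `V → W`, and for
elements `a` of degrees `d`, the expression
`∑_{i=0}^k ∑_{τ ∈ Sh(i,k-i)} sgn(τ) f_{k-i+1}(l_i(a_{τ(1)}, …, a_{τ(i)}), a_{τ(i+1)}, …, a_{τ(k)})`. -/
def insertionSum (f : (m : ℕ) → MultilinearMap K (fun _ : Fin m => V) W)
    (l : (m : ℕ) → MultilinearMap K (fun _ : Fin m => V) V)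
    (k : ℕ) (d : Fin k → ℤ) (a : Fin k → V) : W :=
  ∑ i : Fin (k + 1), ∑ τ ∈ unshuffles (i : ℕ) k,
    ((koszulSign d τ : ℤ) : K) •
      f (k - (i : ℕ) + 1)
        (Fin.cons
          (l (i : ℕ) fun j : Fin (i : ℕ) => a (τ (Fin.castLE (Nat.lt_succ_iff.mp i.isLt) j)))
          (fun j : Fin (k - (i : ℕ)) => a (τ ⟨(i : ℕ) + (j : ℕ), by omega⟩)))

/-- For families `g_t` of `t`-ary maps `W → X` and `f_m` of `m`-ary maps `V → W` (with `f_0 = 0`),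
and for elements `a` of degrees `d`, the expression
`∑_{j₁+⋯+j_t=k} ∑_{τ ∈ S_k} sgn(τ)/(t! j₁! ⋯ j_t!) g_t(f_{j₁}(a_{τ(1)}, …, a_{τ(j₁)}), …,
f_{j_t}(…, a_{τ(k)}))`.
The outer sum is over ordered decompositions `k = j₁ + ⋯ + j_t` into positive parts. -/
def compositionSum {X : Type*} [AddCommGroup X] [Module K X]
    (g : (m : ℕ) → MultilinearMap K (fun _ : Fin m => W) X)
    (f : (m : ℕ) → MultilinearMap K (fun _ : Fin m => V) W)
    (k : ℕ) (d : Fin k → ℤ) (a : Fin k → V) : X :=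
  ∑ c : Composition k, ∑ τ : Perm (Fin k),
    (((koszulSign d τ : ℤ) : K) /
        ((c.length.factorial : K) * ∏ i : Fin c.length, ((c.blocksFun i).factorial : K))) •
      g c.length fun i => f (c.blocksFun i) fun j => a (τ (c.embedding i j))

end Formulas

/-- A strict `L_∞[1]`-algebra over `K`: a `ℤ`-graded vector space with degree one maps
`l_k : S^k C → C`, i.e. graded symmetric `k`-linear maps, with `l_0 = 0`, satisfying the
`L_∞[1]`-relations. -/
structure LInftyAlgebra (K : Type u) [Field K] where
  carrier : Type v
  [addCommGroup : AddCommGroup carrier]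
  [module : Module K carrier]
  /-- the homogeneous part of each degree -/
  deg : ℤ → Submodule K carrier
  isInternal : DirectSum.IsInternal deg
  l : (k : ℕ) → MultilinearMap K (fun _ : Fin k => carrier) carrier
  l_mem : ∀ (k : ℕ) (d : Fin k → ℤ) (a : Fin k → carrier), (∀ j, a j ∈ deg (d j)) →
    l k a ∈ deg ((∑ j, d j) + 1)
  l_symm : ∀ (k : ℕ) (d : Fin k → ℤ) (a : Fin k → carrier), (∀ j, a j ∈ deg (d j)) →
    ∀ σ : Perm (Fin k), l k (fun j => a (σ j)) = ((koszulSign d σ : ℤ) : K) • l k a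
  strict : l 0 = 0
  relation : ∀ (k : ℕ) (d : Fin k → ℤ) (a : Fin k → carrier), (∀ j, a j ∈ deg (d j)) →
    insertionSum l l k d a = 0

namespace LInftyAlgebra

variable {K : Type u} [Field K]

instance : CoeSort (LInftyAlgebra.{u, v} K) (Type v) := ⟨LInftyAlgebra.carrier⟩

attribute [instance] LInftyAlgebra.addCommGroup LInftyAlgebra.module

/-- The differential `l_1`. -/
def d (C : LInftyAlgebra.{u, v} K) : C →ₗ[K] C where
  toFun x := C.l 1 fun _ => x
  map_add' := ((MultilinearMap.ofSubsingleton K C C (0 : Fin 1)).symm (C.l 1)).map_add'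
  map_smul' := ((MultilinearMap.ofSubsingleton K C C (0 : Fin 1)).symm (C.l 1)).map_smul'

/-- The cohomology `H^*(C) = ker l_1 / im l_1`. -/
abbrev Cohomology (C : LInftyAlgebra.{u, v} K) : Type v :=
  LinearMap.ker C.d ⧸ (LinearMap.range C.d).submoduleOf (LinearMap.ker C.d)

/-- Linear maps that agree on homogeneous elements are equal. -/
theorem linearMap_ext (C : LInftyAlgebra.{u, v} K) {W : Type w} [AddCommGroup W] [Module K W]
    {f g : C →ₗ[K] W} (h : ∀ (n : ℤ), ∀ x ∈ C.deg n, f x = g x) : f = g := by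
  ext x
  have hx : x ∈ ⨆ n, C.deg n := by
    rw [C.isInternal.submodule_iSup_eq_top]; trivial
  induction hx using Submodule.iSup_induction' with
  | mem n x hx => exact h n x hx
  | zero => simp
  | add x y _ _ hx hy => simp [hx, hy]

end LInftyAlgebra

/-- A chain map: a degree zero linear map commuting with the differentials `l_1`. -/
structure LInftyChainMap {K : Type u} [Field K]
    (C : LInftyAlgebra.{u, v} K) (C' : LInftyAlgebra.{u, w} K) where
  toLinearMap : C →ₗ[K] C'
  map_mem : ∀ (n : ℤ), ∀ x ∈ C.deg n, toLinearMap x ∈ C'.deg n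
  comm : ∀ x : C, toLinearMap (C.d x) = C'.d (toLinearMap x)

namespace LInftyChainMap

variable {K : Type u} [Field K] {C : LInftyAlgebra.{u, v} K} {C' : LInftyAlgebra.{u, w} K}

/-- The map induced on cohomology. -/
def cohomologyMap (φ : LInftyChainMap C C') : C.Cohomology →ₗ[K] C'.Cohomology :=
  Submodule.mapQ _ _
    (φ.toLinearMap.restrict (p := LinearMap.ker C.d) (q := LinearMap.ker C'.d) (by
      intro x hx
      rw [LinearMap.mem_ker] at hx ⊢
      rw [← φ.comm, hx, map_zero]))
    (by
      rintro ⟨x, hx⟩ ⟨y, hy⟩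
      exact ⟨φ.toLinearMap y, by rw [← φ.comm, hy]; rfl⟩)

/-- A quasi-isomorphic chain map. -/
def IsQuasiIso (φ : LInftyChainMap C C') : Prop :=
  Function.Bijective φ.cohomologyMap

end LInftyChainMap

/-- A (strict) `L_∞[1]`-morphism: degree zero maps `f_k : S^k C → C'` with `f_0 = 0`, satisfying the
`L_∞[1]`-morphism relations. -/
structure LInftyHom {K : Type u} [Field K]
    (C : LInftyAlgebra.{u, v} K) (C' : LInftyAlgebra.{u, w} K) where
  f : (k : ℕ) → MultilinearMap K (fun _ : Fin k => C) C'
  f_mem : ∀ (k : ℕ) (d : Fin k → ℤ) (a : Fin k → C), (∀ j, a j ∈ C.deg (d j)) →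
    f k a ∈ C'.deg (∑ j, d j)
  f_symm : ∀ (k : ℕ) (d : Fin k → ℤ) (a : Fin k → C), (∀ j, a j ∈ C.deg (d j)) →
    ∀ σ : Perm (Fin k), f k (fun j => a (σ j)) = ((koszulSign d σ : ℤ) : K) • f k a
  strict : f 0 = 0
  relation : ∀ (k : ℕ) (d : Fin k → ℤ) (a : Fin k → C), (∀ j, a j ∈ C.deg (d j)) →
    insertionSum f C.l k d a = compositionSum C'.l f k d a

namespace LInftyHom

variable {K : Type u} [Field K]

section

variable {C : LInftyAlgebra.{u, v} K} {C' : LInftyAlgebra.{u, w} K}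

/-- The linear component `f_1`. -/
def linearMap (f : LInftyHom C C') : C →ₗ[K] C' where
  toFun x := f.f 1 fun _ => x
  map_add' := ((MultilinearMap.ofSubsingleton K C C' (0 : Fin 1)).symm (f.f 1)).map_add'
  map_smul' := ((MultilinearMap.ofSubsingleton K C C' (0 : Fin 1)).symm (f.f 1)).map_smul'

theorem f_eq_one (f : LInftyHom C C') {m : ℕ} (h : m = 1) (b : Fin m → C) :
    f.f m b = f.f 1 fun _ => b ⟨0, by omega⟩ := by
  subst h
  exact congrArg (f.f 1) (funext fun j => by rw [Subsingleton.elim j 0]; rfl)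

theorem linearMap_comm (f : LInftyHom C C') : f.linearMap ∘ₗ C.d = C'.d ∘ₗ f.linearMap := by
  refine C.linearMap_ext fun n x hx => ?_
  have h := f.relation 1 (fun _ => n) (fun _ => x) (fun _ => hx)
  have h1 : insertionSum f.f C.l 1 (fun _ => n) (fun _ => x) =
      f.f 1 fun _ => C.l 1 fun _ => x := by
    unfold insertionSum
    have hu : unshuffles ((Fin.last 1 : Fin (1 + 1)) : ℕ) 1 = {1} := unshuffles_self 1
    rw [Fin.sum_univ_castSucc, Fin.sum_univ_one, hu, Finset.sum_singleton, koszulSign_one]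
    rw [Finset.sum_eq_zero, zero_add]
    · simp only [Units.val_one, Int.cast_one, one_smul]
      rw [f.f_eq_one (by simp)]
      rfl
    · intro τ _
      refine (congrArg _ ?_).trans (smul_zero _)
      refine MultilinearMap.map_coord_zero _ 0 ?_
      rw [Fin.cons_zero]
      change C.l 0 _ = 0
      rw [C.strict]
      rfl
  have h2 : compositionSum C'.l f.f 1 (fun _ => n) (fun _ => x) =
      C'.l 1 fun _ => f.f 1 fun _ => x := by
    unfold compositionSum
    rw [Fintype.sum_eq_single (Composition.ones 1)]
    · rw [Fintype.sum_eq_single (1 : Perm (Fin 1)) (fun τ hτ => (hτ (Subsingleton.elim _ _)).elim),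
        koszulSign_one]
      have hl : ∀ (m : ℕ) (_ : m = 1) (b : Fin m → C'),
          (∀ i, b i = f.f 1 fun _ => x) → C'.l m b = C'.l 1 fun _ => f.f 1 fun _ => x := by
        rintro m rfl b hb
        exact congrArg (C'.l 1) (funext hb)
      rw [hl _ (Composition.ones_length 1) _ fun i => f.f_eq_one (by simp) _]
      simp
    · intro c hc
      exact (hc (Composition.eq_ones_iff_le_length.mpr (c.length_pos_of_pos Nat.one_pos))).elim
  rw [h1, h2] at h
  exact h

/-- The linear component `f_1`, as a chain map. -/
def linear (f : LInftyHom C C') : LInftyChainMap C C' where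
  toLinearMap := f.linearMap
  map_mem n x hx := by
    have h := f.f_mem 1 (fun _ => n) (fun _ => x) (fun _ => hx)
    rwa [Fin.sum_univ_one] at h
  comm x := LinearMap.congr_fun f.linearMap_comm x

/-- An `L_∞[1]`-morphism is a quasi-isomorphism if `f_1` is a quasi-isomorphic chain map. -/
def IsQuasiIso (f : LInftyHom C C') : Prop :=
  f.linear.IsQuasiIso

end

/-- The components of the identity morphism: `f_1 = id` and `f_k = 0` for `k ≠ 1`. -/
def idMap (C : LInftyAlgebra.{u, v} K) (k : ℕ) : MultilinearMap K (fun _ : Fin k => C) C :=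
  if h : k = 1 then
    { toFun := fun a => a ⟨0, by omega⟩
      map_update_add' := by subst h; intro _ a i x y; simp [Subsingleton.elim i 0]
      map_update_smul' := by subst h; intro _ a i x y; simp [Subsingleton.elim i 0] }
  else 0

theorem idMap_one (C : LInftyAlgebra.{u, v} K) (a : Fin 1 → C) : idMap C 1 a = a 0 := rfl

theorem idMap_of_ne (C : LInftyAlgebra.{u, v} K) {k : ℕ} (h : k ≠ 1) : idMap C k = 0 := by
  simp [idMap, h]

theorem idMap_eq (C : LInftyAlgebra.{u, v} K) {k : ℕ} (h : k = 1) (a : Fin k → C) :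
    idMap C k a = a ⟨0, by omega⟩ := by
  subst h; rfl

theorem insertionSum_idMap (C : LInftyAlgebra.{u, v} K) (k : ℕ) (d : Fin k → ℤ) (a : Fin k → C) :
    insertionSum (idMap C) C.l k d a = C.l k a := by
  unfold insertionSum
  rw [Finset.sum_eq_single (Fin.last k)]
  · have hu : unshuffles ((Fin.last k : Fin (k + 1)) : ℕ) k = {1} := unshuffles_self k
    rw [hu, Finset.sum_singleton, koszulSign_one, idMap_eq C (by simp)]
    simp only [Units.val_one, Int.cast_one, one_smul]
    rfl
  · intro i _ hi
    have : (i : ℕ) ≠ k := fun h => hi (Fin.ext h)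
    refine Finset.sum_eq_zero fun τ _ => ?_
    rw [idMap_of_ne C (by omega)]
    simp
  · simp

theorem compositionSum_idMap [CharZero K] (C : LInftyAlgebra.{u, v} K) (k : ℕ) (d : Fin k → ℤ)
    (a : Fin k → C) (ha : ∀ j, a j ∈ C.deg (d j)) :
    compositionSum C.l (idMap C) k d a = C.l k a := by
  unfold compositionSum
  have hl : ∀ (m : ℕ) (h : m = k) (τ : Perm (Fin k)) (b : Fin m → C),
      (∀ i, b i = a (τ (Fin.cast h i))) → C.l m b = C.l k fun j => a (τ j) := by
    rintro m rfl τ b hb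
    congr 1
    exact funext hb
  rw [Finset.sum_eq_single (Composition.ones k)]
  · have hterm : ∀ τ : Perm (Fin k), (C.l (Composition.ones k).length fun i =>
        idMap C ((Composition.ones k).blocksFun i) fun j =>
          a (τ ((Composition.ones k).embedding i j))) =
        ((koszulSign d τ : ℤ) : K) • C.l k a := by
      intro τ
      rw [← C.l_symm k d a ha τ]
      refine hl _ (Composition.ones_length k) τ _ fun i => ?_
      rw [idMap_eq C (by simp)]
      congr 2
      rw [Composition.ones_embedding]
      rfl
    have hsq : ∀ τ : Perm (Fin k),
        ((koszulSign d τ : ℤ) : K) * ((koszulSign d τ : ℤ) : K) = 1 := by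
      intro τ
      rw [← Int.cast_mul, ← Units.val_mul, Int.units_mul_self]
      simp
    have hk : (k.factorial : K) ≠ 0 := by exact_mod_cast k.factorial_ne_zero
    simp only [hterm, smul_smul]
    simp only [Composition.ones_length, Composition.ones_blocksFun, Nat.factorial_one,
      Nat.cast_one, Finset.prod_const_one, mul_one, div_mul_eq_mul_div, hsq]
    rw [Finset.sum_const, Finset.card_univ, Fintype.card_perm, Fintype.card_fin,
      ← Nat.cast_smul_eq_nsmul K, smul_smul, mul_one_div_cancel hk, one_smul]
  · intro c _ hc
    refine Finset.sum_eq_zero fun τ _ => ?_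
    obtain ⟨i, hi⟩ : ∃ i, c.blocksFun i ≠ 1 := by
      by_contra! h
      refine hc (Composition.eq_ones_iff.mpr fun b hb => ?_)
      rw [← Composition.ofFn_blocksFun, List.mem_ofFn] at hb
      obtain ⟨i, rfl⟩ := hb
      exact h i
    rw [MultilinearMap.map_coord_zero _ i (by rw [idMap_of_ne C hi]; rfl), smul_zero]
  · simp

/-- The identity morphism. -/
def id [CharZero K] (C : LInftyAlgebra.{u, v} K) : LInftyHom C C where
  f := idMap C
  f_mem k d a ha := by
    by_cases h : k = 1
    · subst h
      simpa [idMap_one] using ha 0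
    · simp [idMap_of_ne C h]
  f_symm k d a ha σ := by
    by_cases h : k = 1
    · subst h
      rw [Subsingleton.elim σ 1, koszulSign_one]
      simp
    · simp [idMap_of_ne C h]
  strict := idMap_of_ne C (by simp)
  relation k d a ha := by
    rw [insertionSum_idMap, compositionSum_idMap C k d a ha]

/-- `h` is the composite `g ∘ f`: its components are
`(g ∘ f)_k(a₁, …, a_k) = ∑ sgn(τ)/(t! j₁! ⋯ j_t!) g_t(f_{j₁}(a_{τ(1)}, …), …, f_{j_t}(…, a_{τ(k)}))`
on homogeneous elements. -/
def IsComp {C : LInftyAlgebra.{u, v} K} {C' : LInftyAlgebra.{u, w} K}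
    {C'' : LInftyAlgebra.{u, x} K} (g : LInftyHom C' C'') (f : LInftyHom C C')
    (h : LInftyHom C C'') : Prop :=
  ∀ (k : ℕ) (d : Fin k → ℤ) (a : Fin k → C), (∀ j, a j ∈ C.deg (d j)) →
    h.f k a = compositionSum g.f f.f k d a

end LInftyHom

/-- A model of `Δ¹ × C`. -/
structure LInftyModel {K : Type u} [Field K] (C : LInftyAlgebra.{u, v} K) where
  alg : LInftyAlgebra.{u, v} K
  eval : Fin 2 → LInftyHom alg C
  incl : LInftyChainMap C alg
  eval_isQuasiIso : ∀ j, (eval j).IsQuasiIso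
  incl_isQuasiIso : incl.IsQuasiIso
  eval_incl : ∀ (j : Fin 2) (x : C), (eval j).linear.toLinearMap (incl.toLinearMap x) = x
  surjective : Function.Surjective fun x : alg =>
    (((eval 0).linear.toLinearMap x, (eval 1).linear.toLinearMap x) : C × C)

namespace LInftyHom

variable {K : Type u} [Field K] {C : LInftyAlgebra.{u, v} K} {C' : LInftyAlgebra.{u, w} K}

/-- `f₀` and `f₁` are homotopic: there are a model `ℭ'` of `Δ¹ × C'` and an `L_∞[1]`-morphism
`h : C → ℭ'` with `f_j = Eval_j ∘ h` for `j = 0, 1`. -/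
def Homotopic (f₀ f₁ : LInftyHom C C') : Prop :=
  ∃ (M : LInftyModel C') (h : LInftyHom C M.alg),
    IsComp (M.eval 0) h f₀ ∧ IsComp (M.eval 1) h f₁

/-- `f : C → C'` is a homotopy equivalence: there is an `L_∞[1]`-morphism `g : C' → C` such that
`g ∘ f` and `f ∘ g` are `L_∞[1]`-morphisms homotopic to the identities. -/
def IsHomotopyEquivalence [CharZero K] (f : LInftyHom C C') : Prop :=
  ∃ g : LInftyHom C' C,
    (∃ gf : LInftyHom C C, IsComp g f gf ∧ Homotopic gf (LInftyHom.id C)) ∧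
    (∃ fg : LInftyHom C' C', IsComp f g fg ∧ Homotopic fg (LInftyHom.id C'))

end LInftyHom

/-!
# The Whitehead theorem for strict `L_∞[1]`-algebras

Families of graded symmetric maps are studied through their values on points with coefficients in
graded commutative nilpotent algebras. A quasi-isomorphism `f : C₁ → C₂` is factored through its
mapping path space `E`, built from polynomial forms on the interval. The projection `E → C₂` has
contractible kernel, hence a nonlinear section, which yields the homotopy inverse.
-/

/-! A family of graded symmetric maps `F_k : S^k V → W` is treated as a formal function. For a
nilpotent graded commutative algebra `A`, a point of degree `0` is an element `v` of `A ⊗ V` in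
which every coefficient has the degree of its vector, and `F` takes the value `F(v) = ∑ F_k(v, …,
v)/k!`, a finite sum. All Koszul signs cancel in such values. Composition of families becomes
composition of functions (`val_comp`) and insertion becomes the directional derivative `DF(v)[l(v)]`
(`val_ins`). Nothing is lost: exterior algebras provide universal points, whose values recover every
component (`eq_zero_of_val`).

Let `η` be an odd coefficient of degree `1`, so that `η² = 0`. Taylor expansion (`val_add_lmul`)
turns the structure equation into invariance of `l` under the flow `v ↦ v + η l(v)` (`Codiff`), and
turns the morphism equation into compatibility of two flows (`Mor`). In this form products,
composites, path objects and path spaces are checked by substitution.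

The path object of `V` consists of polynomial forms `p + r dt` on the interval, with operation `l(p)
+ (p' - Dl(p)[r]) dt` (`Codiff.path`). The Poincaré lemma makes it a model of `Δ¹ × V`. More
generally, `PathData` produces the space of paths joining two morphisms over a base, written as `Z ×
loops` by subtracting the linear interpolation `(1 - t) φ₀ + t φ₁`.

The key result is `Contraction.mor_sect`: a strict morphism `q : E → B` that is surjective with
acyclic kernel has an `L_∞[1]`-section. Over a field such a `q` admits a contraction `h`
(`exists_contraction`). The section `s` solves the fixed point equation `s = base - h N(s)`, where
`N` is the part of the operations of arity at least two; this is solved recursively in the arity.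
The failure of `s` to be a morphism is killed by `q`, by `h`, and, in its lowest arity, by `h d`.
The contraction identity then makes it vanish.

For a quasi-isomorphism `f`, let `E` be the space of triples `(x, y, γ)` with `γ` a path from `f(x)`
to `y`, let `p` and `q` be the projections to `x` and `y`, and let `i` be the inclusion by constant
paths. The kernel of `q` is acyclic precisely because `f` is a quasi-isomorphism
(`mapPath_contraction`), so `q` has a section `s`; set `g = p s`. The path component of `s(y)` is a
homotopy from `f g` to the identity. The paths in `E` from `s q(e)` to `e` over `q(e)` again project
to `E` with acyclic kernel (`sectPath_contraction`), and a section of that projection is a homotopy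
`H` from `s q` to the identity (`exists_homotopy_of_section`). Then `p H i` joins `p s q i = g f` to
`p i = id`. -/

open scoped TensorProduct

/-! ### Multilinear maps and spanning sets -/

section Span

variable {K : Type*} [Field K] {ι : Type*} {M : ι → Type*} [∀ i, AddCommGroup (M i)]
  [∀ i, Module K (M i)] {X : Type*} [AddCommGroup X] [Module K X]

/-- A multilinear map that sends tuples from given sets into a submodule does the same for tuples
from their spans. -/
theorem MultilinearMap.map_mem_of_forall_mem_span [Finite ι] (Φ : MultilinearMap K M X)
    (S : ∀ i, Set (M i)) (P : Submodule K X) (h : ∀ s : ∀ i, M i, (∀ i, s i ∈ S i) → Φ s ∈ P)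
    (v : ∀ i, M i) (hv : ∀ i, v i ∈ Submodule.span K (S i)) : Φ v ∈ P := by
  classical
  cases nonempty_fintype ι
  -- Pass from generators to their spans one coordinate at a time; `T` is the set of coordinates
  -- already treated.
  suffices H : ∀ (T : Finset ι) (v : ∀ i, M i), (∀ i ∈ T, v i ∈ Submodule.span K (S i)) →
      (∀ i ∉ T, v i ∈ S i) → Φ v ∈ P from
    H Finset.univ v (fun i _ => hv i) (fun i hi => (hi (Finset.mem_univ i)).elim)
  intro T
  induction T using Finset.induction_on with
  | empty => exact fun v _ h2 => h v fun i => h2 i (Finset.notMem_empty i)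
  | insert j T hj ih =>
    intro v h1 h2
    have key : ∀ x ∈ Submodule.span K (S j), Φ (Function.update v j x) ∈ P := by
      intro x hx
      induction hx using Submodule.span_induction with
      | mem x hx =>
        refine ih _ (fun i hi => ?_) (fun i hi => ?_)
        · have : i ≠ j := fun e => hj (e ▸ hi)
          rw [Function.update_of_ne this]
          exact h1 i (Finset.mem_insert_of_mem hi)
        · by_cases e : i = j
          · subst e; rwa [Function.update_self]
          · rw [Function.update_of_ne e]
            exact h2 i (by simp [e, hi])
      | zero => rw [Φ.map_update_zero]; exact P.zero_mem
      | add x y _ _ hx hy => rw [Φ.map_update_add]; exact P.add_mem hx hy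
      | smul c x _ hx => rw [Φ.map_update_smul]; exact P.smul_mem c hx
    have := key (v j) (h1 j (Finset.mem_insert_self j T))
    rwa [Function.update_eq_self] at this

theorem MultilinearMap.eq_of_forall_mem_span [Finite ι] (Φ Ψ : MultilinearMap K M X)
    (S : ∀ i, Set (M i)) (h : ∀ s : ∀ i, M i, (∀ i, s i ∈ S i) → Φ s = Ψ s)
    (v : ∀ i, M i) (hv : ∀ i, v i ∈ Submodule.span K (S i)) : Φ v = Ψ v := by
  have := (Φ - Ψ).map_mem_of_forall_mem_span S ⊥ (fun s hs => by simp [h s hs]) v hv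
  simpa [sub_eq_zero] using this

end Span

/-! ### Extension of multilinear maps to tensor products with an algebra -/

section Tens

variable {K : Type*} [Field K] (A : Type*) [Ring A] [Algebra K A]
  {V : Type*} [AddCommGroup V] [Module K V] {W : Type*} [AddCommGroup W] [Module K W]

/-- Multilinear maps on `A ⊗ V` agree if they do so when the first argument is a pure tensor. -/
theorem MultilinearMap.eq_of_tmul {k : ℕ}
    {Φ Ψ : MultilinearMap K (fun _ : Fin (k + 1) => A ⊗[K] V) (A ⊗[K] W)}
    (h : ∀ (v : Fin (k + 1) → A ⊗[K] V) (a : A) (x : V), v 0 = a ⊗ₜ x → Φ v = Ψ v) : Φ = Ψ := by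
  refine MultilinearMap.ext fun v => ?_
  refine Φ.eq_of_forall_mem_span Ψ (fun _ => {t | ∃ (e : A) (x : V), e ⊗ₜ x = t}) ?_ v
    (fun i => by rw [TensorProduct.span_tmul_eq_top]; trivial)
  intro s hs
  obtain ⟨a, x, hx⟩ := hs 0
  exact h s a x hx.symm

/-- The recursion step for extending multilinear maps to `A ⊗ V`: treat the first variable
separately. -/
noncomputable def tensStep {k : ℕ} (T : MultilinearMap K (fun _ : Fin k => V) W →ₗ[K]
    MultilinearMap K (fun _ : Fin k => A ⊗[K] V) (A ⊗[K] W))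
    (Φ : MultilinearMap K (fun _ : Fin (k + 1) => V) W) :
    MultilinearMap K (fun _ : Fin (k + 1) => A ⊗[K] V) (A ⊗[K] W) :=
  LinearMap.uncurryLeft (M := fun _ : Fin (k + 1) => A ⊗[K] V)
    (TensorProduct.lift (LinearMap.mk₂ K
      (fun a x => (LinearMap.rTensor W (LinearMap.mulLeft K a)).compMultilinearMap
        (T (Φ.curryLeft x)))
      (fun a b x => by
        ext v
        simp only [LinearMap.compMultilinearMap_apply, add_apply,
          ← LinearMap.add_apply, ← LinearMap.rTensor_add]
        congr 2; ext; simp [add_mul])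
      (fun c a x => by
        ext v
        simp only [LinearMap.compMultilinearMap_apply, smul_apply,
          ← LinearMap.smul_apply, ← LinearMap.rTensor_smul]
        congr 2; ext; simp)
      (fun a x y => by ext v; simp only [map_add, LinearMap.compMultilinearMap_apply, add_apply])
      (fun c a x => by
        ext v; simp only [map_smul, LinearMap.compMultilinearMap_apply, smul_apply])))

theorem tensStep_cons {k : ℕ} (T : MultilinearMap K (fun _ : Fin k => V) W →ₗ[K]
    MultilinearMap K (fun _ : Fin k => A ⊗[K] V) (A ⊗[K] W))
    (Φ : MultilinearMap K (fun _ : Fin (k + 1) => V) W) (a : A) (x : V)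
    (v : Fin (k + 1) → A ⊗[K] V) (h : v 0 = a ⊗ₜ x) :
    tensStep A T Φ v = LinearMap.rTensor W (LinearMap.mulLeft K a)
      (T (Φ.curryLeft x) (Fin.tail v)) := by
  rw [tensStep, LinearMap.uncurryLeft_apply, h, TensorProduct.lift.tmul, LinearMap.mk₂_apply]
  rfl

/-- The extension of a multilinear map `Φ` to `A ⊗ V`, sending `(eᵢ ⊗ xᵢ)ᵢ` to
`(∏ eᵢ) ⊗ Φ(x)`, as a linear function of `Φ`. -/
noncomputable def tensₗ : (k : ℕ) → MultilinearMap K (fun _ : Fin k => V) W →ₗ[K]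
    MultilinearMap K (fun _ : Fin k => A ⊗[K] V) (A ⊗[K] W)
  | 0 =>
    { toFun := fun Φ => MultilinearMap.constOfIsEmpty K _ (1 ⊗ₜ Φ default)
      map_add' := fun Φ Ψ => MultilinearMap.ext fun v => TensorProduct.tmul_add _ _ _
      map_smul' := fun c Φ => MultilinearMap.ext fun v => TensorProduct.tmul_smul _ _ _ }
  | k + 1 =>
    { toFun := tensStep A (tensₗ k)
      map_add' := fun Φ Ψ => by
        refine MultilinearMap.eq_of_tmul A fun v a x h => ?_
        rw [add_apply, tensStep_cons A _ _ a x v h, tensStep_cons A _ _ a x v h,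
          tensStep_cons A _ _ a x v h, ← map_add, ← add_apply, ← map_add]
        rfl
      map_smul' := fun c Φ => by
        refine MultilinearMap.eq_of_tmul A fun v a x h => ?_
        rw [smul_apply, tensStep_cons A _ _ a x v h, tensStep_cons A _ _ a x v h,
          ← map_smul, ← smul_apply, ← map_smul]
        rfl }

/-- The extension of a multilinear map `Φ` to `A ⊗ V`. -/
noncomputable def tens {k : ℕ} (Φ : MultilinearMap K (fun _ : Fin k => V) W) :
    MultilinearMap K (fun _ : Fin k => A ⊗[K] V) (A ⊗[K] W) := tensₗ A k Φ

variable {A}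

-- Coefficients are collected in order, and no sign is introduced for moving them past vectors. At
-- points of degree zero this is consistent: there a permutation produces the same Koszul sign from
-- coefficients and from vectors.
@[simp] theorem tens_tmul {k : ℕ} (Φ : MultilinearMap K (fun _ : Fin k => V) W)
    (e : Fin k → A) (x : Fin k → V) :
    tens A Φ (fun i => e i ⊗ₜ x i) = (List.ofFn e).prod ⊗ₜ Φ x := by
  induction k with
  | zero =>
    simp only [tens, tensₗ, LinearMap.coe_mk, AddHom.coe_mk, MultilinearMap.constOfIsEmpty_apply,
      List.ofFn_zero, List.prod_nil]
    exact congrArg (fun z => (1 : A) ⊗ₜ[K] Φ z) (Subsingleton.elim _ _)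
  | succ k ih =>
    have h := ih (Φ.curryLeft (x 0)) (fun i => e i.succ) (fun i => x i.succ)
    change tensStep A (tensₗ A k) Φ _ = _
    rw [tensStep_cons A _ _ (e 0) (x 0) _ rfl]
    refine (congrArg _ h).trans ?_
    rw [LinearMap.rTensor_tmul, LinearMap.mulLeft_apply, List.ofFn_succ,
      List.prod_cons, MultilinearMap.curryLeft_apply]
    congr 2
    exact Fin.cons_self_tail x

theorem tens_ext {k : ℕ} {X : Type*} [AddCommGroup X] [Module K X]
    {Φ Ψ : MultilinearMap K (fun _ : Fin k => A ⊗[K] V) X}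
    (h : ∀ (e : Fin k → A) (x : Fin k → V), Φ (fun i => e i ⊗ₜ x i) = Ψ (fun i => e i ⊗ₜ x i)) :
    Φ = Ψ := by
  ext v
  refine Φ.eq_of_forall_mem_span Ψ (fun _ => {t | ∃ (e : A) (x : V), e ⊗ₜ x = t}) ?_ v
    (fun i => by rw [TensorProduct.span_tmul_eq_top]; trivial)
  intro s hs
  choose e x hs using hs
  simpa only [hs] using h e x

@[simp] theorem tens_add {k : ℕ} (Φ Ψ : MultilinearMap K (fun _ : Fin k => V) W) :
    tens A (Φ + Ψ) = tens A Φ + tens A Ψ := map_add _ _ _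

@[simp] theorem tens_smul {k : ℕ} (c : K) (Φ : MultilinearMap K (fun _ : Fin k => V) W) :
    tens A (c • Φ) = c • tens A Φ := map_smul _ _ _

@[simp] theorem tens_neg {k : ℕ} (Φ : MultilinearMap K (fun _ : Fin k => V) W) :
    tens A (-Φ) = -tens A Φ := by
  have h : -Φ = (-1 : K) • Φ := MultilinearMap.ext fun v => (neg_one_smul K (Φ v)).symm
  rw [h, tens_smul]
  exact MultilinearMap.ext fun v => neg_one_smul K _

@[simp] theorem tens_sub {k : ℕ} (Φ Ψ : MultilinearMap K (fun _ : Fin k => V) W) :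
    tens A (Φ - Ψ) = tens A Φ - tens A Ψ := by
  have h : Φ - Ψ = Φ + -Ψ := MultilinearMap.ext fun v => sub_eq_add_neg _ _
  rw [h, tens_add, tens_neg]
  exact MultilinearMap.ext fun v => (sub_eq_add_neg _ _).symm

@[simp] theorem tens_zero {k : ℕ} :
    tens A (0 : MultilinearMap K (fun _ : Fin k => V) W) = 0 := map_zero _

@[simp] theorem tens_sum {k : ℕ} {ι : Type*} (s : Finset ι)
    (Φ : ι → MultilinearMap K (fun _ : Fin k => V) W) :
    tens A (∑ i ∈ s, Φ i) = ∑ i ∈ s, tens A (Φ i) := map_sum _ _ _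

theorem tens_postcomp {k : ℕ} {X : Type*} [AddCommGroup X] [Module K X] (L : W →ₗ[K] X)
    (Φ : MultilinearMap K (fun _ : Fin k => V) W) (v : Fin k → A ⊗[K] V) :
    tens A (L.compMultilinearMap Φ) v = L.lTensor A (tens A Φ v) := by
  have : tens A (L.compMultilinearMap Φ) = (L.lTensor A).compMultilinearMap (tens A Φ) :=
    tens_ext fun e x => by simp
  rw [this]; rfl

theorem tens_precomp {k : ℕ} {X : Type*} [AddCommGroup X] [Module K X] (L : Fin k → X →ₗ[K] V)
    (Φ : MultilinearMap K (fun _ : Fin k => V) W) (v : Fin k → A ⊗[K] X) :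
    tens A (Φ.compLinearMap L) v = tens A Φ fun i => (L i).lTensor A (v i) := by
  have : tens A (Φ.compLinearMap L) = (tens A Φ).compLinearMap fun i => (L i).lTensor A :=
    tens_ext fun e x => by simp
  rw [this]; rfl

variable (V) in
/-- Left multiplication by `a` on `A ⊗ V`. -/
noncomputable def lmul (a : A) : A ⊗[K] V →ₗ[K] A ⊗[K] V := LinearMap.rTensor V (LinearMap.mulLeft K a)

@[simp] theorem lmul_tmul (a e : A) (x : V) : lmul (K := K) V a (e ⊗ₜ x) = (a * e) ⊗ₜ x := rfl

theorem lmul_lmul (a b : A) (z : A ⊗[K] V) : lmul V a (lmul V b z) = lmul V (a * b) z := by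
  induction z with
  | zero => simp
  | tmul e x => simp [mul_assoc]
  | add x y hx hy => simp only [map_add, hx, hy]

theorem lmul_neg (a : A) (z : A ⊗[K] V) : lmul V (-a) z = -lmul V a z := by
  induction z with
  | zero => simp
  | tmul e x => simp [TensorProduct.neg_tmul]
  | add x y hx hy => simp only [map_add, hx, hy, neg_add]

@[simp] theorem lmul_zero (z : A ⊗[K] V) : lmul V (0 : A) z = 0 := by
  induction z with
  | zero => simp
  | tmul e x => simp
  | add x y hx hy => simp only [map_add, hx, hy, add_zero]

theorem lTensor_lmul (L : V →ₗ[K] W) (a : A) (z : A ⊗[K] V) :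
    L.lTensor A (lmul V a z) = lmul W a (L.lTensor A z) := by
  induction z with
  | zero => simp
  | tmul e x => simp
  | add x y hx hy => simp only [map_add, hx, hy]

/-- A scalar leaves the first slot on the left without passing any other coefficient, hence without
a sign. For this reason derivatives insert their direction in the first slot. -/
theorem tens_lmul_cons {k : ℕ} (Φ : MultilinearMap K (fun _ : Fin (k + 1) => V) W) (a : A)
    (z : A ⊗[K] V) (v : Fin k → A ⊗[K] V) :
    tens A Φ (Fin.cons (lmul V a z) v) = lmul W a (tens A Φ (Fin.cons z v)) := by
  have : (tens A Φ).compLinearMap (Fin.cons (lmul V a) fun _ => LinearMap.id) =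
      (lmul W a).compMultilinearMap (tens A Φ) := by
    refine tens_ext fun e x => ?_
    have h : (fun i : Fin (k + 1) => (Fin.cons (lmul V a) (fun _ => LinearMap.id) :
        Fin (k + 1) → A ⊗[K] V →ₗ[K] A ⊗[K] V) i (e i ⊗ₜ x i)) =
        fun i => (Fin.cons (a * e 0) (fun j => e j.succ) : Fin (k + 1) → A) i ⊗ₜ x i := by
      funext i
      refine Fin.cases ?_ (fun j => ?_) i <;> simp
    simp only [MultilinearMap.compLinearMap_apply, LinearMap.compMultilinearMap_apply]
    rw [h, tens_tmul, tens_tmul]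
    simp [List.ofFn_succ, mul_assoc]
  have h2 := MultilinearMap.congr_fun this (Fin.cons z v)
  rw [MultilinearMap.compLinearMap_apply, LinearMap.compMultilinearMap_apply] at h2
  rw [← h2]
  congr 1
  funext i
  refine Fin.cases ?_ (fun j => ?_) i <;> simp

end Tens

/-! ### Koszul signs -/

section Koszul

/-- Products over pairs `p < q` of a symmetric function are invariant under permutations. -/
theorem Finset.prod_pairs_comp_perm {n : ℕ} {M : Type*} [CommMonoid M] (σ : Perm (Fin n))
    (g : Fin n → Fin n → M) (hg : ∀ p q, g p q = g q p) :
    ∏ p, ∏ q, (if p < q then g (σ p) (σ q) else 1) = ∏ p, ∏ q, (if p < q then g p q else 1) := by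
  rw [← Finset.prod_product', ← Finset.prod_product', ← Finset.prod_filter, ← Finset.prod_filter]
  refine Finset.prod_bij (fun x _ => (σ x.1 ⊓ σ x.2, σ x.1 ⊔ σ x.2)) ?_ ?_ ?_ ?_
  · rintro ⟨p, q⟩ h
    simp only [Finset.mem_filter, Finset.univ_product_univ, Finset.mem_univ, true_and] at h ⊢
    exact inf_le_sup.lt_of_ne <| by simp [h.ne]
  · rintro ⟨p, q⟩ h ⟨p', q'⟩ h' e
    simp only [Finset.mem_filter, Finset.univ_product_univ, Finset.mem_univ, true_and] at h h'
    simp only [Prod.mk.injEq] at e ⊢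
    rcases le_total (σ p) (σ q) with h1 | h1 <;> rcases le_total (σ p') (σ q') with h2 | h2 <;>
      simp only [inf_of_le_left, inf_of_le_right, sup_of_le_left, sup_of_le_right, h1, h2] at e <;>
      obtain ⟨e1, e2⟩ := e <;> have e1 := σ.injective e1 <;> have e2 := σ.injective e2
    · exact ⟨e1, e2⟩
    · subst e1 e2; exact absurd h (not_lt.mpr h'.le)
    · subst e1 e2; exact absurd h (not_lt.mpr h'.le)
    · exact ⟨e2, e1⟩
  · rintro ⟨p, q⟩ h
    simp only [Finset.mem_filter, Finset.univ_product_univ, Finset.mem_univ, true_and] at h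
    rcases lt_or_ge (σ.symm p) (σ.symm q) with h1 | h1
    · exact ⟨(σ.symm p, σ.symm q), by simpa using h1, by simp [h.le]⟩
    · refine ⟨(σ.symm q, σ.symm p), ?_, by simp [h.le]⟩
      simpa using h1.lt_of_ne (by simp [h.ne'])
  · rintro ⟨p, q⟩ h
    rcases le_total (σ p) (σ q) with h1 | h1
    · simp [h1]
    · simp [h1, hg (σ p)]

/-- A pair is inverted by `σ * τ` exactly when one, but not both, of the two steps inverts it; a
pair inverted twice contributes a square of a sign. -/
theorem koszulSign_mul {k : ℕ} (d : Fin k → ℤ) (σ τ : Perm (Fin k)) :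
    koszulSign d (σ * τ) = koszulSign d σ * koszulSign (fun j => d (σ j)) τ := by
  -- Rewrite the inversion condition so that the factor is symmetric in `p` and `q`; only then can
  -- the product over pairs be reindexed by `τ`.
  have h1 : koszulSign d σ = ∏ p, ∏ q, if p < q then
      (if (σ p < σ q ↔ p < q) then 1 else Int.negOnePow (d (σ p) * d (σ q))) else 1 := by
    unfold koszulSign
    refine Finset.prod_congr rfl fun p _ => Finset.prod_congr rfl fun q _ => ?_
    by_cases h : p < q
    · have : σ p ≠ σ q := σ.injective.ne h.ne
      by_cases h' : σ q < σ p
      · simp [h, h', h'.not_gt]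
      · simp [h, h', lt_of_le_of_ne (not_lt.mp h') this]
    · simp [h]
  rw [h1, ← Finset.prod_pairs_comp_perm τ (fun p q => if (σ p < σ q ↔ p < q) then 1 else
    Int.negOnePow (d (σ p) * d (σ q)))]
  · unfold koszulSign
    simp only [← Finset.prod_mul_distrib]
    refine Finset.prod_congr rfl fun p _ => Finset.prod_congr rfl fun q _ => ?_
    by_cases h : p < q
    · have e1 : τ p ≠ τ q := τ.injective.ne h.ne
      have e2 : σ (τ p) ≠ σ (τ q) := σ.injective.ne e1
      have hs := Int.units_mul_self (Int.negOnePow (d (σ (τ p)) * d (σ (τ q))))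
      rcases lt_or_gt_of_ne e1 with a | a <;> rcases lt_or_gt_of_ne e2 with b | b <;>
        simp [h, a, b, a.not_gt, b.not_gt, hs]
    · simp [h]
  · intro p q
    by_cases h : p = q
    · subst h; rfl
    · have e : σ p ≠ σ q := σ.injective.ne h
      rw [mul_comm (d (σ p))]
      congr 1
      rw [eq_iff_iff]
      rcases lt_or_gt_of_ne h with a | a <;> rcases lt_or_gt_of_ne e with b | b <;>
        simp [a, b, a.not_gt, b.not_gt]

theorem koszulSign_mul_self {K : Type*} [Field K] {k : ℕ} (d : Fin k → ℤ) (τ : Perm (Fin k)) :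
    ((koszulSign d τ : ℤ) : K) * ((koszulSign d τ : ℤ) : K) = 1 := by
  rw [← Int.cast_mul, ← Units.val_mul, Int.units_mul_self]
  simp

theorem koszulSign_swap_adjacent {k : ℕ} (d : Fin (k + 1) → ℤ) (i : Fin k) :
    koszulSign d (Equiv.swap i.castSucc i.succ) = Int.negOnePow (d i.castSucc * d i.succ) := by
  unfold koszulSign
  have hne : i.castSucc ≠ i.succ := Fin.castSucc_lt_succ.ne
  rw [Finset.prod_eq_single i.castSucc, Finset.prod_eq_single i.succ]
  · simp [mul_comm]
  · intro q _ hq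
    rw [if_neg]
    rintro ⟨h1, h2⟩
    rw [Equiv.swap_apply_left, Equiv.swap_apply_of_ne_of_ne h1.ne' hq] at h2
    rw [Fin.lt_def] at h1 h2
    simp at h1 h2
    omega
  · simp
  · intro p _ hp
    refine Finset.prod_eq_one fun q _ => ?_
    rw [if_neg]
    rintro ⟨h1, h2⟩
    by_cases e : p = i.succ
    · subst e
      rw [Equiv.swap_apply_right, Equiv.swap_apply_of_ne_of_ne
        (Fin.castSucc_lt_succ.trans h1).ne' h1.ne'] at h2
      rw [Fin.lt_def] at h1 h2
      simp at h1 h2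
      omega
    · rw [Equiv.swap_apply_of_ne_of_ne hp e] at h2
      by_cases e1 : q = i.castSucc
      · subst e1
        rw [Equiv.swap_apply_left] at h2
        rw [Fin.lt_def] at h1 h2
        simp at h1 h2
        omega
      by_cases e2 : q = i.succ
      · subst e2
        rw [Equiv.swap_apply_right] at h2
        rw [Fin.lt_def] at h1 h2
        simp at h1 h2
        have : (p : ℕ) ≠ i := fun h => hp (Fin.ext h)
        omega
      · rw [Equiv.swap_apply_of_ne_of_ne e1 e2] at h2
        exact absurd h1 h2.not_gt
  · simp

/-- The sign sees only parities. This allows symmetrization to be defined by a finite sum over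
parity vectors. -/
theorem koszulSign_congr {k : ℕ} {d d' : Fin k → ℤ} (h : ∀ i, (Even (d i) ↔ Even (d' i)))
    (τ : Perm (Fin k)) : koszulSign d τ = koszulSign d' τ := by
  unfold koszulSign
  refine Finset.prod_congr rfl fun p _ => Finset.prod_congr rfl fun q _ => ?_
  congr 1
  rw [Int.negOnePow_eq_iff, Int.even_sub, Int.even_mul, Int.even_mul, h, h]

/-- In a graded commutative algebra, permuting a product of homogeneous elements produces the
Koszul sign. -/
theorem prod_ofFn_perm {A : Type*} [Ring A] {k : ℕ} (d : Fin k → ℤ) (e : Fin k → A)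
    (comm : ∀ i j, e i * e j = ((Int.negOnePow (d i * d j) : ℤ) : A) * (e j * e i))
    (σ : Perm (Fin k)) :
    (List.ofFn fun i => e (σ i)).prod = ((koszulSign d σ : ℤ) : A) * (List.ofFn e).prod := by
  rcases k with _ | k
  · rw [Subsingleton.elim σ 1, koszulSign_one]; simp
  -- Adjacent transpositions generate the symmetric group as a monoid, and `koszulSign_mul` handles
  -- products, so it remains to swap two neighbouring factors.
  have hσ : σ ∈ Submonoid.closure
      (Set.range fun i : Fin k => Equiv.swap i.castSucc i.succ) := by
    rw [Equiv.Perm.mclosure_swap_castSucc_succ]; trivial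
  induction hσ using Submonoid.closure_induction generalizing d e with
  | one => simp [koszulSign_one]
  | mul σ τ _ _ hσ hτ =>
    have h1 := hτ (fun i => d (σ i)) (fun i => e (σ i)) (fun i j => comm _ _)
    simp only [Equiv.Perm.mul_apply]
    rw [h1, hσ d e comm, koszulSign_mul]
    push_cast
    rw [← mul_assoc]
    congr 1
    exact (Int.cast_commute _ _).eq
  | mem σ hσ =>
    obtain ⟨i, rfl⟩ := hσ
    rw [koszulSign_swap_adjacent]
    have key : ∀ (l : List A) (j : ℕ) (h : j + 1 < l.length), ∀ (ε : ℤ),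
        l[j + 1] * l[j] = (ε : A) * (l[j] * l[j + 1]) →
        ((l.set j l[j + 1]).set (j + 1) l[j]).prod = (ε : A) * l.prod := by
      intro l
      induction l with
      | nil => intro j h; simp at h
      | cons a l ih =>
        intro j h ε hε
        rcases j with _ | j
        · rcases l with _ | ⟨b, l⟩
          · simp at h
          · simp only [zero_add, List.getElem_cons_succ, List.getElem_cons_zero] at hε
            simp only [zero_add, List.getElem_cons_succ, List.getElem_cons_zero, List.set_cons_zero,
              List.set_cons_succ, List.prod_cons]
            rw [← mul_assoc, hε]; simp only [mul_assoc]
        · simp only [List.getElem_cons_succ, List.set_cons_succ, List.prod_cons] at hε ⊢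
          rw [ih j (by simpa using h) ε hε, ← mul_assoc, ← mul_assoc]
          congr 1
          exact ((Int.cast_commute _ _).eq).symm
    have := key (List.ofFn e) i (by simp) (Int.negOnePow (d i.castSucc * d i.succ)) (by
      have := comm i.succ i.castSucc
      rw [mul_comm (d i.succ)] at this
      simp only [List.getElem_ofFn]; exact this)
    rw [← this]
    congr 1
    apply List.ext_getElem
    · simp
    · intro n h1 h2
      simp only [List.getElem_ofFn, List.getElem_set]
      by_cases a : (i : ℕ) + 1 = n
      · subst a
        rw [if_pos rfl]
        congr 1
        exact Equiv.swap_apply_right _ _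
      · rw [if_neg a]
        by_cases b : (i : ℕ) = n
        · subst b
          rw [if_pos rfl]
          congr 1
          exact Equiv.swap_apply_left _ _
        · rw [if_neg b]
          congr 1
          refine Equiv.swap_apply_of_ne_of_ne ?_ ?_
          · intro h; exact b (by simpa using (congrArg Fin.val h).symm)
          · intro h; exact a (by simpa using (congrArg Fin.val h).symm)

end Koszul

/-! ### Graded vector spaces -/

/-- A `ℤ`-graded vector space. -/
structure GMod (K : Type u) [Field K] where
  carrier : Type v
  [addCommGroup : AddCommGroup carrier]
  [module : Module K carrier]
  /-- the homogeneous part of each degree -/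
  deg : ℤ → Submodule K carrier
  isInternal : DirectSum.IsInternal deg

namespace GMod

variable {K : Type u} [Field K]

instance : CoeSort (GMod.{u, v} K) (Type v) := ⟨GMod.carrier⟩

attribute [instance] GMod.addCommGroup GMod.module

section Lift

variable (V : GMod.{u, v} K) {W : Type*} [AddCommGroup W] [Module K W]

/-- The isomorphism from the direct sum of the homogeneous parts. -/
noncomputable def ofDirectSum : (DirectSum ℤ fun n => V.deg n) ≃ₗ[K] V :=
  LinearEquiv.ofBijective (DirectSum.coeLinearMap V.deg)
    (show Function.Bijective (DirectSum.coeAddMonoidHom V.deg) from V.isInternal)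

theorem ofDirectSum_of (n : ℤ) (x : V.deg n) :
    V.ofDirectSum (DirectSum.of (fun n => V.deg n) n x) = x :=
  DirectSum.coeAddMonoidHom_of _ _ _

/-- The linear map with given restrictions to the homogeneous parts. -/
noncomputable def lift (φ : ∀ n, V.deg n →ₗ[K] W) : V →ₗ[K] W :=
  (DirectSum.toModule K ℤ W φ) ∘ₗ V.ofDirectSum.symm.toLinearMap

theorem lift_of_mem (φ : ∀ n, V.deg n →ₗ[K] W) {n : ℤ} {x : V} (hx : x ∈ V.deg n) :
    V.lift φ x = φ n ⟨x, hx⟩ := by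
  have : V.ofDirectSum.symm x = DirectSum.lof K ℤ (fun n => V.deg n) n ⟨x, hx⟩ := by
    rw [LinearEquiv.symm_apply_eq]
    exact (V.ofDirectSum_of n ⟨x, hx⟩).symm
  simp only [lift, LinearMap.comp_apply, LinearEquiv.coe_coe, this, DirectSum.toModule_lof]

theorem span_homogeneous : Submodule.span K {x : V | ∃ n, x ∈ V.deg n} = ⊤ := by
  rw [← V.isInternal.submodule_iSup_eq_top, Submodule.iSup_eq_span]
  congr 1; ext x; simp

theorem mem_span_homogeneous (x : V) : x ∈ Submodule.span K {x : V | ∃ n, x ∈ V.deg n} := by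
  rw [V.span_homogeneous]; trivial

theorem linearMap_ext {f g : V →ₗ[K] W} (h : ∀ n, ∀ x ∈ V.deg n, f x = g x) : f = g := by
  ext x
  refine LinearMap.eqOn_span (s := {x : V | ∃ n, x ∈ V.deg n}) ?_ (V.mem_span_homogeneous x)
  rintro x ⟨n, hx⟩
  exact h n x hx

theorem multilinear_ext {k : ℕ} {Φ Ψ : MultilinearMap K (fun _ : Fin k => V) W}
    (h : ∀ (d : Fin k → ℤ) (a : Fin k → V), (∀ j, a j ∈ V.deg (d j)) → Φ a = Ψ a) : Φ = Ψ := by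
  refine MultilinearMap.ext fun v => ?_
  refine Φ.eq_of_forall_mem_span Ψ (fun _ => {x : V | ∃ n, x ∈ V.deg n}) ?_ v
    fun i => V.mem_span_homogeneous _
  intro s hs
  choose d hd using hs
  exact h d s hd

/-- The projection to the homogeneous part of degree `n`. -/
noncomputable def proj (n : ℤ) : V →ₗ[K] V :=
  V.lift fun m => if m = n then (V.deg m).subtype else 0

theorem proj_of_mem {n : ℤ} {x : V} (hx : x ∈ V.deg n) : V.proj n x = x := by
  rw [proj, lift_of_mem V _ hx, if_pos rfl]; rfl

theorem proj_of_mem_ne {n m : ℤ} {x : V} (hx : x ∈ V.deg m) (h : m ≠ n) : V.proj n x = 0 := by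
  rw [proj, lift_of_mem V _ hx, if_neg h]; rfl

theorem proj_mem (n : ℤ) (x : V) : V.proj n x ∈ V.deg n := by
  have hx := V.mem_span_homogeneous x
  induction hx using Submodule.span_induction with
  | mem x hx =>
    obtain ⟨m, hm⟩ := hx
    by_cases h : m = n
    · subst h; rwa [V.proj_of_mem hm]
    · rw [V.proj_of_mem_ne hm h]; exact zero_mem _
  | zero => rw [map_zero]; exact zero_mem _
  | add x y _ _ hx hy => rw [map_add]; exact add_mem hx hy
  | smul c x _ hx => rw [map_smul]; exact Submodule.smul_mem _ _ hx

theorem eq_zero_of_proj {x : V} (h : ∀ n, V.proj n x = 0) : x = 0 := by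
  obtain ⟨y, rfl⟩ := V.ofDirectSum.surjective x
  have hy : ∀ (y : DirectSum ℤ fun n => V.deg n) (n : ℤ), V.proj n (V.ofDirectSum y) = y n := by
    intro y n
    induction y using DirectSum.induction_on with
    | zero => simp
    | of m z =>
      rw [V.ofDirectSum_of]
      by_cases hm : m = n
      · subst hm; rw [V.proj_of_mem z.2, DirectSum.of_eq_same]
      · rw [V.proj_of_mem_ne z.2 hm, DirectSum.of_eq_of_ne _ _ _ (Ne.symm hm)]; rfl
    | add a b ha hb => simp [ha, hb]
  have : y = 0 := DFinsupp.ext fun n => Subtype.ext ((hy y n).symm.trans (h n))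
  rw [this, map_zero]

/-- Every element is a finite sum of its homogeneous components. -/
theorem exists_sum_proj (x : V) : ∃ s : Finset ℤ, x = ∑ n ∈ s, V.proj n x := by
  have hx := V.mem_span_homogeneous x
  obtain ⟨s, hs⟩ : ∃ s : Finset ℤ, ∀ n ∉ s, V.proj n x = 0 := by
    induction hx using Submodule.span_induction with
    | mem x hx =>
      obtain ⟨m, hm⟩ := hx
      exact ⟨{m}, fun n hn => V.proj_of_mem_ne hm (by simpa [eq_comm] using hn)⟩
    | zero => exact ⟨∅, by simp⟩
    | add x y _ _ hx hy =>
      classical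
      obtain ⟨s, hs⟩ := hx
      obtain ⟨t, ht⟩ := hy
      refine ⟨s ∪ t, fun n hn => ?_⟩
      rw [Finset.mem_union, not_or] at hn
      rw [map_add, hs n hn.1, ht n hn.2, add_zero]
    | smul c x _ hx =>
      obtain ⟨s, hs⟩ := hx
      exact ⟨s, fun n hn => by rw [map_smul, hs n hn, smul_zero]⟩
  refine ⟨s, sub_eq_zero.mp (V.eq_zero_of_proj fun n => ?_)⟩
  rw [map_sub, map_sum]
  by_cases hn : n ∈ s
  · rw [Finset.sum_eq_single_of_mem n hn fun m _ hm => V.proj_of_mem_ne (V.proj_mem m x) hm,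
      V.proj_of_mem (V.proj_mem n x), sub_self]
  · rw [hs n hn, Finset.sum_eq_zero, sub_zero]
    intro m hm
    exact V.proj_of_mem_ne (V.proj_mem m x) fun h => hn (h ▸ hm)

/-- The projection to the part of parity `b`. -/
noncomputable def par (b : Fin 2) : V →ₗ[K] V :=
  V.lift fun m => if m % 2 = (b : ℤ) then (V.deg m).subtype else 0

theorem par_of_mem {n : ℤ} {x : V} (hx : x ∈ V.deg n) (b : Fin 2) :
    V.par b x = if n % 2 = (b : ℤ) then x else 0 := by
  rw [par, lift_of_mem V _ hx]; split_ifs <;> rfl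

end Lift

/-- A criterion for an internal direct sum decomposition in terms of projections. -/
theorem isInternal_of_proj {V : Type*} [AddCommGroup V] [Module K V] {deg : ℤ → Submodule K V}
    (π : ℤ → V →ₗ[K] V) (h1 : ∀ n, ∀ x ∈ deg n, π n x = x)
    (h2 : ∀ n m, m ≠ n → ∀ x ∈ deg m, π n x = 0)
    (h3 : ∀ x, x ∈ ⨆ n, deg n) : DirectSum.IsInternal deg := by
  rw [DirectSum.isInternal_submodule_iff_iSupIndep_and_iSup_eq_top]
  refine ⟨?_, eq_top_iff.mpr fun x _ => h3 x⟩
  intro n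
  rw [Submodule.disjoint_def]
  intro x hx hx'
  have : (⨆ m, ⨆ (_ : m ≠ n), deg m) ≤ LinearMap.ker (π n) :=
    iSup_le fun m => iSup_le fun hm x hx => h2 n m hm x hx
  rw [← h1 n x hx]
  exact this hx'

/-- A homogeneous linear map of degree `q`. -/
def HomogLin (V : GMod.{u, v} K) (W : GMod.{u, w} K) (L : V →ₗ[K] W) (q : ℤ) : Prop :=
  ∀ n, ∀ x ∈ V.deg n, L x ∈ W.deg (n + q)

/-- The product of two graded vector spaces. -/
def prod (V : GMod.{u, v} K) (W : GMod.{u, w} K) : GMod.{u, max v w} K where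
  carrier := V × W
  deg n := (V.deg n).prod (W.deg n)
  isInternal := by
    refine isInternal_of_proj (fun n => (V.proj n).prodMap (W.proj n)) ?_ ?_ ?_
    · rintro n ⟨x, y⟩ ⟨hx, hy⟩
      exact Prod.ext (V.proj_of_mem hx) (W.proj_of_mem hy)
    · rintro n m h ⟨x, y⟩ ⟨hx, hy⟩
      exact Prod.ext (V.proj_of_mem_ne hx h) (W.proj_of_mem_ne hy h)
    · rintro ⟨x, y⟩
      have e : ((x, y) : V × W) = LinearMap.inl K V W x + LinearMap.inr K V W y := by simp
      rw [e]
      refine add_mem ?_ ?_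
      · have hx : x ∈ ⨆ n, V.deg n := by rw [V.isInternal.submodule_iSup_eq_top]; trivial
        have : (⨆ n, V.deg n) ≤ (⨆ n, (V.deg n).prod (W.deg n)).comap (LinearMap.inl K V W) :=
          iSup_le fun n x hx => Submodule.mem_iSup_of_mem n ⟨hx, zero_mem _⟩
        exact this hx
      · have hy : y ∈ ⨆ n, W.deg n := by rw [W.isInternal.submodule_iSup_eq_top]; trivial
        have : (⨆ n, W.deg n) ≤ (⨆ n, (V.deg n).prod (W.deg n)).comap (LinearMap.inr K V W) :=
          iSup_le fun n x hx => Submodule.mem_iSup_of_mem n ⟨zero_mem _, hx⟩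
        exact this hy

/-- The graded vector space `V ⊕ V[-1]`, for a formal variable of degree one. -/
def tan (V : GMod.{u, v} K) : GMod.{u, v} K where
  carrier := V × V
  deg n := (V.deg n).prod (V.deg (n - 1))
  isInternal := by
    refine isInternal_of_proj (fun n => (V.proj n).prodMap (V.proj (n - 1))) ?_ ?_ ?_
    · rintro n ⟨x, y⟩ ⟨hx, hy⟩
      exact Prod.ext (V.proj_of_mem hx) (V.proj_of_mem hy)
    · rintro n m h ⟨x, y⟩ ⟨hx, hy⟩
      exact Prod.ext (V.proj_of_mem_ne hx h) (V.proj_of_mem_ne hy (by omega))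
    · rintro ⟨x, y⟩
      have e : ((x, y) : V × V) = LinearMap.inl K V V x + LinearMap.inr K V V y := by simp
      rw [e]
      refine add_mem ?_ ?_
      · have hx : x ∈ ⨆ n, V.deg n := by rw [V.isInternal.submodule_iSup_eq_top]; trivial
        have : (⨆ n, V.deg n) ≤ (⨆ n, (V.deg n).prod (V.deg (n - 1))).comap
            (LinearMap.inl K V V) :=
          iSup_le fun n x hx => Submodule.mem_iSup_of_mem n ⟨hx, zero_mem _⟩
        exact this hx
      · have hy : y ∈ ⨆ n, V.deg n := by rw [V.isInternal.submodule_iSup_eq_top]; trivial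
        have : (⨆ n, V.deg n) ≤ (⨆ n, (V.deg n).prod (V.deg (n - 1))).comap
            (LinearMap.inr K V V) :=
          iSup_le fun n x hx => Submodule.mem_iSup_of_mem (n + 1)
            ⟨zero_mem _, by simpa using hx⟩
        exact this hy

/-- The first projection of `V ⊕ V[-1]`. -/
def tanFst (V : GMod.{u, v} K) : V.tan →ₗ[K] V := LinearMap.fst K V V

/-- The second projection of `V ⊕ V[-1]`. -/
def tanSnd (V : GMod.{u, v} K) : V.tan →ₗ[K] V := LinearMap.snd K V V

/-- The first inclusion of `V ⊕ V[-1]`. -/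
def tanInl (V : GMod.{u, v} K) : V →ₗ[K] V.tan := LinearMap.inl K V V

/-- The second inclusion of `V ⊕ V[-1]`. -/
def tanInr (V : GMod.{u, v} K) : V →ₗ[K] V.tan := LinearMap.inr K V V

theorem homogLin_tanFst (V : GMod.{u, v} K) : HomogLin V.tan V V.tanFst 0 := by
  intro n x hx; rw [add_zero]; exact hx.1

theorem homogLin_tanSnd (V : GMod.{u, v} K) : HomogLin V.tan V V.tanSnd (-1) :=
  fun _ _ hx => hx.2

theorem homogLin_tanInl (V : GMod.{u, v} K) : HomogLin V V.tan V.tanInl 0 := by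
  intro n x hx; rw [add_zero]; exact ⟨hx, zero_mem _⟩

theorem homogLin_tanInr (V : GMod.{u, v} K) : HomogLin V V.tan V.tanInr 1 := by
  intro n x hx
  refine ⟨zero_mem _, ?_⟩
  rw [add_sub_cancel_right]
  exact hx

@[simp] theorem tanFst_comp_tanInl (V : GMod.{u, v} K) :
    V.tanFst ∘ₗ V.tanInl = LinearMap.id := rfl

@[simp] theorem tanFst_comp_tanInr (V : GMod.{u, v} K) : V.tanFst ∘ₗ V.tanInr = 0 := rfl

@[simp] theorem tanSnd_comp_tanInl (V : GMod.{u, v} K) : V.tanSnd ∘ₗ V.tanInl = 0 := rfl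

@[simp] theorem tanSnd_comp_tanInr (V : GMod.{u, v} K) :
    V.tanSnd ∘ₗ V.tanInr = LinearMap.id := rfl

theorem tanInl_add_tanInr (V : GMod.{u, v} K) :
    V.tanInl ∘ₗ V.tanFst + V.tanInr ∘ₗ V.tanSnd = LinearMap.id := by
  refine LinearMap.ext fun x => Prod.ext ?_ ?_
  · exact add_zero _
  · exact zero_add _

/-- Polynomials in a variable of degree zero with coefficients in `V`. -/
noncomputable def poly (V : GMod.{u, v} K) : GMod.{u, v} K where
  carrier := ℕ →₀ V
  deg n :=
    { carrier := {p | ∀ i, p i ∈ V.deg n}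
      add_mem' := fun hp hq i => add_mem (hp i) (hq i)
      zero_mem' := fun _ => zero_mem _
      smul_mem' := fun c _ hp i => Submodule.smul_mem _ c (hp i) }
  isInternal := by
    refine isInternal_of_proj (fun n => Finsupp.mapRange.linearMap (V.proj n)) ?_ ?_ ?_
    · intro n p hp
      ext i
      exact V.proj_of_mem (hp i)
    · intro n m h p hp
      ext i
      exact V.proj_of_mem_ne (hp i) h
    · intro p
      induction p using Finsupp.induction_linear with
      | zero => exact zero_mem _
      | add p q hp hq => exact add_mem hp hq
      | single i x =>
        have hx : x ∈ ⨆ n, V.deg n := by rw [V.isInternal.submodule_iSup_eq_top]; trivial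
        induction hx using Submodule.iSup_induction' with
        | zero => rw [Finsupp.single_zero]; exact zero_mem _
        | add x y _ _ hx hy => rw [Finsupp.single_add]; exact add_mem hx hy
        | mem n x hx =>
          refine Submodule.mem_iSup_of_mem n fun j => ?_
          rw [Finsupp.single_apply]
          split_ifs
          exacts [hx, zero_mem _]

/-- A homogeneous subspace as a graded vector space. -/
def sub (V : GMod.{u, v} K) (R : Submodule K V) (hR : ∀ n, ∀ x ∈ R, V.proj n x ∈ R) :
    GMod.{u, v} K where
  carrier := R
  deg n := (V.deg n).comap R.subtype
  isInternal := by
    refine isInternal_of_proj (fun n => (V.proj n).restrict (hR n)) ?_ ?_ ?_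
    · intro n x hx
      exact Subtype.ext (V.proj_of_mem hx)
    · intro n m h x hx
      exact Subtype.ext (V.proj_of_mem_ne hx h)
    · intro x
      obtain ⟨s, hs⟩ := V.exists_sum_proj x
      have hs' : x = ∑ n ∈ s, (⟨V.proj n x, hR n x x.2⟩ : R) := by
        refine Subtype.ext ?_
        rw [AddSubmonoidClass.coe_finsetSum]
        exact hs
      rw [hs']
      exact Submodule.sum_mem _ fun n _ => Submodule.mem_iSup_of_mem n (V.proj_mem n x)

end GMod

/-- The graded vector space underlying an `L_∞[1]`-algebra. -/
@[reducible] def LInftyAlgebra.toGMod {K : Type u} [Field K] (C : LInftyAlgebra.{u, v} K) :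
    GMod.{u, v} K where
  carrier := C.carrier
  deg := C.deg
  isInternal := C.isInternal

/-! ### Families of graded symmetric maps -/

section Sym

variable {K : Type u} [Field K] {V : GMod.{u, v} K} {W : GMod.{u, w} K}

/-- A multilinear map of degree `p`. -/
def IsHomog {k : ℕ} (Φ : MultilinearMap K (fun _ : Fin k => V) W) (p : ℤ) : Prop :=
  ∀ (d : Fin k → ℤ) (a : Fin k → V), (∀ j, a j ∈ V.deg (d j)) → Φ a ∈ W.deg ((∑ j, d j) + p)

/-- The graded symmetrization `∑_τ sgn(τ) Φ ∘ τ` of a multilinear map. -/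
noncomputable def gsym {X : Type*} [AddCommGroup X] [Module K X] {k : ℕ}
    (Φ : MultilinearMap K (fun _ : Fin k => V) X) :
    MultilinearMap K (fun _ : Fin k => V) X :=
  ∑ τ : Perm (Fin k), ∑ δ : Fin k → Fin 2,
    ((koszulSign (fun j => ((δ j : ℕ) : ℤ)) τ : ℤ) : K) •
      (Φ.domDomCongr τ).compLinearMap fun j => V.par (δ j)

/-- A multilinear map cannot read degrees off its arguments, so `gsym` sums over all parity vectors
`δ`. On homogeneous arguments every `δ` other than the true one projects some argument to zero. -/
theorem gsym_apply {X : Type*} [AddCommGroup X] [Module K X] {k : ℕ}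
    (Φ : MultilinearMap K (fun _ : Fin k => V) X) (d : Fin k → ℤ) (a : Fin k → V)
    (ha : ∀ j, a j ∈ V.deg (d j)) :
    gsym Φ a = ∑ τ : Perm (Fin k), ((koszulSign d τ : ℤ) : K) • Φ fun j => a (τ j) := by
  simp only [gsym, sum_apply, smul_apply,
    MultilinearMap.compLinearMap_apply, MultilinearMap.domDomCongr_apply]
  refine Finset.sum_congr rfl fun τ _ => ?_
  let δ₀ : Fin k → Fin 2 := fun j => ⟨(d j % 2).toNat, by omega⟩
  have hδ : ∀ j, d j % 2 = ((δ₀ j : ℕ) : ℤ) := fun j => by simp only [δ₀]; omega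
  rw [Finset.sum_eq_single δ₀]
  · congr 2
    · refine congrArg Units.val (koszulSign_congr (fun i => ?_) τ)
      rw [← hδ, Int.even_iff, Int.even_iff]; omega
    · funext j
      rw [V.par_of_mem (ha _), if_pos (hδ _)]
  · intro δ _ hne
    obtain ⟨j, hj⟩ := Function.ne_iff.mp hne
    rw [Φ.map_coord_zero (τ.symm j), smul_zero]
    rw [Equiv.apply_symm_apply, V.par_of_mem (ha _), if_neg]
    intro h
    rw [hδ] at h
    exact hj (Fin.ext (by exact_mod_cast h.symm))
  · simp

theorem gsym_symm {X : Type*} [AddCommGroup X] [Module K X] {k : ℕ}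
    (Φ : MultilinearMap K (fun _ : Fin k => V) X) (d : Fin k → ℤ) (a : Fin k → V)
    (ha : ∀ j, a j ∈ V.deg (d j)) (σ : Perm (Fin k)) :
    gsym Φ (fun j => a (σ j)) = ((koszulSign d σ : ℤ) : K) • gsym Φ a := by
  rw [gsym_apply Φ d a ha, gsym_apply Φ (fun j => d (σ j)) _ fun j => ha _, Finset.smul_sum]
  conv_rhs => rw [← Equiv.sum_comp (Equiv.mulLeft σ)]
  refine Finset.sum_congr rfl fun τ _ => ?_
  simp only [Equiv.coe_mulLeft, Equiv.Perm.mul_apply]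
  rw [koszulSign_mul, smul_smul]
  push_cast
  rw [← mul_assoc, koszulSign_mul_self, one_mul]

theorem IsHomog.gsym {k : ℕ} {Φ : MultilinearMap K (fun _ : Fin k => V) W} {p : ℤ}
    (h : IsHomog Φ p) : IsHomog (gsym Φ) p := by
  intro d a ha
  rw [gsym_apply Φ d a ha]
  refine Submodule.sum_mem _ fun τ _ => Submodule.smul_mem _ _ ?_
  have := h (fun j => d (τ j)) (fun j => a (τ j)) fun j => ha _
  rwa [Equiv.sum_comp τ d] at this

theorem IsHomog.sum {k : ℕ} {ι : Type*} {s : Finset ι}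
    {Φ : ι → MultilinearMap K (fun _ : Fin k => V) W} {p : ℤ}
    (h : ∀ i ∈ s, IsHomog (Φ i) p) : IsHomog (∑ i ∈ s, Φ i) p := by
  intro d a ha
  rw [sum_apply]
  exact Submodule.sum_mem _ fun i hi => h i hi d a ha

theorem IsHomog.smul {k : ℕ} {Φ : MultilinearMap K (fun _ : Fin k => V) W} {p : ℤ}
    (h : IsHomog Φ p) (c : K) : IsHomog (c • Φ) p :=
  fun d a ha => Submodule.smul_mem _ c (h d a ha)

end Sym

/-- A family of graded symmetric `k`-linear maps from `V` to `W`, for all `k ≥ 1`. -/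
@[ext] structure Fam {K : Type u} [Field K] (V : GMod.{u, v} K) (W : GMod.{u, w} K) where
  f : (k : ℕ) → MultilinearMap K (fun _ : Fin k => V) W
  symm : ∀ (k : ℕ) (d : Fin k → ℤ) (a : Fin k → V), (∀ j, a j ∈ V.deg (d j)) →
    ∀ σ : Perm (Fin k), f k (fun j => a (σ j)) = ((koszulSign d σ : ℤ) : K) • f k a
  zero : f 0 = 0

namespace Fam

variable {K : Type u} [Field K] {V : GMod.{u, v} K} {W : GMod.{u, w} K} {X : GMod.{u, x} K}

/-- All components have degree `p`. -/
def Homog (F : Fam V W) (p : ℤ) : Prop := ∀ k, IsHomog (F.f k) p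

theorem ext_homogeneous {F G : Fam V W} (h : ∀ (k : ℕ) (d : Fin k → ℤ) (a : Fin k → V),
    (∀ j, a j ∈ V.deg (d j)) → F.f k a = G.f k a) : F = G :=
  Fam.ext (funext fun k => V.multilinear_ext (h k))

/-- The family obtained by symmetrization. -/
noncomputable def ofSym (Φ : (k : ℕ) → MultilinearMap K (fun _ : Fin k => V) W)
    (h0 : Φ 0 = 0) : Fam V W where
  f k := gsym (Φ k)
  symm k := gsym_symm (Φ k)
  zero := by
    refine V.multilinear_ext fun d a ha => ?_
    rw [gsym_apply _ d a ha, h0]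
    simp

theorem homog_ofSym {Φ : (k : ℕ) → MultilinearMap K (fun _ : Fin k => V) W} {h0 : Φ 0 = 0} {p : ℤ}
    (h : ∀ k, IsHomog (Φ k) p) : (ofSym Φ h0).Homog p := fun k => (h k).gsym

instance : Zero (Fam V W) := ⟨{ f := 0, symm := by simp, zero := rfl }⟩

@[simp] theorem zero_f (k : ℕ) : (0 : Fam V W).f k = 0 := rfl

theorem zero_homog (p : ℤ) : (0 : Fam V W).Homog p := fun _ _ _ _ => zero_mem _

instance : Add (Fam V W) := ⟨fun F G =>
  { f := fun k => F.f k + G.f k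
    symm := fun k d a ha σ => by
      rw [add_apply, add_apply, F.symm k d a ha, G.symm k d a ha, smul_add]
    zero := by rw [F.zero, G.zero, add_zero] }⟩

@[simp] theorem add_f (F G : Fam V W) (k : ℕ) : (F + G).f k = F.f k + G.f k := rfl

theorem Homog.add {F G : Fam V W} {p : ℤ} (hF : F.Homog p) (hG : G.Homog p) : (F + G).Homog p :=
  fun k d a ha => add_mem (hF k d a ha) (hG k d a ha)

instance : Sub (Fam V W) := ⟨fun F G =>
  { f := fun k => F.f k - G.f k
    symm := fun k d a ha σ => by
      have h : ∀ b, (F.f k - G.f k) b = F.f k b - G.f k b := fun _ => rfl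
      rw [h, h, F.symm k d a ha, G.symm k d a ha, smul_sub]
    zero := by
      rw [F.zero, G.zero]
      exact MultilinearMap.ext fun v => sub_self _ }⟩

@[simp] theorem sub_f (F G : Fam V W) (k : ℕ) : (F - G).f k = F.f k - G.f k := rfl

theorem Homog.sub {F G : Fam V W} {p : ℤ} (hF : F.Homog p) (hG : G.Homog p) : (F - G).Homog p :=
  fun k d a ha => sub_mem (hF k d a ha) (hG k d a ha)

/-- Composition with a linear map on the target. -/
def post (L : W →ₗ[K] X) (F : Fam V W) : Fam V X where
  f k := L.compMultilinearMap (F.f k)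
  symm k d a ha σ := by
    rw [LinearMap.compMultilinearMap_apply, F.symm k d a ha, map_smul]; rfl
  zero := by rw [F.zero]; ext; simp

@[simp] theorem post_f (L : W →ₗ[K] X) (F : Fam V W) (k : ℕ) :
    (post L F).f k = L.compMultilinearMap (F.f k) := rfl

theorem Homog.post {L : W →ₗ[K] X} {F : Fam V W} {p q r : ℤ} (hF : F.Homog p)
    (hL : GMod.HomogLin W X L q) (h : r = p + q) : (Fam.post L F).Homog r := by
  subst h
  intro k d a ha
  rw [← add_assoc]
  exact hL _ _ (hF k d a ha)

/-- Composition with a linear map of degree zero on the source. -/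
def pre (F : Fam W X) (L : V →ₗ[K] W) (hL : GMod.HomogLin V W L 0) : Fam V X where
  f k := (F.f k).compLinearMap fun _ => L
  symm k d a ha σ := F.symm k d (fun j => L (a j)) (fun j => by simpa using hL _ _ (ha j)) σ
  zero := by rw [F.zero]; rfl

theorem Homog.pre {F : Fam W X} {L : V →ₗ[K] W} {p : ℤ} (hF : F.Homog p)
    (hL : GMod.HomogLin V W L 0) : (Fam.pre F L hL).Homog p :=
  fun k d a ha => hF k d (fun j => L (a j)) (fun j => by simpa using hL _ _ (ha j))

/-- A linear map as a family concentrated in arity one. -/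
def lin (L : V →ₗ[K] W) : Fam V W where
  f k := if h : k = 1 then
    { toFun := fun a => L (a ⟨0, by omega⟩)
      map_update_add' := by subst h; intro _ a i x y; simp [Subsingleton.elim i 0]
      map_update_smul' := by subst h; intro _ a i x y; simp [Subsingleton.elim i 0] } else 0
  symm k d a ha σ := by
    by_cases h : k = 1
    · subst h
      rw [Subsingleton.elim σ 1, koszulSign_one]
      simp
    · simp [h]
  zero := by simp

theorem lin_one (L : V →ₗ[K] W) (a : Fin 1 → V) : (lin L).f 1 a = L (a 0) := rfl

theorem lin_of_ne (L : V →ₗ[K] W) {k : ℕ} (h : k ≠ 1) : (lin L).f k = 0 := by simp [lin, h]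

theorem homog_lin {L : V →ₗ[K] W} {q : ℤ} (hL : GMod.HomogLin V W L q) : (lin L).Homog q := by
  intro k d a ha
  by_cases h : k = 1
  · subst h
    simpa [lin_one] using hL _ _ (ha 0)
  · simp [lin_of_ne L h]

section Comp

/-- The multilinear map `g(f_{j₁}(…), …, f_{j_t}(…))` for a composition `k = j₁ + ⋯ + j_t`. -/
def compAlong {V W X : Type*} [AddCommGroup V] [Module K V] [AddCommGroup W] [Module K W]
    [AddCommGroup X] [Module K X] {k : ℕ} (c : Composition k)
    (G : MultilinearMap K (fun _ : Fin c.length => W) X)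
    (F : (j : ℕ) → MultilinearMap K (fun _ : Fin j => V) W) :
    MultilinearMap K (fun _ : Fin k => V) X :=
  (G.compMultilinearMap fun i => F (c.blocksFun i)).domDomCongr c.blocksFinEquiv

theorem compAlong_apply {V W X : Type*} [AddCommGroup V] [Module K V] [AddCommGroup W] [Module K W]
    [AddCommGroup X] [Module K X] {k : ℕ} (c : Composition k)
    (G : MultilinearMap K (fun _ : Fin c.length => W) X)
    (F : (j : ℕ) → MultilinearMap K (fun _ : Fin j => V) W) (a : Fin k → V) :
    compAlong c G F a = G fun i => F (c.blocksFun i) fun j => a (c.embedding i j) := rfl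

/-- The composition of two families. -/
noncomputable def comp (G : Fam W X) (F : Fam V W) : Fam V X :=
  ofSym (fun k => ∑ c : Composition k,
    ((c.length.factorial : K) * ∏ i : Fin c.length, ((c.blocksFun i).factorial : K))⁻¹ •
      compAlong c (G.f c.length) F.f) (by
    refine Finset.sum_eq_zero fun c _ => ?_
    have h : ∀ m, m = 0 → G.f m = 0 := by rintro m rfl; exact G.zero
    rw [h c.length (by simp)]
    ext; simp [compAlong_apply])

theorem comp_f (G : Fam W X) (F : Fam V W) (k : ℕ) (d : Fin k → ℤ) (a : Fin k → V)
    (ha : ∀ j, a j ∈ V.deg (d j)) : (comp G F).f k a = compositionSum G.f F.f k d a := by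
  unfold compositionSum
  refine (gsym_apply _ d a ha).trans ?_
  rw [Finset.sum_comm]
  refine Finset.sum_congr rfl fun τ _ => ?_
  rw [sum_apply, Finset.smul_sum]
  refine Finset.sum_congr rfl fun c _ => ?_
  rw [smul_apply, compAlong_apply, smul_smul, div_eq_mul_inv]

theorem Homog.comp {G : Fam W X} {F : Fam V W} {p : ℤ} (hG : G.Homog p) (hF : F.Homog 0) :
    (Fam.comp G F).Homog p := by
  refine homog_ofSym fun k => IsHomog.sum fun c _ => IsHomog.smul ?_ _
  intro d a ha
  rw [compAlong_apply]
  have := hG c.length (fun i => ∑ j, d (c.embedding i j))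
    (fun i => F.f (c.blocksFun i) fun j => a (c.embedding i j)) fun i => by
      simpa using hF _ (fun j => d (c.embedding i j)) (fun j => a (c.embedding i j))
        fun j => ha _
  have e : ∑ j, d j = ∑ i, ∑ j, d (c.embedding i j) := by
    rw [← Equiv.sum_comp c.blocksFinEquiv d, Fintype.sum_sigma]
    rfl
  rwa [e]

end Comp

section Ins

/-- The equivalence `Fin i ⊕ Fin (k - i) ≃ Fin k` for `i ≤ k`. -/
def sumFinEquiv {k : ℕ} (i : Fin (k + 1)) : Fin (i : ℕ) ⊕ Fin (k - i) ≃ Fin k :=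
  finSumFinEquiv.trans (finCongr (by omega))

/-- The multilinear map `F(l(a₁, …, a_i), a_{i+1}, …, a_k)`. -/
def insAlong {V W : Type*} [AddCommGroup V] [Module K V] [AddCommGroup W] [Module K W] {k : ℕ}
    (i : Fin (k + 1)) (F : MultilinearMap K (fun _ : Fin (k - i + 1) => V) W)
    (l : MultilinearMap K (fun _ : Fin (i : ℕ) => V) V) :
    MultilinearMap K (fun _ : Fin k => V) W :=
  (MultilinearMap.uncurrySum (N := fun _ => V)
    (F.curryLeft.compMultilinearMap l)).domDomCongr (sumFinEquiv i)

theorem insAlong_apply {V W : Type*} [AddCommGroup V] [Module K V] [AddCommGroup W] [Module K W]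
    {k : ℕ} (i : Fin (k + 1)) (F : MultilinearMap K (fun _ : Fin (k - i + 1) => V) W)
    (l : MultilinearMap K (fun _ : Fin (i : ℕ) => V) V) (a : Fin k → V) :
    insAlong i F l a = F (Fin.cons
      (l fun j : Fin (i : ℕ) => a (Fin.castLE (Nat.lt_succ_iff.mp i.isLt) j))
      (fun j : Fin (k - (i : ℕ)) => a ⟨(i : ℕ) + (j : ℕ), by omega⟩)) := rfl

/-- The family `D F(v)[l(v)]`. -/
noncomputable def ins (F : Fam V W) (l : Fam V V) : Fam V W :=
  ofSym (fun k => ∑ i : Fin (k + 1),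
    (((i : ℕ).factorial : K) * ((k - (i : ℕ)).factorial : K))⁻¹ •
      insAlong i (F.f (k - i + 1)) (l.f i)) (by
    refine Finset.sum_eq_zero fun i _ => ?_
    obtain rfl : i = 0 := Fin.ext (by omega)
    refine MultilinearMap.ext fun v => ?_
    have h : insAlong (0 : Fin 1) (F.f (0 - ((0 : Fin 1) : ℕ) + 1)) (l.f ((0 : Fin 1) : ℕ)) v = 0 := by
      rw [insAlong_apply]
      refine MultilinearMap.map_coord_zero _ 0 ?_
      rw [Fin.cons_zero]
      change l.f 0 _ = 0
      rw [l.zero]; rfl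
    rw [smul_apply, h, smul_zero]; rfl)

end Ins

section Der

/-- The derivative of a family, as the family `(x, y) ↦ D F(x)[y]` on `V ⊕ V[-1]`. -/
noncomputable def der (F : Fam V W) : Fam V.tan W :=
  ofSym (fun k => (((k - 1).factorial : K))⁻¹ • (F.f k).compLinearMap fun i =>
    if (i : ℕ) = 0 then V.tanSnd else V.tanFst) (by
      rw [F.zero]; exact MultilinearMap.ext fun v => smul_zero _)

theorem Homog.der {F : Fam V W} {p q : ℤ} (hF : F.Homog p) (h : q = p - 1) : (der F).Homog q := by
  subst h
  refine homog_ofSym fun k => IsHomog.smul ?_ _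
  intro d a ha
  rcases k with _ | k
  · rw [F.zero]; exact zero_mem _
  -- The argument in slot `0` is read in the shifted summand, where its degree is one less; this is
  -- the drop from `p` to `p - 1`.
  have := hF (k + 1) (Fin.cons (d 0 - 1) fun j => d j.succ) (fun i =>
    (if (i : ℕ) = 0 then V.tanSnd else V.tanFst) (a i)) (by
      intro j
      refine Fin.cases ?_ (fun j => ?_) j
      · exact (ha 0).2
      · exact (ha j.succ).1)
  rw [Fin.sum_univ_succ] at this ⊢
  simp only [Fin.cons_zero, Fin.cons_succ] at this
  convert! this using 2
  ring

end Der

end Fam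

/-! ### Unshuffles as coset representatives -/

section Unshuffles

/-- The permutations of `Fin k` preserving the set of the first `i` indices. -/
def blockPerms (i k : ℕ) : Finset (Perm (Fin k)) :=
  Finset.univ.filter fun σ => ∀ p : Fin k, ((σ p : ℕ) < i ↔ (p : ℕ) < i)

theorem mem_blockPerms {i k : ℕ} {σ : Perm (Fin k)} :
    σ ∈ blockPerms i k ↔ ∀ p : Fin k, ((σ p : ℕ) < i ↔ (p : ℕ) < i) := by simp [blockPerms]

theorem mem_unshuffles {i k : ℕ} {τ : Perm (Fin k)} : τ ∈ unshuffles i k ↔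
    ∀ p q : Fin k, p < q → ((q : ℕ) < i ∨ i ≤ (p : ℕ)) → τ p < τ q := by simp [unshuffles]

theorem card_blockPerms {i k : ℕ} (h : i ≤ k) :
    (blockPerms i k).card = i.factorial * (k - i).factorial := by
  have e1 : Fintype.card {p : Fin k // (p : ℕ) < i} = i := by
    rw [Fintype.card_subtype]
    have : (Finset.univ.filter fun p : Fin k => (p : ℕ) < i) =
        Finset.univ.map (Fin.castLEEmb h) := by
      ext p
      simp only [Finset.mem_filter, Finset.mem_univ, true_and, Finset.mem_map]
      constructor
      · intro hp; exact ⟨⟨p, hp⟩, rfl⟩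
      · rintro ⟨q, rfl⟩; exact q.2
    rw [this, Finset.card_map, Finset.card_fin]
  have e2 : Fintype.card {p : Fin k // ¬ (p : ℕ) < i} = k - i := by
    rw [Fintype.card_subtype_compl, e1, Fintype.card_fin]
  have := Equiv.Perm.subtypeCongrHom_injective (fun p : Fin k => (p : ℕ) < i)
  suffices H : (blockPerms i k).card =
      Fintype.card (Perm {p : Fin k // (p : ℕ) < i} × Perm {p : Fin k // ¬ (p : ℕ) < i}) by
    rw [H, Fintype.card_prod, Fintype.card_perm, Fintype.card_perm, e1, e2]
  rw [← Finset.card_univ, ← Finset.card_map ⟨_, this⟩]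
  congr 1
  ext σ
  simp only [mem_blockPerms, Finset.mem_map, Finset.mem_univ, true_and, Function.Embedding.coeFn_mk]
  constructor
  · intro hσ
    refine ⟨(σ.subtypePerm hσ, σ.subtypePerm fun p => not_congr (hσ p)), ?_⟩
    ext p
    by_cases hp : (p : ℕ) < i
    · simp [Equiv.Perm.subtypeCongrHom, Equiv.Perm.subtypeCongr.left_apply, hp]
    · simp [Equiv.Perm.subtypeCongrHom, Equiv.Perm.subtypeCongr.right_apply, hp]
  · rintro ⟨⟨σ, τ⟩, rfl⟩ p
    by_cases hp : (p : ℕ) < i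
    · have h := Equiv.Perm.subtypeCongr.left_apply (p := fun p : Fin k => (p : ℕ) < i) σ τ hp
      have h' : ((Equiv.Perm.subtypeCongrHom (fun p : Fin k => (p : ℕ) < i) (σ, τ)) p) = _ := h
      rw [h']
      exact iff_of_true (σ ⟨p, hp⟩).2 hp
    · have h := Equiv.Perm.subtypeCongr.right_apply (p := fun p : Fin k => (p : ℕ) < i) σ τ hp
      have h' : ((Equiv.Perm.subtypeCongrHom (fun p : Fin k => (p : ℕ) < i) (σ, τ)) p) = _ := h
      rw [h']
      exact iff_of_false (τ ⟨p, hp⟩).2 hp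

/-- Sort the values of `τ` separately inside each of the two blocks. The key adds `k` on the second
block, so that a single sort keeps the blocks apart. -/
theorem exists_unshuffle_mul {i k : ℕ} (τ : Perm (Fin k)) :
    ∃ ρ ∈ unshuffles i k, ∃ σ ∈ blockPerms i k, ρ * σ = τ := by
  let key : Fin k → ℕ := fun p => (if (p : ℕ) < i then 0 else k) + τ p
  let h : Perm (Fin k) := Tuple.sort key
  have hkey : Function.Injective key := by
    intro p q hpq
    simp only [key] at hpq
    refine τ.injective (Fin.ext ?_)
    have := (τ p).2; have := (τ q).2
    split_ifs at hpq <;> omega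
  have hmono : StrictMono (key ∘ h) :=
    (Tuple.monotone_sort key).strictMono_of_injective (hkey.comp h.injective)
  have hlt : ∀ p : Fin k, (p : ℕ) < i ↔ key p < k := by
    intro p
    simp only [key]
    have := (τ p).2
    split_ifs <;> omega
  have hblock : ∀ p q : Fin k, p < q → ((h q : Fin k) : ℕ) < i → ((h p : Fin k) : ℕ) < i := by
    intro p q hpq hq
    rw [hlt] at hq ⊢
    exact (hmono hpq).trans hq
  -- By `hblock` the positions sent to the first block form an initial segment, and it has the same
  -- size as the first block itself.
  have hcard : ∀ p : Fin k, (((h p : Fin k) : ℕ) < i ↔ (p : ℕ) < i) := by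
    have hS : (Finset.univ.filter fun p : Fin k => ((h p : Fin k) : ℕ) < i).card =
        (Finset.univ.filter fun p : Fin k => (p : ℕ) < i).card := by
      refine Finset.card_bij (fun p _ => h p) (by simp) (fun p _ q _ e => h.injective e) ?_
      intro q hq
      exact ⟨h.symm q, by simpa using hq, by simp⟩
    have hcmp : (Finset.univ.filter fun p : Fin k => ((h p : Fin k) : ℕ) < i) =
        (Finset.univ.filter fun p : Fin k => (p : ℕ) < i) := by
      by_cases hsub : (Finset.univ.filter fun p : Fin k => ((h p : Fin k) : ℕ) < i) ⊆
        (Finset.univ.filter fun p : Fin k => (p : ℕ) < i)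
      · exact Finset.eq_of_subset_of_card_le hsub hS.ge
      · rw [Finset.not_subset] at hsub
        obtain ⟨p, hp, hp'⟩ := hsub
        simp only [Finset.mem_filter, Finset.mem_univ, true_and] at hp hp'
        refine (Finset.eq_of_subset_of_card_le ?_ hS.le).symm
        intro q hq
        simp only [Finset.mem_filter, Finset.mem_univ, true_and] at hq ⊢
        exact hblock q p (by rw [Fin.lt_def]; omega) hp
    intro p
    have := Finset.ext_iff.mp hcmp p
    simpa using this
  refine ⟨τ * h, ?_, h⁻¹, ?_, by simp⟩
  · rw [mem_unshuffles]
    intro p q hpq hi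
    have h1 := hmono hpq
    simp only [Function.comp, key] at h1
    have hp := hcard p; have hq := hcard q
    rw [Equiv.Perm.mul_apply, Equiv.Perm.mul_apply, Fin.lt_def]
    rw [Fin.lt_def] at hpq
    split_ifs at h1 <;> omega
  · rw [mem_blockPerms]
    intro p
    have := hcard (h⁻¹ p)
    rw [show h (h⁻¹ p) = p from h.apply_symm_apply p] at this
    exact this.symm

/-- The permutation `σ' * σ⁻¹` preserves the blocks and must be increasing on each, because `ρ` and
`ρ'` are. It is then increasing on all of `Fin k`, hence the identity. -/
theorem unshuffle_mul_injective {i k : ℕ} {ρ ρ' σ σ' : Perm (Fin k)} (hρ : ρ ∈ unshuffles i k)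
    (hρ' : ρ' ∈ unshuffles i k) (hσ : σ ∈ blockPerms i k) (hσ' : σ' ∈ blockPerms i k)
    (h : ρ * σ = ρ' * σ') : ρ = ρ' ∧ σ = σ' := by
  rw [mem_unshuffles] at hρ hρ'
  rw [mem_blockPerms] at hσ hσ'
  have hg : ∀ p, ρ p = ρ' ((σ' * σ⁻¹) p) := by
    intro p
    have := congrArg (fun f : Perm (Fin k) => f (σ⁻¹ p)) h
    simpa using this
  have hgb : ∀ p : Fin k, ((((σ' * σ⁻¹) p : Fin k) : ℕ) < i ↔ (p : ℕ) < i) := by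
    intro p
    rw [Equiv.Perm.mul_apply, hσ', ← hσ, show σ (σ⁻¹ p) = p from σ.apply_symm_apply p]
  have hmono : StrictMono (σ' * σ⁻¹ : Perm (Fin k)) := by
    intro p q hpq
    by_cases hb : (q : ℕ) < i ∨ i ≤ (p : ℕ)
    · have h1 := hρ p q hpq hb
      rw [hg, hg] at h1
      by_contra hcon
      have hne : (σ' * σ⁻¹) q ≠ (σ' * σ⁻¹) p := (σ' * σ⁻¹).injective.ne hpq.ne'
      have h2 := hρ' _ _ (lt_of_le_of_ne (not_lt.mp hcon) hne) (by
        have := hgb p; have := hgb q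
        have hpq' := Fin.lt_def.mp hpq
        rcases hb with hb | hb <;> omega)
      exact absurd h1 h2.not_gt
    · have := hgb p; have := hgb q
      rw [Fin.lt_def] at hpq ⊢
      omega
  have h1 : σ' * σ⁻¹ = 1 := by
    have := Subsingleton.elim (hmono.orderIsoOfSurjective _ (σ' * σ⁻¹).surjective)
      (OrderIso.refl (Fin k))
    ext x
    exact congrArg Fin.val (DFunLike.congr_fun this x)
  have h2 : σ' = σ := by rwa [mul_inv_eq_one] at h1
  subst h2
  exact ⟨mul_right_cancel h, rfl⟩

/-- Sums over unshuffles as averages over all permutations. -/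
theorem sum_perm_eq_sum_unshuffles {M : Type*} [AddCommMonoid M] {i k : ℕ} (hik : i ≤ k)
    (φ : Perm (Fin k) → M)
    (hφ : ∀ ρ, ∀ σ ∈ blockPerms i k, φ (ρ * σ) = φ ρ) :
    ∑ τ, φ τ = (i.factorial * (k - i).factorial) • ∑ ρ ∈ unshuffles i k, φ ρ := by
  rw [← card_blockPerms hik, Finset.smul_sum]
  have : ∀ ρ ∈ unshuffles i k, (blockPerms i k).card • φ ρ =
      ∑ σ ∈ blockPerms i k, φ (ρ * σ) := by
    intro ρ _
    rw [Finset.sum_congr rfl fun σ hσ => hφ ρ σ hσ, Finset.sum_const]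
  rw [Finset.sum_congr rfl this, ← Finset.sum_product']
  symm
  refine Finset.sum_bij (fun x _ => x.1 * x.2) (fun _ _ => Finset.mem_univ _) ?_ ?_ ?_
  · rintro ⟨ρ, σ⟩ h ⟨ρ', σ'⟩ h' e
    rw [Finset.mem_product] at h h'
    obtain ⟨h1, h2⟩ := unshuffle_mul_injective h.1 h'.1 h.2 h'.2 e
    exact Prod.ext h1 h2
  · intro τ _
    obtain ⟨ρ, hρ, σ, hσ, e⟩ := exists_unshuffle_mul (i := i) τ
    exact ⟨(ρ, σ), Finset.mem_product.mpr ⟨hρ, hσ⟩, e⟩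
  · intros; rfl

end Unshuffles

/-! ### Insertion over unshuffles and over all permutations -/

namespace Fam

variable {K : Type u} [Field K] {V : GMod.{u, v} K} {W : GMod.{u, w} K} {X : GMod.{u, x} K}

theorem koszulSign_sumFin {k : ℕ} (i : Fin (k + 1)) (d : Fin k → ℤ) (σ : Perm (Fin k))
    (σ₁ : Perm (Fin (i : ℕ))) (σ₂ : Perm (Fin (k - i)))
    (h₁ : ∀ p, σ (sumFinEquiv i (Sum.inl p)) = sumFinEquiv i (Sum.inl (σ₁ p)))
    (h₂ : ∀ p, σ (sumFinEquiv i (Sum.inr p)) = sumFinEquiv i (Sum.inr (σ₂ p))) :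
    koszulSign d σ = koszulSign (fun p => d (sumFinEquiv i (Sum.inl p))) σ₁ *
      koszulSign (fun p => d (sumFinEquiv i (Sum.inr p))) σ₂ := by
  have l1 : ∀ p q, sumFinEquiv i (Sum.inl p) < sumFinEquiv i (Sum.inl q) ↔ p < q :=
    fun p q => Iff.rfl
  have l2 : ∀ p q, sumFinEquiv i (Sum.inr p) < sumFinEquiv i (Sum.inr q) ↔ p < q :=
    fun p q => by rw [Fin.lt_def, Fin.lt_def]; exact Nat.add_lt_add_iff_left
  have l3 : ∀ p q, sumFinEquiv i (Sum.inl p) < sumFinEquiv i (Sum.inr q) :=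
    fun p q => Fin.lt_def.mpr (show (p : ℕ) < i + q by omega)
  unfold koszulSign
  rw [← Equiv.prod_comp (sumFinEquiv i), Fintype.prod_sum_type]
  congr 1
  · refine Finset.prod_congr rfl fun p _ => ?_
    rw [← Equiv.prod_comp (sumFinEquiv i), Fintype.prod_sum_type]
    simp only [h₁, h₂, l1, (l3 _ _).not_gt, and_false, if_false, Finset.prod_const_one, mul_one]
  · refine Finset.prod_congr rfl fun p _ => ?_
    rw [← Equiv.prod_comp (sumFinEquiv i), Fintype.prod_sum_type]
    simp only [h₁, h₂, l2, (l3 _ _).not_gt, false_and, if_false, Finset.prod_const_one, one_mul]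

theorem koszulSign_decomposeFin {k : ℕ} (d : Fin (k + 1) → ℤ) (σ : Perm (Fin k)) :
    koszulSign d (Equiv.Perm.decomposeFin.symm (0, σ)) = koszulSign (fun j => d j.succ) σ := by
  unfold koszulSign
  rw [Fin.prod_univ_succ]
  simp only [Fin.prod_univ_succ]
  simp

/-- The permutation splits into one of the inner arguments, absorbed by the symmetry of `l`, and one
of the outer arguments, absorbed by the symmetry of `F`. The latter fixes the slot of `l(…)`, so the
degree of `l` does not enter the sign. -/
theorem insAlong_perm_left {F : Fam V W} {l : Fam V V} {q : ℤ} (hl : l.Homog q) {k : ℕ}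
    (i : Fin (k + 1)) (d : Fin k → ℤ) (a : Fin k → V) (ha : ∀ j, a j ∈ V.deg (d j))
    (σ : Perm (Fin k)) (hσ : σ ∈ blockPerms i k) :
    insAlong i (F.f (k - i + 1)) (l.f i) (fun j => a (σ j)) =
      ((koszulSign d σ : ℤ) : K) • insAlong i (F.f (k - i + 1)) (l.f i) a := by
  rw [mem_blockPerms] at hσ
  have hex1 : ∀ p : Fin (i : ℕ), ∃ q : Fin (i : ℕ),
      σ (sumFinEquiv i (Sum.inl p)) = sumFinEquiv i (Sum.inl q) := fun p =>
    ⟨⟨σ (sumFinEquiv i (Sum.inl p)), (hσ _).mpr p.2⟩, Fin.ext rfl⟩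
  have hex2 : ∀ p : Fin (k - i), ∃ q : Fin (k - i),
      σ (sumFinEquiv i (Sum.inr p)) = sumFinEquiv i (Sum.inr q) := fun p => by
    have h : ¬ ((σ (sumFinEquiv i (Sum.inr p)) : Fin k) : ℕ) < i := by
      rw [hσ]; simp [sumFinEquiv]
    refine ⟨⟨(σ (sumFinEquiv i (Sum.inr p)) : ℕ) - i, by omega⟩, Fin.ext ?_⟩
    simp only [sumFinEquiv, Equiv.trans_apply, finSumFinEquiv_apply_right, finCongr_apply,
      Fin.val_cast, Fin.val_natAdd] at h ⊢
    omega
  choose f1 h1 using hex1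
  choose f2 h2 using hex2
  have i1 : Function.Injective f1 := fun p q h => by
    have := (h1 p).trans ((congrArg _ (congrArg _ h)).trans (h1 q).symm)
    simpa using this
  have i2 : Function.Injective f2 := fun p q h => by
    have := (h2 p).trans ((congrArg _ (congrArg _ h)).trans (h2 q).symm)
    simpa using this
  let σ₁ : Perm (Fin (i : ℕ)) := Equiv.ofBijective f1 (Finite.injective_iff_bijective.mp i1)
  let σ₂ : Perm (Fin (k - i)) := Equiv.ofBijective f2 (Finite.injective_iff_bijective.mp i2)
  rw [koszulSign_sumFin i d σ σ₁ σ₂ h1 h2]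
  have hb : ∀ b : Fin k → V, insAlong i (F.f (k - i + 1)) (l.f i) b = F.f (k - i + 1) (Fin.cons
      (l.f i fun j => b (sumFinEquiv i (Sum.inl j))) fun j => b (sumFinEquiv i (Sum.inr j))) :=
    fun b => rfl
  rw [hb, hb]
  simp only [h1, h2]
  have e1 := l.symm i (fun p => d (sumFinEquiv i (Sum.inl p)))
    (fun p => a (sumFinEquiv i (Sum.inl p))) (fun p => ha _) σ₁
  have e2 := F.symm (k - i + 1)
    (Fin.cons ((∑ p, d (sumFinEquiv i (Sum.inl p))) + q) fun p => d (sumFinEquiv i (Sum.inr p)))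
    (Fin.cons (l.f i fun j => a (sumFinEquiv i (Sum.inl j)))
      fun j => a (sumFinEquiv i (Sum.inr j))) (by
      intro j
      refine Fin.cases ?_ (fun j => ?_) j
      · simpa only [Fin.cons_zero] using hl i _ _ fun p => ha (sumFinEquiv i (Sum.inl p))
      · simpa only [Fin.cons_succ] using ha _) (Equiv.Perm.decomposeFin.symm (0, σ₂))
  rw [koszulSign_decomposeFin] at e2
  have e3 : ∀ (c : K) (z : V) (v : Fin (k - i) → V), F.f (k - i + 1) (Fin.cons (c • z) v) =
      c • F.f (k - i + 1) (Fin.cons z v) := fun c z v => (F.f (k - i + 1)).cons_smul v c z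
  refine (congrArg (fun z => F.f (k - i + 1) (Fin.cons z _)) e1).trans ?_
  rw [e3]
  push_cast
  rw [mul_smul]
  congr 1
  simp only [Fin.cons_succ] at e2
  rw [← e2]
  congr 1
  funext j
  refine Fin.cases ?_ (fun j => ?_) j
  · simp
  · simp [σ₂]

/-- The signed summands are constant on cosets of block permutations. Summing over all permutations
thus overcounts by `i! (k - i)!`, which is the normalization in `ins`. -/
theorem ins_f [CharZero K] (F : Fam V W) (l : Fam V V) {q : ℤ} (hl : l.Homog q) (k : ℕ)
    (d : Fin k → ℤ) (a : Fin k → V) (ha : ∀ j, a j ∈ V.deg (d j)) :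
    (ins F l).f k a = insertionSum F.f l.f k d a := by
  unfold insertionSum
  refine (gsym_apply _ d a ha).trans ?_
  simp only [sum_apply, Finset.smul_sum]
  rw [Finset.sum_comm]
  refine Finset.sum_congr rfl fun i _ => ?_
  simp only [smul_apply]
  have h := sum_perm_eq_sum_unshuffles (Nat.lt_succ_iff.mp i.isLt)
    (fun τ : Perm (Fin k) => ((koszulSign d τ : ℤ) : K) •
      insAlong i (F.f (k - i + 1)) (l.f i) fun j => a (τ j)) (by
        intro ρ σ hσ
        have := insAlong_perm_left (F := F) hl i (fun j => d (ρ j)) (fun j => a (ρ j))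
          (fun j => ha _) σ hσ
        simp only [Equiv.Perm.mul_apply]
        rw [this, smul_smul, koszulSign_mul]
        push_cast
        rw [mul_assoc, koszulSign_mul_self, mul_one])
  have hne : (((i : ℕ).factorial : K) * ((k - (i : ℕ)).factorial : K)) ≠ 0 :=
    mul_ne_zero (by exact_mod_cast Nat.factorial_ne_zero _)
      (by exact_mod_cast Nat.factorial_ne_zero _)
  rw [← Nat.cast_smul_eq_nsmul K, Nat.cast_mul] at h
  rw [← inv_smul_eq_iff₀ hne] at h
  rw [Finset.smul_sum] at h
  simp only [insAlong_apply] at h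
  rw [← h]
  refine Finset.sum_congr rfl fun τ _ => ?_
  rw [smul_comm, insAlong_apply]

end Fam

/-! ### Points of graded vector spaces over graded commutative algebras -/

/-- A nilpotent graded commutative algebra, inside a unital algebra, with three distinguished
elements of odd degree. -/
structure PointAlg (K : Type u) [Field K] where
  A : Type u
  [ring : Ring A]
  [algebra : Algebra K A]
  /-- the homogeneous nilpotent elements of each degree -/
  gr : ℤ → Submodule K A
  mul_mem : ∀ {i j : ℤ} {a b : A}, a ∈ gr i → b ∈ gr j → a * b ∈ gr (i + j)
  comm : ∀ {i j : ℤ} {a b : A}, a ∈ gr i → b ∈ gr j →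
    a * b = ((Int.negOnePow (i * j) : ℤ) : A) * (b * a)
  /-- a bound for nonvanishing products -/
  N : ℕ
  N_pos : 0 < N
  nil : ∀ k, N ≤ k → ∀ (d : Fin k → ℤ) (e : Fin k → A), (∀ i, e i ∈ gr (d i)) →
    (List.ofFn e).prod = 0
  θ : A
  η : A
  ζ : A
  θ_mem : θ ∈ gr (-1)
  η_mem : η ∈ gr 1
  ζ_mem : ζ ∈ gr 1

attribute [instance] PointAlg.ring PointAlg.algebra

namespace PointAlg

variable {K : Type u} [Field K] (𝔸 : PointAlg.{u} K)

theorem prod_mem {k : ℕ} (d : Fin (k + 1) → ℤ) (e : Fin (k + 1) → 𝔸.A)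
    (he : ∀ i, e i ∈ 𝔸.gr (d i)) : (List.ofFn e).prod ∈ 𝔸.gr (∑ i, d i) := by
  induction k with
  | zero => simpa using he 0
  | succ k ih =>
    rw [List.ofFn_succ, List.prod_cons, Fin.sum_univ_succ]
    exact 𝔸.mul_mem (he 0) (ih (fun i => d i.succ) (fun i => e i.succ) fun i => he _)

theorem mul_self_eq_zero [CharZero K] {r : ℤ} (hr : Odd r) {μ : 𝔸.A} (hμ : μ ∈ 𝔸.gr r) :
    μ * μ = 0 := by
  have h := 𝔸.comm hμ hμ
  rw [Int.negOnePow_odd _ (hr.mul hr)] at h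
  have h2 : (2 : K) • (μ * μ) = 0 := by
    rw [two_smul]; nth_rewrite 1 [h]; simp
  exact (smul_eq_zero.mp h2).resolve_left two_ne_zero

theorem exists_prod_eq_mul {r : ℤ} {μ : 𝔸.A} (hμ : μ ∈ 𝔸.gr r) {k : ℕ} (d : Fin k → ℤ)
    (e : Fin k → 𝔸.A) (he : ∀ i, e i ∈ 𝔸.gr (d i)) (i : Fin k) (a : 𝔸.A) (hi : e i = μ * a) :
    ∃ b, (List.ofFn e).prod = μ * b := by
  induction k with
  | zero => exact i.elim0
  | succ k ih =>
    rw [List.ofFn_succ, List.prod_cons]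
    revert hi
    refine Fin.cases (fun hi => ⟨a * (List.ofFn fun i => e i.succ).prod, ?_⟩) (fun i hi => ?_) i
    · rw [hi, mul_assoc]
    · obtain ⟨b, hb⟩ := ih (fun i => d i.succ) (fun i => e i.succ) (fun i => he _) i hi
      refine ⟨((Int.negOnePow (d 0 * r) : ℤ) : 𝔸.A) * (e 0 * b), ?_⟩
      rw [hb, ← mul_assoc, 𝔸.comm (he 0) hμ, ← mul_assoc μ, ← (Int.cast_commute _ μ).eq]
      simp only [mul_assoc]

/-- Graded commutativity brings the two factors `μ` together, where they multiply to zero. -/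
theorem prod_eq_zero_of_two {r : ℤ} {μ : 𝔸.A} (hμ : μ ∈ 𝔸.gr r) (hμ2 : μ * μ = 0) {k : ℕ}
    (d : Fin k → ℤ) (e : Fin k → 𝔸.A) (he : ∀ i, e i ∈ 𝔸.gr (d i)) (i j : Fin k) (hij : i < j)
    {n : ℤ} (a b : 𝔸.A) (ha : a ∈ 𝔸.gr n)
    (hi : e i = μ * a) (hj : e j = μ * b) : (List.ofFn e).prod = 0 := by
  induction k with
  | zero => exact i.elim0
  | succ k ih =>
    rw [List.ofFn_succ, List.prod_cons]
    obtain ⟨j, rfl⟩ := Fin.exists_succ_eq.mpr (Fin.ne_of_gt (lt_of_le_of_lt (Fin.zero_le i) hij))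
    revert hi hij
    refine Fin.cases (fun hi _ => ?_) (fun i hi hij => ?_) i
    · obtain ⟨c, hc⟩ := 𝔸.exists_prod_eq_mul hμ (fun i => d i.succ) (fun i => e i.succ)
        (fun i => he _) j b hj
      rw [hi, hc, mul_assoc, ← mul_assoc a, 𝔸.comm ha hμ, ← mul_assoc, ← mul_assoc,
        ← (Int.cast_commute _ μ).eq, mul_assoc _ μ, ← mul_assoc μ, hμ2]
      simp
    · rw [ih (fun i => d i.succ) (fun i => e i.succ) (fun i => he _) i j
        (Fin.succ_lt_succ_iff.mp hij) hi hj, mul_zero]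

variable (V : GMod.{u, v} K)

/-- The homogeneous pure tensors spanning the points of degree `p`. -/
def pure (p : ℤ) : Set (𝔸.A ⊗[K] V) :=
  {t | ∃ (n : ℤ) (e : 𝔸.A) (x : V), e ∈ 𝔸.gr n ∧ x ∈ V.deg (n + p) ∧ e ⊗ₜ x = t}

/-- The points of degree `p` of a graded vector space. -/
def pts (p : ℤ) : Submodule K (𝔸.A ⊗[K] V) := Submodule.span K (𝔸.pure V p)

end PointAlg

section Points

variable {K : Type u} [Field K] {𝔸 : PointAlg.{u} K} {V : GMod.{u, v} K} {W : GMod.{u, w} K}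
  {X : GMod.{u, x} K}

theorem tmul_mem_pts {p n : ℤ} {e : 𝔸.A} {x : V} (he : e ∈ 𝔸.gr n) (hx : x ∈ V.deg (n + p)) :
    e ⊗ₜ x ∈ 𝔸.pts V p := Submodule.subset_span ⟨n, e, x, he, hx, rfl⟩

theorem lTensor_mem_pts {L : V →ₗ[K] W} {p q r : ℤ} (hL : GMod.HomogLin V W L q)
    {v : 𝔸.A ⊗[K] V} (hv : v ∈ 𝔸.pts V p) (h : r = p + q) : L.lTensor 𝔸.A v ∈ 𝔸.pts W r := by
  subst h
  induction hv using Submodule.span_induction with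
  | mem t ht =>
    obtain ⟨n, e, x, he, hx, rfl⟩ := ht
    exact tmul_mem_pts he (by rw [← add_assoc]; exact hL _ _ hx)
  | zero => rw [map_zero]; exact zero_mem _
  | add x y _ _ hx hy => rw [map_add]; exact add_mem hx hy
  | smul c x _ hx => rw [map_smul]; exact Submodule.smul_mem _ _ hx

theorem lmul_mem_pts {μ : 𝔸.A} {p q r : ℤ} (hμ : μ ∈ 𝔸.gr r)
    {v : 𝔸.A ⊗[K] V} (hv : v ∈ 𝔸.pts V p) (h : q = p - r) : lmul V μ v ∈ 𝔸.pts V q := by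
  subst h
  induction hv using Submodule.span_induction with
  | mem t ht =>
    obtain ⟨n, e, x, he, hx, rfl⟩ := ht
    exact tmul_mem_pts (𝔸.mul_mem hμ he) (by convert! hx using 2; ring)
  | zero => rw [map_zero]; exact zero_mem _
  | add x y _ _ hx hy => rw [map_add]; exact add_mem hx hy
  | smul c x _ hx => rw [map_smul]; exact Submodule.smul_mem _ _ hx

/-- The arity is taken positive because the empty product of coefficients is `1`, which is not
required to lie in any `gr n`. -/
theorem tens_mem_pts {k : ℕ} {Φ : MultilinearMap K (fun _ : Fin (k + 1) => V) W} {p : ℤ}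
    (hΦ : IsHomog Φ p) (q : Fin (k + 1) → ℤ) (v : Fin (k + 1) → 𝔸.A ⊗[K] V)
    (hv : ∀ i, v i ∈ 𝔸.pts V (q i)) {r : ℤ} (hr : r = p + ∑ i, q i) :
    tens 𝔸.A Φ v ∈ 𝔸.pts W r := by
  subst hr
  refine MultilinearMap.map_mem_of_forall_mem_span _ (fun i => 𝔸.pure V (q i)) _ ?_ v hv
  intro s hs
  choose n e x he hx hs using hs
  obtain rfl : (fun i => e i ⊗ₜ[K] x i) = s := funext hs
  rw [tens_tmul]
  refine tmul_mem_pts (𝔸.prod_mem n e he) ?_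
  convert! hΦ (fun i => n i + q i) x hx using 2
  rw [Finset.sum_add_distrib]; ring

theorem tens_eq_zero_of_le {k : ℕ} (Φ : MultilinearMap K (fun _ : Fin k => V) W)
    (hk : 𝔸.N ≤ k) (q : Fin k → ℤ) (v : Fin k → 𝔸.A ⊗[K] V) (hv : ∀ i, v i ∈ 𝔸.pts V (q i)) :
    tens 𝔸.A Φ v = 0 := by
  have := MultilinearMap.map_mem_of_forall_mem_span (tens 𝔸.A Φ) (fun i => 𝔸.pure V (q i)) ⊥
    (fun s hs => ?_) v hv
  · simpa using this
  · choose n e x he hx hs using hs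
    obtain rfl : (fun i => e i ⊗ₜ[K] x i) = s := funext hs
    rw [tens_tmul, 𝔸.nil k hk n e he, TensorProduct.zero_tmul]
    exact zero_mem _

theorem prod_perm_tmul {k : ℕ} (n : Fin k → ℤ) (e : Fin k → 𝔸.A)
    (he : ∀ i, e i ∈ 𝔸.gr (n i)) (τ : Perm (Fin k)) {X : Type*} [AddCommGroup X] [Module K X] (y : X) :
    (List.ofFn fun i => e (τ i)).prod ⊗ₜ[K] y =
      ((koszulSign n τ : ℤ) : K) • ((List.ofFn e).prod ⊗ₜ[K] y) := by
  rw [prod_ofFn_perm n e (fun i j => 𝔸.comm (he i) (he j)) τ, TensorProduct.smul_tmul']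
  congr 1
  rw [Algebra.smul_def]
  simp

/-- In a point of degree zero each coefficient has the degree of its vector, so the signs from
permuting coefficients and from permuting arguments of `F` are equal and cancel. -/
theorem tens_perm {F : Fam V W} {k : ℕ} (v : Fin k → 𝔸.A ⊗[K] V)
    (hv : ∀ i, v i ∈ 𝔸.pts V 0) (τ : Perm (Fin k)) :
    tens 𝔸.A (F.f k) (fun i => v (τ i)) = tens 𝔸.A (F.f k) v := by
  refine MultilinearMap.eq_of_forall_mem_span ((tens 𝔸.A (F.f k)).domDomCongr τ) _
    (fun i => 𝔸.pure V 0) ?_ v hv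
  intro s hs
  choose n e x he hx hs using hs
  obtain rfl : (fun i => e i ⊗ₜ[K] x i) = s := funext hs
  rw [MultilinearMap.domDomCongr_apply, tens_tmul (F.f k) (fun i => e (τ i)) fun i => x (τ i),
    tens_tmul, prod_perm_tmul n e he,
    F.symm k n x (fun j => by simpa using hx j), TensorProduct.tmul_smul, smul_smul,
    koszulSign_mul_self, one_smul]

theorem tens_gsym {k : ℕ} (Φ : MultilinearMap K (fun _ : Fin k => V) W) (v : 𝔸.A ⊗[K] V)
    (hv : v ∈ 𝔸.pts V 0) :
    tens 𝔸.A (gsym Φ) (fun _ => v) = (k.factorial : K) • tens 𝔸.A Φ fun _ => v := by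
  have h := MultilinearMap.eq_of_forall_mem_span (tens 𝔸.A (gsym Φ))
    (∑ τ : Perm (Fin k), (tens 𝔸.A Φ).domDomCongr τ)
    (fun i => 𝔸.pure V 0) ?_ (fun _ => v) fun _ => hv
  · rw [h, sum_apply]
    simp only [MultilinearMap.domDomCongr_apply]
    rw [Finset.sum_const, Finset.card_univ, Fintype.card_perm, Fintype.card_fin,
      Nat.cast_smul_eq_nsmul]
  · intro s hs
    choose n e x he hx hs using hs
    obtain rfl : (fun i => e i ⊗ₜ[K] x i) = s := funext hs
    rw [tens_tmul, gsym_apply Φ n x (fun j => by simpa using hx j), sum_apply,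
      TensorProduct.tmul_sum]
    refine Finset.sum_congr rfl fun τ _ => ?_
    rw [MultilinearMap.domDomCongr_apply, tens_tmul Φ (fun i => e (τ i)) fun i => x (τ i),
      prod_perm_tmul n e he, TensorProduct.tmul_smul]

/-! ### Values, derivatives and Taylor expansion at points -/

namespace Fam

/-- The value of a family at a point. -/
noncomputable def val (F : Fam V W) (v : 𝔸.A ⊗[K] V) : 𝔸.A ⊗[K] W :=
  ∑ k ∈ Finset.range 𝔸.N, ((k.factorial : K))⁻¹ • tens 𝔸.A (F.f k) fun _ => v

theorem val_eq_sum (F : Fam V W) {v : 𝔸.A ⊗[K] V} (hv : v ∈ 𝔸.pts V 0) {M : ℕ} (hM : 𝔸.N ≤ M) :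
    F.val v = ∑ k ∈ Finset.range M, ((k.factorial : K))⁻¹ • tens 𝔸.A (F.f k) fun _ => v := by
  refine Finset.sum_subset (Finset.range_subset_range.mpr hM) fun k _ hk => ?_
  rw [Finset.mem_range, not_lt] at hk
  rw [tens_eq_zero_of_le _ hk (fun _ => 0) _ fun _ => hv, smul_zero]

/-- At a point all `k!` terms of the symmetrization agree, which cancels the `1/k!` in the value.
Families built by `ofSym` can thus be evaluated from their unsymmetrized formulas. -/
theorem val_ofSym [CharZero K] (Φ : (k : ℕ) → MultilinearMap K (fun _ : Fin k => V) W)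
    (h0 : Φ 0 = 0) {v : 𝔸.A ⊗[K] V} (hv : v ∈ 𝔸.pts V 0) {M : ℕ} (hM : 𝔸.N ≤ M) :
    (ofSym Φ h0).val v = ∑ k ∈ Finset.range M, tens 𝔸.A (Φ k) fun _ => v := by
  rw [val_eq_sum _ hv hM]
  refine Finset.sum_congr rfl fun k _ => ?_
  have hk : (k.factorial : K) ≠ 0 := by exact_mod_cast k.factorial_ne_zero
  refine (congrArg _ (tens_gsym (Φ k) v hv)).trans ?_
  rw [smul_smul, inv_mul_cancel₀ hk, one_smul]

/-- The derivative of a family at a point. -/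
noncomputable def D (F : Fam V W) (v : 𝔸.A ⊗[K] V) : 𝔸.A ⊗[K] V →ₗ[K] 𝔸.A ⊗[K] W where
  toFun u := ∑ k ∈ Finset.range 𝔸.N, ((k.factorial : K))⁻¹ •
    (tens 𝔸.A (F.f (k + 1))).curryLeft u fun _ => v
  map_add' x y := by simp only [map_add, add_apply, smul_add, Finset.sum_add_distrib]
  map_smul' c x := by
    simp only [map_smul, smul_apply, Finset.smul_sum, RingHom.id_apply]
    exact Finset.sum_congr rfl fun k _ => smul_comm _ _ _

theorem D_apply (F : Fam V W) (v u : 𝔸.A ⊗[K] V) :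
    F.D v u = ∑ k ∈ Finset.range 𝔸.N, ((k.factorial : K))⁻¹ •
      tens 𝔸.A (F.f (k + 1)) (Fin.cons u fun _ => v) := rfl

theorem val_mem {F : Fam V W} {p : ℤ} (hF : F.Homog p) {v : 𝔸.A ⊗[K] V} (hv : v ∈ 𝔸.pts V 0) :
    F.val v ∈ 𝔸.pts W p := by
  refine Submodule.sum_mem _ fun k _ => Submodule.smul_mem _ _ ?_
  rcases k with _ | k
  · rw [F.zero, tens_zero]; exact zero_mem _
  · exact tens_mem_pts (hF _) (fun _ => 0) _ (fun _ => hv) (by simp)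

theorem D_mem {F : Fam V W} {p q r : ℤ} (hF : F.Homog p) {v u : 𝔸.A ⊗[K] V}
    (hv : v ∈ 𝔸.pts V 0) (hu : u ∈ 𝔸.pts V q) (hr : r = p + q) : F.D v u ∈ 𝔸.pts W r := by
  rw [D_apply]
  refine Submodule.sum_mem _ fun k _ => Submodule.smul_mem _ _ ?_
  refine tens_mem_pts (hF _) (Fin.cons q fun _ => 0) _ (fun i => ?_) (by simp [Fin.sum_univ_succ, hr])
  refine Fin.cases ?_ (fun i => ?_) i
  · simpa using hu
  · simpa using hv

theorem D_lmul (F : Fam V W) (v u : 𝔸.A ⊗[K] V) (μ : 𝔸.A) :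
    F.D v (lmul V μ u) = lmul W μ (F.D v u) := by
  simp only [D_apply, tens_lmul_cons, map_sum, map_smul]

/-- Every coefficient of `lmul V μ u` is a multiple of `μ`, and a product with two such coefficients
vanishes. -/
theorem tens_two_eq_zero {F : Fam V W} {k : ℕ} {μ : 𝔸.A} {r : ℤ} (hμ : μ ∈ 𝔸.gr r)
    (hμ2 : μ * μ = 0) {u : 𝔸.A ⊗[K] V} (hu : u ∈ 𝔸.pts V r) (v : Fin k → 𝔸.A ⊗[K] V)
    (hv : ∀ i, v i ∈ 𝔸.pts V 0) (i j : Fin k) (hij : i < j) (hi : v i = lmul V μ u)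
    (hj : v j = lmul V μ u) : tens 𝔸.A (F.f k) v = 0 := by
  let S : Set (𝔸.A ⊗[K] V) := {t | ∃ (n : ℤ) (e : 𝔸.A) (x : V), e ∈ 𝔸.gr n ∧ x ∈ V.deg (n + r) ∧
    (μ * e) ⊗ₜ x = t}
  have hS : lmul V μ u ∈ Submodule.span K S := by
    have : Submodule.span K (𝔸.pure V r) ≤ (Submodule.span K S).comap (lmul V μ) := by
      refine Submodule.span_le.mpr ?_
      rintro _ ⟨n, e, x, he, hx, rfl⟩
      exact Submodule.subset_span ⟨n, e, x, he, hx, rfl⟩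
    exact this hu
  have := MultilinearMap.map_mem_of_forall_mem_span (tens 𝔸.A (F.f k))
    (fun l => if l = i ∨ l = j then S else 𝔸.pure V 0) ⊥ (fun s hs => ?_) v (fun l => ?_)
  · simpa using this
  · have hs' : ∀ l, ∃ (n : ℤ) (e : 𝔸.A) (x : V), e ∈ 𝔸.gr n ∧ e ⊗ₜ[K] x = s l ∧
        (l = i ∨ l = j → ∃ (m : ℤ) (a : 𝔸.A), a ∈ 𝔸.gr m ∧ e = μ * a) := by
      intro l
      have := hs l
      by_cases hl : l = i ∨ l = j
      · rw [if_pos hl] at this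
        obtain ⟨n, e, x, he, hx, h⟩ := this
        exact ⟨r + n, μ * e, x, 𝔸.mul_mem hμ he, h, fun _ => ⟨n, e, he, rfl⟩⟩
      · rw [if_neg hl] at this
        obtain ⟨n, e, x, he, hx, h⟩ := this
        exact ⟨n, e, x, he, h, fun h => (hl h).elim⟩
    choose n e x he hs' hμe using hs'
    obtain rfl : (fun i => e i ⊗ₜ[K] x i) = s := funext hs'
    obtain ⟨m, a, ha, hia⟩ := hμe i (Or.inl rfl)
    obtain ⟨_, b, _, hjb⟩ := hμe j (Or.inr rfl)
    rw [tens_tmul, 𝔸.prod_eq_zero_of_two hμ hμ2 n e he i j hij a b ha hia hjb,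
      TensorProduct.zero_tmul]
    exact zero_mem _
  · by_cases hl : l = i ∨ l = j
    · rw [if_pos hl]
      rcases hl with rfl | rfl
      · rw [hi]; exact hS
      · rw [hj]; exact hS
    · rw [if_neg hl]; exact hv l

/-- First order Taylor expansion in a square zero direction. -/
theorem tens_add_lmul {F : Fam V W} {k : ℕ} {μ : 𝔸.A} {r : ℤ} (hμ : μ ∈ 𝔸.gr r)
    (hμ2 : μ * μ = 0) {v u : 𝔸.A ⊗[K] V} (hv : v ∈ 𝔸.pts V 0) (hu : u ∈ 𝔸.pts V r) :
    tens 𝔸.A (F.f (k + 1)) (fun _ => v + lmul V μ u) = tens 𝔸.A (F.f (k + 1)) (fun _ => v) +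
      ((k + 1 : ℕ) : K) • tens 𝔸.A (F.f (k + 1)) (Fin.cons (lmul V μ u) fun _ => v) := by
  classical
  set w := lmul V μ u with hw
  have hwm : w ∈ 𝔸.pts V 0 := lmul_mem_pts hμ hu (by ring)
  have h1 : (fun _ : Fin (k + 1) => v + w) = (fun _ => w) + fun _ => v := by
    funext i; exact add_comm _ _
  rw [h1, MultilinearMap.map_add_univ]
  let g : Finset (Fin (k + 1)) → 𝔸.A ⊗[K] W := fun s =>
    tens 𝔸.A (F.f (k + 1)) (s.piecewise (fun _ => w) fun _ => v)
  have hpm : ∀ (s : Finset (Fin (k + 1))) i, s.piecewise (fun _ => w) (fun _ => v) i ∈ 𝔸.pts V 0 := by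
    intro s i
    by_cases h : i ∈ s
    · simpa [h] using hwm
    · simpa [h] using hv
  -- In the expansion over subsets only the empty set and the singletons survive; `Option` indexes
  -- exactly these.
  rw [← Fintype.sum_of_injective (fun o : Option (Fin (k + 1)) => o.elim ∅ fun i => {i}) ?_
    (fun o => g (o.elim ∅ fun i => {i})) g ?_ (fun _ => rfl)]
  · rw [Fintype.sum_option]
    congr 1
    · have : ∀ i, g {i} = tens 𝔸.A (F.f (k + 1)) (Fin.cons w fun _ => v) := by
        intro i
        have := tens_perm (F := F) (({i} : Finset (Fin (k + 1))).piecewise (fun _ => w) fun _ => v)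
          (hpm _) (Equiv.swap 0 i)
        refine this.symm.trans (congrArg _ ?_)
        funext j
        refine Fin.cases ?_ (fun j => ?_) j
        · simp
        · rw [Fin.cons_succ, Finset.piecewise_eq_of_notMem]
          rw [Finset.mem_singleton]
          intro h
          have : (Equiv.swap 0 i) (j.succ) = (Equiv.swap 0 i) 0 := by rw [h, Equiv.swap_apply_left]
          exact Fin.succ_ne_zero j ((Equiv.swap 0 i).injective this)
      simp only [Option.elim_some, this]
      rw [Finset.sum_const, Finset.card_univ, Fintype.card_fin, Nat.cast_smul_eq_nsmul]
  · rintro (_ | i) (_ | j) h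
    · rfl
    · exact absurd h.symm (Finset.singleton_ne_empty j)
    · exact absurd h (Finset.singleton_ne_empty i)
    · exact congrArg some (Finset.singleton_injective h)
  · intro s hs
    have : 1 < s.card := by
      by_contra hcon
      rw [not_lt, Finset.card_le_one_iff_subset_singleton] at hcon
      obtain ⟨i, hi⟩ := hcon
      rcases Finset.subset_singleton_iff.mp hi with h | h
      · exact hs ⟨none, h.symm⟩
      · exact hs ⟨some i, h.symm⟩
    rw [Finset.one_lt_card] at this
    obtain ⟨i, hi, j, hj, hij⟩ := this
    rcases lt_or_gt_of_ne hij with h | h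
    · exact tens_two_eq_zero hμ hμ2 hu _ (hpm s) i j h (by simp [hi, hw]) (by simp [hj, hw])
    · exact tens_two_eq_zero hμ hμ2 hu _ (hpm s) j i h (by simp [hj, hw]) (by simp [hi, hw])

/-- This is how identities are differentiated: substitute `v + μ u` and compare the parts containing
`μ`. The `k + 1` equal first order terms turn `1/(k + 1)!` into `1/k!`. -/
theorem val_add_lmul [CharZero K] (F : Fam V W) {μ : 𝔸.A} {r : ℤ} (hμ : μ ∈ 𝔸.gr r)
    (hμ2 : μ * μ = 0) {v u : 𝔸.A ⊗[K] V} (hv : v ∈ 𝔸.pts V 0) (hu : u ∈ 𝔸.pts V r) :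
    F.val (v + lmul V μ u) = F.val v + lmul W μ (F.D v u) := by
  have hwm : lmul V μ u ∈ 𝔸.pts V 0 := lmul_mem_pts hμ hu (by ring)
  rw [val_eq_sum F (add_mem hv hwm) (Nat.le_succ _), val_eq_sum F hv (Nat.le_succ _),
    ← D_lmul, D_apply, Finset.sum_range_succ', Finset.sum_range_succ']
  have h0 : ∀ x : 𝔸.A ⊗[K] V, tens 𝔸.A (F.f 0) (fun _ => x) = 0 := fun x => by
    rw [F.zero, tens_zero]; rfl
  simp only [h0, smul_zero, add_zero]
  rw [← Finset.sum_add_distrib]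
  refine Finset.sum_congr rfl fun k _ => ?_
  have hk : ((k + 1 : ℕ) : K) ≠ 0 := by exact_mod_cast k.succ_ne_zero
  have hk' : (k.factorial : K) ≠ 0 := by exact_mod_cast k.factorial_ne_zero
  rw [tens_add_lmul hμ hμ2 hv hu, smul_add, smul_smul]
  congr 2
  rw [Nat.factorial_succ, Nat.cast_mul]
  field_simp

end Fam

end Points

/-! ### Compatibility of operations on families with their values at points -/

section CompAlong

theorem List.prod_ofFn_composition {M : Type*} [Monoid M] {k : ℕ} (c : Composition k)
    (e : Fin k → M) :
    (List.ofFn fun i : Fin c.length => (List.ofFn fun j => e (c.embedding i j)).prod).prod =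
      (List.ofFn e).prod := by
  have h := List.flatten_splitWrtCompositionAux (ns := c.blocks) (l := List.ofFn e)
    (by simp [c.blocks_sum])
  change ((List.ofFn e).splitWrtComposition c).flatten = _ at h
  conv_rhs => rw [← h, List.prod_flatten]
  congr 1
  apply List.ext_getElem
  · simp
  · intro i h1 h2
    simp only [List.getElem_ofFn, List.getElem_map, List.getElem_splitWrtComposition]
    congr 1
    have hi : i < c.length := by simpa using h1
    have hs : c.sizeUpTo (i + 1) = c.sizeUpTo i + c.blocksFun ⟨i, hi⟩ := c.sizeUpTo_succ' ⟨i, hi⟩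
    have hle : c.sizeUpTo (i + 1) ≤ k := c.sizeUpTo_le _
    apply List.ext_getElem
    · simp only [List.length_ofFn, List.length_drop, List.length_take]
      omega
    · intro j h3 h4
      simp only [List.getElem_ofFn, List.getElem_drop, List.getElem_take]
      congr 1

variable {K : Type u} [Field K] {A : Type*} [Ring A] [Algebra K A]
  {V W X : Type*} [AddCommGroup V] [Module K V] [AddCommGroup W] [Module K W]
  [AddCommGroup X] [Module K X]

/-- The blocks of a composition are consecutive, so both sides collect the coefficients in the same
order. -/
theorem tens_compAlong {k : ℕ} (c : Composition k)
    (G : MultilinearMap K (fun _ : Fin c.length => W) X)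
    (F : (j : ℕ) → MultilinearMap K (fun _ : Fin j => V) W) (v : A ⊗[K] V) :
    tens A (Fam.compAlong c G F) (fun _ => v) =
      tens A G fun i => tens A (F (c.blocksFun i)) fun _ => v := by
  have : tens A (Fam.compAlong c G F) = Fam.compAlong c (tens A G) fun j => tens A (F j) := by
    refine tens_ext fun e x => ?_
    rw [tens_tmul, Fam.compAlong_apply, Fam.compAlong_apply]
    simp only [tens_tmul]
    rw [List.prod_ofFn_composition]
  rw [this, Fam.compAlong_apply]

theorem tens_insAlong {k : ℕ} (i : Fin (k + 1))
    (F : MultilinearMap K (fun _ : Fin (k - i + 1) => V) W)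
    (l : MultilinearMap K (fun _ : Fin (i : ℕ) => V) V) (v : A ⊗[K] V) :
    tens A (Fam.insAlong i F l) (fun _ => v) =
      tens A F (Fin.cons (tens A l fun _ => v) fun _ => v) := by
  have : tens A (Fam.insAlong i F l) = Fam.insAlong i (tens A F) (tens A l) := by
    refine tens_ext fun e x => ?_
    rw [tens_tmul, Fam.insAlong_apply, Fam.insAlong_apply]
    have h1 : (fun j : Fin (i : ℕ) => e (Fin.castLE (Nat.lt_succ_iff.mp i.isLt) j) ⊗ₜ[K]
      x (Fin.castLE (Nat.lt_succ_iff.mp i.isLt) j)) = _ := rfl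
    rw [tens_tmul l (fun j => e (Fin.castLE (Nat.lt_succ_iff.mp i.isLt) j))]
    have h2 : (Fin.cons ((List.ofFn fun j : Fin (i : ℕ) =>
          e (Fin.castLE (Nat.lt_succ_iff.mp i.isLt) j)).prod ⊗ₜ[K]
          l fun j => x (Fin.castLE (Nat.lt_succ_iff.mp i.isLt) j))
        (fun j : Fin (k - (i : ℕ)) => e ⟨(i : ℕ) + (j : ℕ), by omega⟩ ⊗ₜ[K]
          x ⟨(i : ℕ) + (j : ℕ), by omega⟩) : Fin (k - i + 1) → A ⊗[K] V) =
        fun j => (Fin.cons ((List.ofFn fun j : Fin (i : ℕ) =>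
          e (Fin.castLE (Nat.lt_succ_iff.mp i.isLt) j)).prod)
          (fun j : Fin (k - (i : ℕ)) => e ⟨(i : ℕ) + (j : ℕ), by omega⟩) : Fin (k - i + 1) → A) j ⊗ₜ[K]
          (Fin.cons (l fun j => x (Fin.castLE (Nat.lt_succ_iff.mp i.isLt) j))
          (fun j : Fin (k - (i : ℕ)) => x ⟨(i : ℕ) + (j : ℕ), by omega⟩) : Fin (k - i + 1) → V) j := by
      funext j
      refine Fin.cases ?_ (fun j => ?_) j <;> simp
    rw [h2, tens_tmul]
    congr 1
    rw [List.ofFn_succ, List.prod_cons]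
    simp only [Fin.cons_zero, Fin.cons_succ]
    have hk : k = (i : ℕ) + (k - i) := by omega
    rw [List.ofFn_congr hk, List.ofFn_add, List.prod_append]
    rfl
  rw [this, Fam.insAlong_apply]

end CompAlong

section Points

variable {K : Type u} [Field K] {𝔸 : PointAlg.{u} K} {V : GMod.{u, v} K} {W : GMod.{u, w} K}
  {X : GMod.{u, x} K}

namespace Fam

@[simp] theorem val_zero (v : 𝔸.A ⊗[K] V) : (0 : Fam V W).val v = 0 := by
  simp [val]

theorem val_at_zero (F : Fam V W) : F.val (0 : 𝔸.A ⊗[K] V) = 0 := by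
  refine Finset.sum_eq_zero fun k _ => ?_
  rcases k with _ | k
  · rw [F.zero, tens_zero]; exact smul_zero _
  · rw [MultilinearMap.map_coord_zero _ 0 rfl, smul_zero]

@[simp] theorem val_add (F G : Fam V W) (v : 𝔸.A ⊗[K] V) : (F + G).val v = F.val v + G.val v := by
  simp only [val, add_f, tens_add, add_apply, smul_add, Finset.sum_add_distrib]

@[simp] theorem val_sub (F G : Fam V W) (v : 𝔸.A ⊗[K] V) : (F - G).val v = F.val v - G.val v := by
  simp only [val, sub_f, tens_sub, ← Finset.sum_sub_distrib]
  exact Finset.sum_congr rfl fun k _ => smul_sub _ _ _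

@[simp] theorem val_post (L : W →ₗ[K] X) (F : Fam V W) (v : 𝔸.A ⊗[K] V) :
    (post L F).val v = L.lTensor 𝔸.A (F.val v) := by
  simp only [val, post_f, tens_postcomp, map_sum, map_smul]

@[simp] theorem val_pre (F : Fam W X) (L : V →ₗ[K] W) (hL : GMod.HomogLin V W L 0)
    (v : 𝔸.A ⊗[K] V) : (pre F L hL).val v = F.val (L.lTensor 𝔸.A v) := by
  simp only [val]
  refine Finset.sum_congr rfl fun k _ => ?_
  congr 1
  exact tens_precomp _ _ _

theorem tens_lin_one (L : V →ₗ[K] W) (v : Fin 1 → 𝔸.A ⊗[K] V) :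
    tens 𝔸.A ((lin L).f 1) v = L.lTensor 𝔸.A (v 0) := by
  have : tens 𝔸.A ((lin L).f 1) = (L.lTensor 𝔸.A).compMultilinearMap
      (MultilinearMap.ofSubsingleton K _ _ (0 : Fin 1) LinearMap.id) := by
    refine tens_ext fun e x => ?_
    rw [tens_tmul, lin_one]
    simp
  rw [this]; rfl

theorem val_lin (L : V →ₗ[K] W) {v : 𝔸.A ⊗[K] V} (hv : v ∈ 𝔸.pts V 0) :
    (lin L).val v = L.lTensor 𝔸.A v := by
  rw [val_eq_sum _ hv (Nat.le_add_right _ 2), Finset.sum_eq_single_of_mem 1 (by simp)]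
  · simp [tens_lin_one]
  · intro k _ hk
    rw [lin_of_ne L hk, tens_zero]; exact smul_zero _

theorem D_lin (L : V →ₗ[K] W) (v u : 𝔸.A ⊗[K] V) : (lin L).D v u = L.lTensor 𝔸.A u := by
  rw [D_apply, Finset.sum_eq_single_of_mem 0 (by simpa using 𝔸.N_pos)]
  · have := tens_lin_one (𝔸 := 𝔸) L (Fin.cons u fun _ => v)
    simpa using this
  · intro k _ hk
    rw [lin_of_ne L (by omega), tens_zero]; exact smul_zero _

@[simp] theorem D_zero (v : 𝔸.A ⊗[K] V) : (0 : Fam V W).D v = 0 := by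
  refine LinearMap.ext fun u => ?_
  rw [D_apply]
  simp

@[simp] theorem D_post (L : W →ₗ[K] X) (F : Fam V W) (v u : 𝔸.A ⊗[K] V) :
    (post L F).D v u = L.lTensor 𝔸.A (F.D v u) := by
  simp only [D_apply, post_f, tens_postcomp, map_sum, map_smul]

@[simp] theorem D_pre (F : Fam W X) (L : V →ₗ[K] W) (hL : GMod.HomogLin V W L 0)
    (v u : 𝔸.A ⊗[K] V) :
    (pre F L hL).D v u = F.D (L.lTensor 𝔸.A v) (L.lTensor 𝔸.A u) := by
  simp only [D_apply]
  refine Finset.sum_congr rfl fun k _ => ?_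
  congr 1
  refine (tens_precomp _ _ _).trans (congrArg _ ?_)
  funext i
  refine Fin.cases ?_ (fun i => ?_) i <;> simp

variable [CharZero K]

/-- Expanding `G` at the sum `F.val v` gives terms indexed by a length and a tuple of block sizes,
and such tuples are the same as compositions. The bijection is the one used for composing formal
power series. -/
theorem val_comp (G : Fam W X) (F : Fam V W) (hF : F.Homog 0) {v : 𝔸.A ⊗[K] V}
    (hv : v ∈ 𝔸.pts V 0) : (comp G F).val v = G.val (F.val v) := by
  classical
  set N := 𝔸.N
  have hN : 𝔸.N = N := rfl
  let t : (Σ n, Composition n) → 𝔸.A ⊗[K] X := fun s =>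
    ((s.2.length.factorial : K) * ∏ i : Fin s.2.length, ((s.2.blocksFun i).factorial : K))⁻¹ •
      tens 𝔸.A (G.f s.2.length) fun i => tens 𝔸.A (F.f (s.2.blocksFun i)) fun _ => v
  have hFv : F.val v = ∑ j ∈ Finset.Ico 1 N, ((j.factorial : K))⁻¹ •
      tens 𝔸.A (F.f j) fun _ => v := by
    rw [val, Finset.range_eq_Ico]
    refine (Finset.sum_subset (Finset.Ico_subset_Ico_left (Nat.zero_le 1)) fun j h1 h2 => ?_).symm
    rw [Finset.mem_Ico] at h1 h2
    obtain rfl : j = 0 := by omega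
    rw [F.zero, tens_zero]; exact smul_zero _
  have hR : G.val (F.val v) = ∑ e ∈ FormalMultilinearSeries.compPartialSumTarget 0 N N, t e := by
    rw [← FormalMultilinearSeries.compChangeOfVariables_sum 0 N N (fun s =>
      (((s.1).factorial : K) * ∏ i : Fin s.1, ((s.2 i).factorial : K))⁻¹ •
        tens 𝔸.A (G.f s.1) fun i => tens 𝔸.A (F.f (s.2 i)) fun _ => v) t]
    · rw [FormalMultilinearSeries.compPartialSumSource, Finset.sum_sigma, hFv, val,
        Finset.range_eq_Ico]
      refine Finset.sum_congr rfl fun n _ => ?_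
      rw [MultilinearMap.map_sum_finset, Finset.smul_sum]
      refine Finset.sum_congr rfl fun r _ => ?_
      rw [MultilinearMap.map_smul_univ, smul_smul, mul_inv, Finset.prod_inv_distrib]
    · rintro ⟨n, r⟩ h
      have hl := FormalMultilinearSeries.compChangeOfVariables_length 0 N N h
      have hb := FormalMultilinearSeries.compChangeOfVariables_blocksFun 0 N N h
      have key : ∀ (s : Σ n, Composition n) (hl : s.2.length = n)
          (_ : ∀ j : Fin n, s.2.blocksFun ⟨j, hl.symm ▸ j.2⟩ = r j),
          ((n.factorial : K) * ∏ i : Fin n, ((r i).factorial : K))⁻¹ •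
            (tens 𝔸.A (G.f n) fun i => tens 𝔸.A (F.f (r i)) fun _ => v) = t s := by
        rintro ⟨m, c⟩ hl hb
        dsimp only at hl hb
        subst hl
        obtain rfl : r = c.blocksFun := funext fun j => (hb j).symm
        rfl
      exact key _ hl hb
  -- A composition with fewer than `N` blocks, each shorter than `N`, has size below `N * N + N`, so
  -- no relevant term is cut off.
  rw [hR, comp, val_ofSym _ _ hv (M := N * N + N) (by omega)]
  simp only [tens_sum, sum_apply, tens_smul, smul_apply, tens_compAlong]
  rw [← Finset.sum_sigma (Finset.range (N * N + N)) (fun _ => Finset.univ) t]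
  symm
  refine Finset.sum_subset ?_ ?_
  · rintro ⟨n, c⟩ h
    rw [FormalMultilinearSeries.mem_compPartialSumTarget_iff] at h
    simp only [Finset.mem_sigma, Finset.mem_range, Finset.mem_univ, and_true]
    have h1 : n = ∑ i, c.blocksFun i := c.sum_blocksFun.symm
    have h2 : ∑ i, c.blocksFun i ≤ ∑ _i : Fin c.length, N :=
      Finset.sum_le_sum fun i _ => (h.2.2 i).le
    simp only [Finset.sum_const, Finset.card_univ, Fintype.card_fin, smul_eq_mul] at h2
    have h3 : c.length * N ≤ N * N := Nat.mul_le_mul_right _ h.2.1.le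
    have h4 : 0 < N := 𝔸.N_pos
    omega
  · rintro ⟨n, c⟩ _ h
    rw [FormalMultilinearSeries.mem_compPartialSumTarget_iff] at h
    simp only [zero_le, true_and, not_and_or, not_lt, not_forall] at h
    simp only [t]
    refine (congrArg (_ • ·) ?_).trans (smul_zero _)
    -- The additional compositions have at least `N` blocks or a block of length at least `N`.
    -- Nilpotency kills the outer map in the first case and an inner one in the second.
    rcases h with h | ⟨i, h⟩
    · refine tens_eq_zero_of_le _ h (fun _ => 0) _ fun i => ?_
      obtain ⟨b, hb⟩ : ∃ b, c.blocksFun i = b + 1 :=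
        ⟨c.blocksFun i - 1, by have := c.one_le_blocksFun i; omega⟩
      rw [hb]
      exact tens_mem_pts (hF _) (fun _ => 0) _ (fun _ => hv) (by simp)
    · refine MultilinearMap.map_coord_zero _ i ?_
      exact tens_eq_zero_of_le _ h (fun _ => 0) _ fun i => hv

theorem val_ins (F : Fam V W) (l : Fam V V) {p : ℤ} (hl : l.Homog p) {v : 𝔸.A ⊗[K] V}
    (hv : v ∈ 𝔸.pts V 0) : (ins F l).val v = F.D v (l.val v) := by
  set N := 𝔸.N
  have hlv : l.val v ∈ 𝔸.pts V p := val_mem hl hv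
  rw [ins, val_ofSym _ _ hv (M := N + N) (by omega)]
  simp only [tens_sum, sum_apply, tens_smul, smul_apply, tens_insAlong]
  have hz : ∀ i j, N ≤ i ∨ N ≤ j → tens 𝔸.A (F.f (j + 1))
      (Fin.cons (tens 𝔸.A (l.f i) fun _ => v) fun _ => v) = 0 := by
    intro i j h
    rcases h with h | h
    · refine MultilinearMap.map_coord_zero _ 0 ?_
      rw [Fin.cons_zero]
      exact tens_eq_zero_of_le _ h (fun _ => 0) _ fun i => hv
    · rcases i with _ | i
      · refine MultilinearMap.map_coord_zero _ 0 ?_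
        rw [Fin.cons_zero, l.zero, tens_zero]; rfl
      · refine tens_eq_zero_of_le _ (by omega) (Fin.cons p fun _ => 0) _ fun i => ?_
        refine Fin.cases ?_ (fun i => ?_) i
        · rw [Fin.cons_zero, Fin.cons_zero]
          exact tens_mem_pts (hl _) (fun _ => 0) _ (fun _ => hv) (by simp)
        · simpa only [Fin.cons_succ] using hv
  let g : ℕ → ℕ → 𝔸.A ⊗[K] W := fun i j => ((i.factorial : K) * (j.factorial : K))⁻¹ •
    tens 𝔸.A (F.f (j + 1)) (Fin.cons (tens 𝔸.A (l.f i) fun _ => v) fun _ => v)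
  have hL : ∀ k, ∑ i : Fin (k + 1), (((i : ℕ).factorial : K) * ((k - (i : ℕ)).factorial : K))⁻¹ •
      tens 𝔸.A (F.f (k - i + 1)) (Fin.cons (tens 𝔸.A (l.f i) fun _ => v) fun _ => v) =
      ∑ x ∈ Finset.HasAntidiagonal.antidiagonal k, g x.1 x.2 := fun k => by
    rw [Finset.Nat.sum_antidiagonal_eq_sum_range_succ g, ← Fin.sum_univ_eq_sum_range
      (fun i => g i (k - i))]
  rw [Finset.sum_congr rfl fun k _ => hL k]
  rw [Finset.sum_sigma']
  have hR : F.D v (l.val v) = ∑ x ∈ Finset.range N ×ˢ Finset.range N, g x.1 x.2 := by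
    rw [Finset.sum_product_right, D_apply]
    refine Finset.sum_congr rfl fun j _ => ?_
    have : tens 𝔸.A (F.f (j + 1)) (Fin.cons (l.val v) fun _ => v) =
        (tens 𝔸.A (F.f (j + 1))).curryLeft (l.val v) fun _ => v := rfl
    rw [this, val, map_sum, sum_apply, Finset.smul_sum]
    refine Finset.sum_congr rfl fun i _ => ?_
    rw [map_smul, smul_apply, smul_smul, ← mul_inv, mul_comm]
    rfl
  rw [hR]
  -- Sort the pairs `(i, j)` by their sum; pairs outside the square `i, j < N` contribute zero by
  -- `hz`.
  refine (Finset.sum_bij_ne_zero (fun x _ _ => ⟨x.1 + x.2, x⟩) ?_ ?_ ?_ ?_).symm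
  · rintro ⟨i, j⟩ h _
    simp only [Finset.mem_product, Finset.mem_range] at h
    simp only [Finset.mem_sigma, Finset.mem_range, Finset.HasAntidiagonal.mem_antidiagonal, and_true]
    omega
  · rintro ⟨i, j⟩ _ _ ⟨i', j'⟩ _ _ h
    simp only [Sigma.mk.injEq, heq_eq_eq] at h
    exact h.2
  · rintro ⟨k, i, j⟩ h hne
    simp only [Finset.mem_sigma, Finset.mem_range, Finset.HasAntidiagonal.mem_antidiagonal] at h
    obtain ⟨h1, rfl⟩ := h
    refine ⟨(i, j), ?_, hne, rfl⟩
    rw [Finset.mem_product, Finset.mem_range, Finset.mem_range]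
    by_contra hcon
    refine hne ?_
    simp only [g]
    rw [hz i j (by change ¬ (i < N ∧ j < N) at hcon; omega), smul_zero]
  · intros; rfl

theorem val_der (F : Fam V W) {v : 𝔸.A ⊗[K] V.tan} (hv : v ∈ 𝔸.pts V.tan 0) :
    (der F).val v = F.D (V.tanFst.lTensor 𝔸.A v) (V.tanSnd.lTensor 𝔸.A v) := by
  rw [D_apply]
  refine (val_ofSym _ _ hv (Nat.le_succ _)).trans ?_
  rw [Finset.sum_range_succ']
  have h0 : tens 𝔸.A ((((0 - 1).factorial : K))⁻¹ • (F.f 0).compLinearMap fun i =>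
    if (i : ℕ) = 0 then V.tanSnd else V.tanFst) (fun _ => v) = 0 := by
    rw [F.zero, tens_smul, smul_apply]
    refine (congrArg _ ((tens_precomp _ _ _))).trans ?_
    rw [tens_zero]; exact smul_zero _
  refine (congrArg₂ (· + ·) ?_ h0).trans (add_zero _)
  refine Finset.sum_congr rfl fun k _ => ?_
  rw [tens_smul, smul_apply, Nat.add_sub_cancel]
  congr 1
  refine (tens_precomp _ _ _).trans (congrArg _ ?_)
  funext i
  refine Fin.cases ?_ (fun i => ?_) i <;> simp

end Fam

end Points

/-! ### Universal points -/

section ExteriorMonomials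

variable (K : Type u) [Field K] {ι : Type} [DecidableEq ι]

/-- A generator of the exterior algebra of `K^ι`. -/
noncomputable def extGen (i : ι) : ExteriorAlgebra K (ι → K) := ExteriorAlgebra.ι K (Pi.single i 1)

/-- A monomial in the exterior algebra of `K^ι`. -/
noncomputable def extMon (L : List ι) : ExteriorAlgebra K (ι → K) := (L.map (extGen K)).prod

variable {K}

theorem extMon_append (L M : List ι) : extMon K (L ++ M) = extMon K L * extMon K M := by
  simp [extMon]

theorem extMon_flatten (L : List (List ι)) : extMon K L.flatten = (L.map (extMon K)).prod := by
  induction L with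
  | nil => rfl
  | cons a L ih => rw [List.flatten_cons, extMon_append, ih, List.map_cons, List.prod_cons]

theorem extMon_eq_ιMulti (L : List ι) : extMon K L =
    ExteriorAlgebra.ιMulti K L.length fun i => (Pi.single (L.get i) 1 : ι → K) := by
  rw [ExteriorAlgebra.ιMulti_apply, extMon]
  congr 1
  apply List.ext_getElem
  · simp
  · intro i h1 h2
    simp [extGen]

theorem extMon_eq_zero {L : List ι} (h : ¬ L.Nodup) : extMon K L = 0 := by
  rw [extMon_eq_ιMulti]
  refine AlternatingMap.map_eq_zero_of_not_injective _ _ fun hi => h ?_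
  rw [List.nodup_iff_injective_get]
  intro a b hab
  exact hi (by simp only [hab])

/-- The minor on the coordinates listed in `L` is an alternating form. On the corresponding basis
vectors it is the determinant of an identity matrix. -/
theorem exists_functional_extMon {L : List ι} (h : L.Nodup) :
    ∃ τ : ExteriorAlgebra K (ι → K) →ₗ[K] K, τ (extMon K L) = 1 := by
  let r : (ι → K) →ₗ[K] (Fin L.length → K) := LinearMap.funLeft K K L.get
  let φ : ∀ k : ℕ, (ι → K) [⋀^Fin k]→ₗ[K] K := fun k =>
    if e : L.length = k then
      ((Matrix.detRowAlternating (n := Fin L.length) (R := K)).compLinearMap r).domDomCongr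
        (finCongr e) else 0
  refine ⟨ExteriorAlgebra.liftAlternating φ, ?_⟩
  rw [extMon_eq_ιMulti, ExteriorAlgebra.liftAlternating_apply_ιMulti]
  simp only [φ, dif_pos]
  change Matrix.det (fun i j => (Pi.single (L.get i) 1 : ι → K) (L.get j)) = 1
  refine (congrArg Matrix.det ?_).trans (Matrix.det_one (R := K) (n := Fin L.length))
  ext i j
  rw [Matrix.one_apply, Pi.single_apply]
  congr 1
  rw [eq_iff_iff, eq_comm]
  exact (List.nodup_iff_injective_get.mp h).eq_iff

theorem extGen_mul_extMon {δ : ι → ℤ} (hδ : ∀ i, Odd (δ i)) (i : ι) (M : List ι) :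
    extGen K i * extMon K M = ((Int.negOnePow (M.map δ).sum : ℤ) : ExteriorAlgebra K (ι → K)) *
      (extMon K M * extGen K i) := by
  induction M with
  | nil => simp [extMon]
  | cons j M ih =>
    have h : extMon K (j :: M) = extGen K j * extMon K M := by simp [extMon]
    have hsw : extGen K i * extGen K j = -(extGen K j * extGen K i) :=
      eq_neg_of_add_eq_zero_left (ExteriorAlgebra.ι_add_mul_swap _ _)
    rw [h, ← mul_assoc, hsw, neg_mul, mul_assoc, ih, List.map_cons, List.sum_cons, Int.negOnePow_add,
      Int.negOnePow_odd _ (hδ j)]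
    rw [← mul_assoc, ← (Int.cast_commute _ (extGen K j)).eq]
    simp [mul_assoc]

/-- All generators anticommute and have odd degree, so the parity of the degree of a monomial is the
parity of its length. -/
theorem extMon_comm {δ : ι → ℤ} (hδ : ∀ i, Odd (δ i)) (L M : List ι) :
    extMon K L * extMon K M = ((Int.negOnePow ((L.map δ).sum * (M.map δ).sum) : ℤ) :
      ExteriorAlgebra K (ι → K)) * (extMon K M * extMon K L) := by
  induction L with
  | nil => simp [extMon]
  | cons j L ih =>
    have h : extMon K (j :: L) = extGen K j * extMon K L := by simp [extMon]
    have hs : Int.negOnePow (δ j * (M.map δ).sum) = Int.negOnePow (M.map δ).sum := by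
      rw [Int.negOnePow_eq_iff]
      obtain ⟨c, hc⟩ := hδ j
      rw [hc]
      exact ⟨c * (M.map δ).sum, by ring⟩
    rw [h, mul_assoc, ih, ← mul_assoc, ← (Int.cast_commute _ (extGen K j)).eq, mul_assoc,
      ← mul_assoc (extGen K j), extGen_mul_extMon hδ, List.map_cons, List.sum_cons, add_mul,
      Int.negOnePow_add, hs]
    push_cast
    rw [← (Int.cast_commute _ _).eq]
    simp only [mul_assoc]

/-- The homogeneous nilpotent elements for given odd degrees of the generators. -/
noncomputable def extGr (K : Type u) [Field K] (δ : ι → ℤ) (n : ℤ) :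
    Submodule K (ExteriorAlgebra K (ι → K)) :=
  Submodule.span K {x | ∃ L : List ι, L ≠ [] ∧ (L.map δ).sum = n ∧ extMon K L = x}

theorem extMon_mem_extGr {δ : ι → ℤ} {n : ℤ} {L : List ι} (h : L ≠ []) (hn : (L.map δ).sum = n) :
    extMon K L ∈ extGr K δ n := Submodule.subset_span ⟨L, h, hn, rfl⟩

theorem mul_mem_extGr {δ : ι → ℤ} {i j : ℤ} {a b : ExteriorAlgebra K (ι → K)}
    (ha : a ∈ extGr K δ i) (hb : b ∈ extGr K δ j) : a * b ∈ extGr K δ (i + j) := by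
  have h := Submodule.mul_mem_mul ha hb
  rw [extGr, extGr, Submodule.span_mul_span] at h
  refine Submodule.span_le.mpr ?_ h
  rintro _ ⟨_, ⟨L, hL, rfl, rfl⟩, _, ⟨M, hM, rfl, rfl⟩, rfl⟩
  dsimp only
  rw [← extMon_append]
  exact extMon_mem_extGr (by simp [hL]) (by simp)

theorem comm_extGr {δ : ι → ℤ} (hδ : ∀ i, Odd (δ i)) {i j : ℤ} {a b : ExteriorAlgebra K (ι → K)}
    (ha : a ∈ extGr K δ i) (hb : b ∈ extGr K δ j) :
    a * b = ((Int.negOnePow (i * j) : ℤ) : ExteriorAlgebra K (ι → K)) * (b * a) := by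
  induction ha using Submodule.span_induction with
  | zero => simp
  | add x y _ _ hx hy => rw [add_mul, hx, hy, mul_add, mul_add]
  | smul c x _ hx => rw [smul_mul_assoc, hx, mul_smul_comm, mul_smul_comm]
  | mem x hx =>
    obtain ⟨L, -, rfl, rfl⟩ := hx
    induction hb using Submodule.span_induction with
    | zero => simp
    | add x y _ _ hx hy => rw [mul_add, hx, hy, add_mul, mul_add]
    | smul c x _ hx => rw [mul_smul_comm, hx, smul_mul_assoc, mul_smul_comm]
    | mem y hy =>
      obtain ⟨M, -, rfl, rfl⟩ := hy
      exact extMon_comm hδ L M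

theorem prod_ofFn_extMon {k : ℕ} (L : Fin k → List ι) :
    (List.ofFn fun i => extMon K (L i)).prod = extMon K (List.ofFn L).flatten := by
  rw [extMon_flatten, List.map_ofFn]; rfl

/-- Each factor is a combination of nonempty monomials; more factors than generators force a
repeated generator. -/
theorem nil_extGr [Fintype ι] {δ : ι → ℤ} {k : ℕ} (hk : Fintype.card ι < k) (d : Fin k → ℤ)
    (e : Fin k → ExteriorAlgebra K (ι → K)) (he : ∀ i, e i ∈ extGr K δ (d i)) :
    (List.ofFn e).prod = 0 := by
  have := MultilinearMap.map_mem_of_forall_mem_span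
    (MultilinearMap.mkPiAlgebraFin K k (ExteriorAlgebra K (ι → K)))
    (fun i => {x | ∃ L : List ι, L ≠ [] ∧ (L.map δ).sum = d i ∧ extMon K L = x}) ⊥ ?_ e he
  · simpa using this
  intro s hs
  choose L hL hd hs using hs
  obtain rfl : (fun i => extMon K (L i)) = s := funext hs
  rw [MultilinearMap.mkPiAlgebraFin_apply, prod_ofFn_extMon, extMon_eq_zero]
  · exact zero_mem _
  · intro hn
    have h1 := hn.length_le_card
    rw [List.length_flatten, List.map_ofFn, List.sum_ofFn] at h1
    have h2 : ∑ _i : Fin k, 1 ≤ ∑ i, (List.length ∘ L) i :=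
      Finset.sum_le_sum fun i _ => List.length_pos_of_ne_nil (hL i)
    simp at h2
    simp only [Function.comp] at h1
    omega

end ExteriorMonomials

/-! ### Universal points with prescribed coordinates -/

section Universal

variable {K : Type u} [Field K]

/-- Degrees of exterior generators. -/
def genDeg {n : ℕ} (d : Fin n → ℤ) (i : Fin n × Bool) : ℤ :=
  if Odd (d i.1) then (if i.2 then 1 else d i.1) else if i.2 then d i.1 - 1 else 1

theorem odd_genDeg {n : ℕ} (d : Fin n → ℤ) (i : Fin n × Bool) : Odd (genDeg d i) := by
  unfold genDeg
  split_ifs with h1 h2 h2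
  · exact odd_one
  · exact h1
  · exact (Int.not_odd_iff_even.mp h1).sub_odd odd_one
  · exact odd_one

/-- The exterior generators whose product is a generator of the given degree. -/
def genBlock {n : ℕ} (d : Fin n → ℤ) (j : Fin n) : List (Fin n × Bool) :=
  if Odd (d j) then [(j, false)] else [(j, false), (j, true)]

theorem genBlock_ne_nil {n : ℕ} (d : Fin n → ℤ) (j : Fin n) : genBlock d j ≠ [] := by
  unfold genBlock; split_ifs <;> simp

theorem sum_genBlock {n : ℕ} (d : Fin n → ℤ) (j : Fin n) :
    ((genBlock d j).map (genDeg d)).sum = d j := by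
  unfold genBlock
  split_ifs with h <;> simp [genDeg, h]

theorem mem_genBlock {n : ℕ} (d : Fin n → ℤ) (j : Fin n) : (j, false) ∈ genBlock d j := by
  unfold genBlock; split_ifs <;> simp

theorem fst_of_mem_genBlock {n : ℕ} {d : Fin n → ℤ} {j : Fin n} {i : Fin n × Bool}
    (h : i ∈ genBlock d j) : i.1 = j := by
  unfold genBlock at h; split_ifs at h
  · simp only [List.mem_singleton] at h; rw [h]
  · simp only [List.mem_cons, List.not_mem_nil, or_false] at h
    rcases h with rfl | rfl <;> rfl

theorem nodup_genBlock {n : ℕ} (d : Fin n → ℤ) (j : Fin n) : (genBlock d j).Nodup := by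
  unfold genBlock; split_ifs <;> simp

variable (K)

/-- The generator of degree `d j`. -/
noncomputable def gen {n : ℕ} (d : Fin n → ℤ) (j : Fin n) :
    ExteriorAlgebra K (Fin n × Bool → K) := extMon K (genBlock d j)

variable {K}

theorem gen_mem {n : ℕ} (d : Fin n → ℤ) (j : Fin n) : gen K d j ∈ extGr K (genDeg d) (d j) :=
  extMon_mem_extGr (genBlock_ne_nil d j) (sum_genBlock d j)

/-- A repeated index repeats the exterior generator `(j, false)`, which occurs in every block. In
particular generators of even degree, products of two odd ones, also square to zero. -/
theorem prod_gen_eq_zero {n k : ℕ} (d : Fin n → ℤ) (i : Fin k → Fin n)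
    (hi : ¬ Function.Injective i) : (List.ofFn fun j => gen K d (i j)).prod = 0 := by
  simp only [gen]
  rw [prod_ofFn_extMon, extMon_eq_zero]
  intro hn
  rw [List.nodup_flatten] at hn
  have h2 := hn.2
  rw [List.pairwise_ofFn] at h2
  refine hi fun a b hab => ?_
  by_contra hne
  rcases lt_or_gt_of_ne hne with h | h
  · exact h2 h (mem_genBlock d (i a)) (by rw [hab]; exact mem_genBlock d (i b))
  · exact h2 h (mem_genBlock d (i b)) (by rw [← hab]; exact mem_genBlock d (i a))

theorem exists_functional_prod_gen {n : ℕ} (d : Fin n → ℤ) :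
    ∃ τ : ExteriorAlgebra K (Fin n × Bool → K) →ₗ[K] K, τ (List.ofFn (gen K d)).prod = 1 := by
  have h : (List.ofFn (gen K d)).prod = extMon K (List.ofFn (genBlock d)).flatten :=
    prod_ofFn_extMon _
  rw [h]
  refine exists_functional_extMon ?_
  rw [List.nodup_flatten]
  constructor
  · intro l hl
    rw [List.mem_ofFn] at hl
    obtain ⟨j, rfl⟩ := hl
    exact nodup_genBlock d j
  · rw [List.pairwise_ofFn]
    intro a b hab x hxa hxb
    exact hab.ne ((fst_of_mem_genBlock hxa).symm.trans (fst_of_mem_genBlock hxb))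

/-- The algebra on square zero generators of degrees `-1, 1, 1` and `d`. -/
noncomputable def univAlg (K : Type u) [Field K] {n : ℕ} (d : Fin n → ℤ) : PointAlg K where
  A := ExteriorAlgebra K (Fin (n + 3) × Bool → K)
  gr := extGr K (genDeg (Fin.cons (-1) (Fin.cons 1 (Fin.cons 1 d)) : Fin (n + 3) → ℤ))
  mul_mem := mul_mem_extGr
  comm := comm_extGr (odd_genDeg _)
  N := Fintype.card (Fin (n + 3) × Bool) + 1
  N_pos := Nat.succ_pos _
  nil _ hk := nil_extGr hk
  θ := gen K (Fin.cons (-1) (Fin.cons 1 (Fin.cons 1 d)) : Fin (n + 3) → ℤ) 0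
  η := gen K (Fin.cons (-1) (Fin.cons 1 (Fin.cons 1 d)) : Fin (n + 3) → ℤ) 1
  ζ := gen K (Fin.cons (-1) (Fin.cons 1 (Fin.cons 1 d)) : Fin (n + 3) → ℤ) 2
  θ_mem := gen_mem _ 0
  η_mem := gen_mem _ 1
  ζ_mem := gen_mem _ 2

/-- The generators of `univAlg` of degrees `d`. -/
noncomputable def univGen (K : Type u) [Field K] {n : ℕ} (d : Fin n → ℤ) (j : Fin n) :
    (univAlg K d).A :=
  gen K (Fin.cons (-1) (Fin.cons 1 (Fin.cons 1 d)) : Fin (n + 3) → ℤ) j.succ.succ.succ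

theorem univGen_mem {n : ℕ} (d : Fin n → ℤ) (j : Fin n) :
    univGen K d j ∈ (univAlg K d).gr (d j) :=
  gen_mem (Fin.cons (-1) (Fin.cons 1 (Fin.cons 1 d)) : Fin (n + 3) → ℤ) j.succ.succ.succ

theorem prod_univGen_eq_zero {n k : ℕ} (d : Fin n → ℤ) (i : Fin k → Fin n)
    (hi : ¬ Function.Injective i) : (List.ofFn fun j => univGen K d (i j)).prod = 0 :=
  prod_gen_eq_zero _ (fun j => (i j).succ.succ.succ) fun h => hi fun a b hab => h (by simp only [hab])

/-- The product of all generators, including `θ`, `η` and `ζ`, is a monomial without repetition, and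
a functional equal to `1` on it extracts `y`. Identities may therefore be tested after
multiplication by `θ η ζ`. -/
theorem eq_zero_of_univGen {n : ℕ} (d : Fin n → ℤ) {W : Type*} [AddCommGroup W] [Module K W]
    {y : W} (h : lmul W ((univAlg K d).θ * ((univAlg K d).η * (univAlg K d).ζ))
      ((List.ofFn (univGen K d)).prod ⊗ₜ[K] y) = 0) : y = 0 := by
  obtain ⟨τ, hτ⟩ := exists_functional_prod_gen (K := K)
    (Fin.cons (-1) (Fin.cons 1 (Fin.cons 1 d)) : Fin (n + 3) → ℤ)
  have e : (List.ofFn (gen K (Fin.cons (-1) (Fin.cons 1 (Fin.cons 1 d)) : Fin (n + 3) → ℤ))).prod =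
      (univAlg K d).θ * ((univAlg K d).η * (univAlg K d).ζ) * (List.ofFn (univGen K d)).prod := by
    rw [List.ofFn_succ, List.ofFn_succ, List.ofFn_succ, List.prod_cons, List.prod_cons,
      List.prod_cons, ← mul_assoc, ← mul_assoc, ← mul_assoc]
    rfl
  rw [lmul_tmul, ← e] at h
  have := congrArg (fun z => TensorProduct.lid K W (τ.rTensor W z)) h
  change TensorProduct.lid K W (τ.rTensor W (_ ⊗ₜ[K] y)) =
    TensorProduct.lid K W (τ.rTensor W 0) at this
  rw [LinearMap.rTensor_tmul, hτ, map_zero, map_zero, TensorProduct.lid_tmul, one_smul] at this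
  exact this

/-- The universal point with coordinates `a`. -/
noncomputable def univPt {V : GMod.{u, v} K} {n : ℕ} (d : Fin n → ℤ) (a : Fin n → V) :
    (univAlg K d).A ⊗[K] V := ∑ j, univGen K d j ⊗ₜ a j

theorem univPt_mem {V : GMod.{u, v} K} {n : ℕ} {d : Fin n → ℤ} {a : Fin n → V}
    (ha : ∀ j, a j ∈ V.deg (d j)) : univPt d a ∈ (univAlg K d).pts V 0 :=
  Submodule.sum_mem _ fun j _ => tmul_mem_pts (univGen_mem _ j) (by simpa using ha j)

namespace Fam

variable {V : GMod.{u, v} K} {W : GMod.{u, w} K}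

/-- Of all index tuples only the permutations avoid a repeated generator, and by symmetry they
contribute `n!` equal terms. -/
theorem tens_univPt (F : Fam V W) {n : ℕ} {d : Fin n → ℤ} {a : Fin n → V}
    (ha : ∀ j, a j ∈ V.deg (d j)) :
    tens (univAlg K d).A (F.f n) (fun _ => univPt d a) =
      (n.factorial : K) • (List.ofFn (univGen K d)).prod ⊗ₜ[K] F.f n a := by
  classical
  simp only [univPt]
  rw [MultilinearMap.map_sum]
  simp only [tens_tmul]
  have h := Fintype.sum_of_injective (fun σ : Perm (Fin n) => (σ : Fin n → Fin n))
    DFunLike.coe_injective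
    (fun _ => (List.ofFn (univGen K d)).prod ⊗ₜ[K] F.f n a)
    (fun i : Fin n → Fin n => (List.ofFn fun j => univGen K d (i j)).prod ⊗ₜ[K]
      F.f n fun j => a (i j)) ?_ ?_
  · rw [← h, Finset.sum_const, Finset.card_univ, Fintype.card_perm, Fintype.card_fin,
      Nat.cast_smul_eq_nsmul]
  · intro i hi
    rw [prod_univGen_eq_zero, TensorProduct.zero_tmul]
    intro hinj
    exact hi ⟨Equiv.ofBijective i (Finite.injective_iff_bijective.mp hinj), rfl⟩
  · intro σ
    rw [prod_perm_tmul (𝔸 := univAlg K d) d _ (univGen_mem _) σ,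
      F.symm n d a ha, TensorProduct.tmul_smul, smul_smul, koszulSign_mul_self, one_smul]

theorem tens_univPt_eq_zero (F : Fam V W) {n k : ℕ} (hk : n < k) (d : Fin n → ℤ) (a : Fin n → V) :
    tens (univAlg K d).A (F.f k) (fun _ => univPt d a) = 0 := by
  classical
  simp only [univPt]
  rw [MultilinearMap.map_sum]
  simp only [tens_tmul]
  refine Finset.sum_eq_zero fun i _ => ?_
  rw [prod_univGen_eq_zero, TensorProduct.zero_tmul]
  intro h
  have := Fintype.card_le_of_injective i h
  simp at this
  omega

variable [CharZero K]

theorem val_univPt (F : Fam V W) {n : ℕ} {d : Fin n → ℤ} {a : Fin n → V}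
    (ha : ∀ j, a j ∈ V.deg (d j)) (hF : ∀ k < n, F.f k = 0) :
    F.val (univPt d a) = (List.ofFn (univGen K d)).prod ⊗ₜ[K] F.f n a := by
  rw [val_eq_sum F (univPt_mem ha) (Nat.le_add_right _ (n + 1)), Finset.sum_eq_single_of_mem n]
  · rw [tens_univPt F ha, smul_smul, inv_mul_cancel₀, one_smul]
    exact_mod_cast n.factorial_ne_zero
  · simp only [Finset.mem_range]; omega
  · intro k _ hk
    rcases lt_or_gt_of_ne hk with h | h
    · rw [hF k h, tens_zero]; exact smul_zero _
    · rw [tens_univPt_eq_zero F h, smul_zero]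

/-- A family is determined by its values at points. -/
theorem eq_zero_of_val {F : Fam V W} (h : ∀ (𝔸 : PointAlg.{u} K) (v : 𝔸.A ⊗[K] V),
    v ∈ 𝔸.pts V 0 → lmul W (𝔸.θ * (𝔸.η * 𝔸.ζ)) (F.val v) = 0) : F = 0 := by
  have key : ∀ n, F.f n = 0 := by
    intro n
    induction n using Nat.strong_induction_on with
    | _ n ih =>
      refine V.multilinear_ext fun d a ha => ?_
      have := h (univAlg K d) (univPt d a) (univPt_mem ha)
      rw [val_univPt F ha ih] at this
      exact eq_zero_of_univGen _ this
  exact Fam.ext (funext key)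

omit [CharZero K] in
theorem sub_eq_zero_fam {F G : Fam V W} (h : F - G = 0) : F = G := by
  refine Fam.ext (funext fun k => ?_)
  have := congrArg (fun H : Fam V W => H.f k) h
  exact MultilinearMap.ext fun a => sub_eq_zero.mp (MultilinearMap.congr_fun this a)

theorem eq_of_val {F G : Fam V W} (h : ∀ (𝔸 : PointAlg.{u} K) (v : 𝔸.A ⊗[K] V),
    v ∈ 𝔸.pts V 0 → F.val v = G.val v) : F = G := by
  exact sub_eq_zero_fam <| eq_zero_of_val fun 𝔸 v hv => by
    rw [val_sub, h 𝔸 v hv, sub_self, map_zero]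

end Fam

end Universal

/-! ### `L_∞[1]`-structures in terms of points -/

namespace PointAlg

variable {K : Type u} [Field K] (𝔸 : PointAlg.{u} K)

theorem η_mul_η [CharZero K] : 𝔸.η * 𝔸.η = 0 := 𝔸.mul_self_eq_zero odd_one 𝔸.η_mem
theorem θ_mul_θ [CharZero K] : 𝔸.θ * 𝔸.θ = 0 := 𝔸.mul_self_eq_zero (by decide) 𝔸.θ_mem
theorem ζ_mul_η : 𝔸.ζ * 𝔸.η = -(𝔸.η * 𝔸.ζ) := by
  rw [𝔸.comm 𝔸.ζ_mem 𝔸.η_mem]; simp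
theorem η_mul_θ : 𝔸.η * 𝔸.θ = -(𝔸.θ * 𝔸.η) := by
  rw [𝔸.comm 𝔸.η_mem 𝔸.θ_mem]; simp
theorem ζ_mul_θ : 𝔸.ζ * 𝔸.θ = -(𝔸.θ * 𝔸.ζ) := by
  rw [𝔸.comm 𝔸.ζ_mem 𝔸.θ_mem]; simp

variable {𝔸} {V : Type*} [AddCommGroup V] [Module K V] {z : 𝔸.A ⊗[K] V}

/-- This lemma and the two after it allow an identity known only up to some of the factors `θ`, `η`,
`ζ` to be used with `eq_zero_of_val`. -/
theorem top_of_ηζ (h : lmul V 𝔸.η (lmul V 𝔸.ζ z) = 0) : lmul V (𝔸.θ * (𝔸.η * 𝔸.ζ)) z = 0 := by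
  rw [← lmul_lmul, ← lmul_lmul, h, map_zero]

theorem top_of_η (h : lmul V 𝔸.η z = 0) : lmul V (𝔸.θ * (𝔸.η * 𝔸.ζ)) z = 0 := by
  refine top_of_ηζ ?_
  rw [lmul_lmul, ← neg_neg (𝔸.η * 𝔸.ζ), ← ζ_mul_η, lmul_neg, ← lmul_lmul, h, map_zero, neg_zero]

theorem top_of_θη (h : lmul V 𝔸.θ (lmul V 𝔸.η z) = 0) :
    lmul V (𝔸.θ * (𝔸.η * 𝔸.ζ)) z = 0 := by
  rw [← neg_neg (𝔸.η * 𝔸.ζ), ← ζ_mul_η, mul_neg, ← mul_assoc, ← neg_mul, ← ζ_mul_θ, mul_assoc,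
    ← lmul_lmul, ← lmul_lmul, h, map_zero]

end PointAlg

namespace Fam

variable {K : Type u} [Field K] [CharZero K] {V : GMod.{u, v} K} {W : GMod.{u, w} K}
  {X : GMod.{u, x} K}

/-- `l` is an `L_∞[1]`-structure. -/
structure Codiff (l : Fam V V) : Prop where
  homog : l.Homog 1
  sq : ∀ (𝔸 : PointAlg.{u} K) (v : 𝔸.A ⊗[K] V), v ∈ 𝔸.pts V 0 →
    l.val (v + lmul V 𝔸.η (l.val v)) = l.val v

/-- `f` is an `L_∞[1]`-morphism. -/
structure Mor (l : Fam V V) (l' : Fam W W) (f : Fam V W) : Prop where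
  homog : f.Homog 0
  comm : ∀ (𝔸 : PointAlg.{u} K) (v : 𝔸.A ⊗[K] V), v ∈ 𝔸.pts V 0 →
    f.val (v + lmul V 𝔸.η (l.val v)) = f.val v + lmul W 𝔸.η (l'.val (f.val v))

/-- Expanding flow invariance to first order gives the structure equation multiplied by `η`; the
factor is removed by testing at universal points. -/
theorem Codiff.ins_eq_zero {l : Fam V V} (h : l.Codiff) : ins l l = 0 := by
  refine eq_zero_of_val fun 𝔸 v hv => PointAlg.top_of_η ?_
  have h1 := h.sq 𝔸 v hv
  rw [val_add_lmul l 𝔸.η_mem 𝔸.η_mul_η hv (val_mem h.homog hv), add_eq_left] at h1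
  rw [val_ins l l h.homog hv, h1]

theorem Codiff.D_val {l : Fam V V} (h : l.Codiff) {𝔸 : PointAlg.{u} K} {v : 𝔸.A ⊗[K] V}
    (hv : v ∈ 𝔸.pts V 0) : l.D v (l.val v) = 0 := by
  rw [← val_ins l l h.homog hv, h.ins_eq_zero, val_zero]

theorem codiff_of_top {l : Fam V V} (hl : l.Homog 1) (h : ∀ (𝔸 : PointAlg.{u} K) (v : 𝔸.A ⊗[K] V),
    v ∈ 𝔸.pts V 0 → lmul V (𝔸.θ * (𝔸.η * 𝔸.ζ)) (l.D v (l.val v)) = 0) : l.Codiff := by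
  have h0 : ins l l = 0 := eq_zero_of_val fun 𝔸 v hv => by rw [val_ins l l hl hv]; exact h 𝔸 v hv
  refine ⟨hl, fun 𝔸 v hv => ?_⟩
  rw [val_add_lmul l 𝔸.η_mem 𝔸.η_mul_η hv (val_mem hl hv), ← val_ins l l hl hv, h0, val_zero,
    map_zero, add_zero]

theorem Mor.ins_eq_comp {l : Fam V V} {l' : Fam W W} {f : Fam V W} (hl : l.Homog 1)
    (h : Mor l l' f) : ins f l = comp l' f := by
  refine sub_eq_zero_fam (eq_zero_of_val fun 𝔸 v hv => PointAlg.top_of_η ?_)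
  have h1 := h.comm 𝔸 v hv
  rw [val_add_lmul f 𝔸.η_mem 𝔸.η_mul_η hv (val_mem hl hv), add_right_inj] at h1
  rw [val_sub, val_ins f l hl hv, val_comp l' f h.homog hv, map_sub, h1, sub_self]

theorem Mor.D_val {l : Fam V V} {l' : Fam W W} {f : Fam V W} (hl : l.Homog 1)
    (h : Mor l l' f) {𝔸 : PointAlg.{u} K} {v : 𝔸.A ⊗[K] V} (hv : v ∈ 𝔸.pts V 0) :
    f.D v (l.val v) = l'.val (f.val v) := by
  rw [← val_ins f l hl hv, h.ins_eq_comp hl, val_comp l' f h.homog hv]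

theorem mor_of_top {l : Fam V V} {l' : Fam W W} {f : Fam V W} (hl : l.Homog 1) (hf : f.Homog 0)
    (h : ∀ (𝔸 : PointAlg.{u} K) (v : 𝔸.A ⊗[K] V), v ∈ 𝔸.pts V 0 →
      lmul W (𝔸.θ * (𝔸.η * 𝔸.ζ)) (f.D v (l.val v) - l'.val (f.val v)) = 0) : Mor l l' f := by
  have h0 : ins f l = comp l' f := sub_eq_zero_fam <| eq_zero_of_val fun 𝔸 v hv => by
    rw [val_sub, val_ins f l hl hv, val_comp l' f hf hv]; exact h 𝔸 v hv
  refine ⟨hf, fun 𝔸 v hv => ?_⟩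
  rw [val_add_lmul f 𝔸.η_mem 𝔸.η_mul_η hv (val_mem hl hv), ← val_ins f l hl hv, h0,
    val_comp l' f hf hv]

/-- Morphisms are the maps that intertwine the flows `v ↦ v + η l(v)`, a property inherited by
composites. -/
theorem Mor.comp {l : Fam V V} {l' : Fam W W} {l'' : Fam X X} {f : Fam V W} {g : Fam W X}
    (hl : l.Homog 1) (hg : Mor l' l'' g) (hf : Mor l l' f) : Mor l l'' (Fam.comp g f) := by
  refine ⟨hg.homog.comp hf.homog, fun 𝔸 v hv => ?_⟩
  have h1 : v + lmul V 𝔸.η (l.val v) ∈ 𝔸.pts V 0 :=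
    add_mem hv (lmul_mem_pts 𝔸.η_mem (val_mem hl hv) (by ring))
  rw [val_comp g f hf.homog hv, val_comp g f hf.homog h1, hf.comm 𝔸 v hv]
  exact hg.comm 𝔸 _ (val_mem hf.homog hv)

omit [CharZero K] in
/-- A linear map intertwining all operations is a strict morphism. -/
theorem mor_lin {l : Fam V V} {l' : Fam W W} (hl : l.Homog 1) {L : V →ₗ[K] W}
    (hL : GMod.HomogLin V W L 0) (h : post L l = pre l' L hL) : Mor l l' (lin L) := by
  refine ⟨homog_lin hL, fun 𝔸 v hv => ?_⟩
  have h1 : v + lmul V 𝔸.η (l.val v) ∈ 𝔸.pts V 0 :=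
    add_mem hv (lmul_mem_pts 𝔸.η_mem (val_mem hl hv) (by ring))
  rw [val_lin L h1, val_lin L hv, map_add, lTensor_lmul, ← val_post, h, val_pre]

theorem Mor.lin_val {l : Fam V V} {l' : Fam W W} {L : V →ₗ[K] W} (hl : l.Homog 1)
    (h : Mor l l' (lin L)) {𝔸 : PointAlg.{u} K} {v : 𝔸.A ⊗[K] V} (hv : v ∈ 𝔸.pts V 0) :
    L.lTensor 𝔸.A (l.val v) = l'.val (L.lTensor 𝔸.A v) := by
  have := h.D_val hl hv
  rwa [D_lin, val_lin L hv] at this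

end Fam

/-! ### Conversion to bundled algebras and morphisms -/

section Bundled

variable {K : Type u} [Field K]

/-- The operations of an `L_∞[1]`-algebra as a family. -/
def LInftyAlgebra.fam (C : LInftyAlgebra.{u, v} K) : Fam C.toGMod C.toGMod :=
  ⟨C.l, C.l_symm, C.strict⟩

/-- The components of an `L_∞[1]`-morphism as a family. -/
def LInftyHom.fam {C : LInftyAlgebra.{u, v} K} {C' : LInftyAlgebra.{u, w} K} (f : LInftyHom C C') :
    Fam C.toGMod C'.toGMod := ⟨f.f, f.f_symm, f.strict⟩

theorem LInftyAlgebra.fam_homog (C : LInftyAlgebra.{u, v} K) : C.fam.Homog 1 := C.l_mem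

theorem LInftyHom.fam_homog {C : LInftyAlgebra.{u, v} K} {C' : LInftyAlgebra.{u, w} K}
    (f : LInftyHom C C') : f.fam.Homog 0 := fun k d a ha => by
  rw [add_zero]; exact f.f_mem k d a ha

variable [CharZero K]

theorem LInftyAlgebra.fam_codiff (C : LInftyAlgebra.{u, v} K) : C.fam.Codiff := by
  have h : Fam.ins C.fam C.fam = 0 := Fam.ext_homogeneous fun k d a ha => by
    rw [Fam.ins_f C.fam C.fam C.fam_homog k d a ha]
    exact C.relation k d a ha
  refine Fam.codiff_of_top C.fam_homog fun 𝔸 v hv => ?_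
  rw [← Fam.val_ins _ _ C.fam_homog hv, h, Fam.val_zero, map_zero]

theorem LInftyHom.fam_mor {C : LInftyAlgebra.{u, v} K} {C' : LInftyAlgebra.{u, w} K}
    (f : LInftyHom C C') : Fam.Mor C.fam C'.fam f.fam := by
  have h : Fam.ins f.fam C.fam = Fam.comp C'.fam f.fam := Fam.ext_homogeneous fun k d a ha => by
    rw [Fam.ins_f f.fam C.fam C.fam_homog k d a ha, Fam.comp_f C'.fam f.fam k d a ha]
    exact f.relation k d a ha
  refine Fam.mor_of_top C.fam_homog f.fam_homog fun 𝔸 v hv => ?_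
  rw [← Fam.val_ins _ _ C.fam_homog hv, h, Fam.val_comp _ _ f.fam_homog hv, sub_self, map_zero]

/-- The `L_∞[1]`-algebra with given operations. -/
def Fam.Codiff.alg {V : GMod.{u, v} K} {l : Fam V V} (h : l.Codiff) : LInftyAlgebra.{u, v} K where
  carrier := V
  deg := V.deg
  isInternal := V.isInternal
  l := l.f
  l_mem := h.homog
  l_symm := l.symm
  strict := l.zero
  relation k d a ha := by
    rw [← Fam.ins_f l l h.homog k d a ha, h.ins_eq_zero]; rfl

/-- The `L_∞[1]`-morphism with given components. -/
def Fam.Mor.hom {C : LInftyAlgebra.{u, v} K} {C' : LInftyAlgebra.{u, w} K}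
    {f : Fam C.toGMod C'.toGMod} (h : Fam.Mor C.fam C'.fam f) : LInftyHom C C' where
  f := f.f
  f_mem k d a ha := by have := h.homog k d a ha; rwa [add_zero] at this
  f_symm := f.symm
  strict := f.zero
  relation k d a ha := by
    have := h.ins_eq_comp C.fam_homog
    have h1 := Fam.ins_f f C.fam C.fam_homog k d a ha
    have h2 := Fam.comp_f C'.fam f k d a ha
    rw [this] at h1
    exact h1.symm.trans h2

omit [CharZero K] in
theorem LInftyHom.isComp_of_fam {C : LInftyAlgebra.{u, v} K} {C' : LInftyAlgebra.{u, w} K}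
    {C'' : LInftyAlgebra.{u, x} K} {g : LInftyHom C' C''} {f : LInftyHom C C'}
    {h : LInftyHom C C''} (e : h.fam = Fam.comp g.fam f.fam) : LInftyHom.IsComp g f h := by
  intro k d a ha
  refine Eq.trans ?_ (Fam.comp_f g.fam f.fam k d a ha)
  rw [← e]; rfl

theorem LInftyHom.id_fam (C : LInftyAlgebra.{u, v} K) :
    (LInftyHom.id C).fam = Fam.lin LinearMap.id := rfl

end Bundled

/-! ### Polynomials with coefficients in a graded vector space -/

namespace GMod

variable {K : Type u} [Field K] (V : GMod.{u, v} K) {W : GMod.{u, w} K}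

/-- The monomial `t^i x`. -/
noncomputable def mono (i : ℕ) : V →ₗ[K] V.poly := Finsupp.lsingle i

/-- Evaluation at `t = τ`. -/
noncomputable def ev (τ : K) : V.poly →ₗ[K] V := Finsupp.lsum K fun i => τ ^ i • LinearMap.id

/-- The derivative with respect to `t`. -/
noncomputable def deriv : V.poly →ₗ[K] V.poly :=
  Finsupp.lsum K fun i => (i : K) • V.mono (i - 1)

/-- The antiderivative with respect to `t` vanishing at `t = 0`. -/
noncomputable def integ : V.poly →ₗ[K] V.poly :=
  Finsupp.lsum K fun i => ((i + 1 : ℕ) : K)⁻¹ • V.mono (i + 1)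

/-- Coefficientwise application of a linear map. -/
noncomputable def polyMap (L : V →ₗ[K] W) : V.poly →ₗ[K] W.poly := Finsupp.mapRange.linearMap L

@[simp] theorem ev_mono (τ : K) (i : ℕ) (x : V) : V.ev τ (V.mono i x) = τ ^ i • x :=
  Finsupp.lsum_single K _ i x

@[simp] theorem deriv_mono (i : ℕ) (x : V) : V.deriv (V.mono i x) = (i : K) • V.mono (i - 1) x :=
  Finsupp.lsum_single K _ i x

@[simp] theorem integ_mono (i : ℕ) (x : V) :
    V.integ (V.mono i x) = ((i + 1 : ℕ) : K)⁻¹ • V.mono (i + 1) x :=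
  Finsupp.lsum_single K _ i x

@[simp] theorem polyMap_mono (L : V →ₗ[K] W) (i : ℕ) (x : V) :
    V.polyMap L (V.mono i x) = W.mono i (L x) :=
  Finsupp.mapRange_single (hf := map_zero L)

variable {V} in
theorem poly_linearMap_ext {X : Type*} [AddCommGroup X] [Module K X] {f g : V.poly →ₗ[K] X}
    (h : ∀ i x, f (V.mono i x) = g (V.mono i x)) : f = g :=
  Finsupp.lhom_ext h

theorem poly_mem_span (p : V.poly) :
    p ∈ Submodule.span K {q : V.poly | ∃ (i : ℕ) (x : V), q = V.mono i x} := by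
  induction p using Finsupp.induction_linear with
  | zero => exact zero_mem _
  | add p q hp hq => exact add_mem hp hq
  | single i x => exact Submodule.subset_span ⟨i, x, rfl⟩

theorem ev_polyMap (L : V →ₗ[K] W) (τ : K) (p : V.poly) :
    W.ev τ (V.polyMap L p) = L (V.ev τ p) := by
  have : W.ev τ ∘ₗ V.polyMap L = L ∘ₗ V.ev τ := poly_linearMap_ext fun i x => by simp
  exact LinearMap.congr_fun this p

theorem deriv_polyMap (L : V →ₗ[K] W) (p : V.poly) :
    W.deriv (V.polyMap L p) = V.polyMap L (V.deriv p) := by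
  have : W.deriv ∘ₗ V.polyMap L = V.polyMap L ∘ₗ V.deriv := poly_linearMap_ext fun i x => by simp
  exact LinearMap.congr_fun this p

theorem integ_polyMap (L : V →ₗ[K] W) (p : V.poly) :
    W.integ (V.polyMap L p) = V.polyMap L (V.integ p) := by
  have : W.integ ∘ₗ V.polyMap L = V.polyMap L ∘ₗ V.integ := poly_linearMap_ext fun i x => by
    rw [LinearMap.comp_apply, LinearMap.comp_apply, polyMap_mono, integ_mono, integ_mono, map_smul,
      polyMap_mono]
  exact LinearMap.congr_fun this p

@[simp] theorem ev_zero_integ (p : V.poly) : V.ev 0 (V.integ p) = 0 := by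
  have : V.ev 0 ∘ₗ V.integ = 0 := poly_linearMap_ext fun i x => by
    rw [LinearMap.comp_apply, integ_mono, map_smul, ev_mono, zero_pow (Nat.succ_ne_zero i),
      zero_smul, smul_zero, LinearMap.zero_apply]
  exact LinearMap.congr_fun this p

section CharZero

variable [CharZero K]

@[simp] theorem deriv_integ (p : V.poly) : V.deriv (V.integ p) = p := by
  have : V.deriv ∘ₗ V.integ = LinearMap.id := poly_linearMap_ext fun i x => by
    rw [LinearMap.comp_apply, integ_mono, map_smul, deriv_mono, smul_smul, Nat.add_sub_cancel,
      inv_mul_cancel₀ (by exact_mod_cast i.succ_ne_zero), one_smul, LinearMap.id_apply]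
  exact LinearMap.congr_fun this p

@[simp] theorem integ_deriv (p : V.poly) : V.integ (V.deriv p) = p - V.mono 0 (V.ev 0 p) := by
  have : V.integ ∘ₗ V.deriv = LinearMap.id - V.mono 0 ∘ₗ V.ev 0 :=
    poly_linearMap_ext fun i x => by
      rw [LinearMap.comp_apply, deriv_mono, map_smul, integ_mono, LinearMap.sub_apply,
        LinearMap.comp_apply, ev_mono, LinearMap.id_apply]
      rcases i with _ | i
      · simp
      · rw [Nat.add_sub_cancel, smul_smul, mul_inv_cancel₀ (by exact_mod_cast i.succ_ne_zero),
          one_smul, zero_pow (Nat.succ_ne_zero i), zero_smul, map_zero, sub_zero]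
  exact LinearMap.congr_fun this p

variable {V}

/-- A linear functional applied to the coefficients yields a scalar polynomial vanishing at every
element of the infinite field `K`. -/
theorem poly_eq_zero_of_ev {p : V.poly} (h : ∀ τ : K, V.ev τ p = 0) : p = 0 := by
  let c : ℕ →₀ V := p
  suffices c = 0 from this
  refine Finsupp.ext fun i => ?_
  refine (Module.forall_dual_apply_eq_zero_iff K _).mp fun φ => ?_
  let P : Polynomial K := ∑ j ∈ c.support, Polynomial.C (φ (c j)) * Polynomial.X ^ j
  have hP : P = 0 := by
    refine Polynomial.funext fun τ => ?_
    have : φ (V.ev τ p) = 0 := by rw [h, map_zero]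
    change φ (∑ j ∈ c.support, τ ^ j • c j) = 0 at this
    rw [map_sum] at this
    simp only [P, Polynomial.eval_finsetSum, Polynomial.eval_mul, Polynomial.eval_C,
      Polynomial.eval_pow, Polynomial.eval_X, Polynomial.eval_zero]
    rw [← this]
    refine Finset.sum_congr rfl fun j _ => ?_
    simp [mul_comm]
  have hc : P.coeff i = φ (c i) := by
    simp only [P, Polynomial.finsetSum_coeff, Polynomial.coeff_C_mul, Polynomial.coeff_X_pow]
    by_cases hi : i ∈ c.support
    · rw [Finset.sum_eq_single_of_mem i hi]
      · simp
      · intro j _ hj; simp [hj.symm]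
    · rw [Finset.sum_eq_zero]
      · rw [Finsupp.notMem_support_iff.mp hi, map_zero]
      · intro j hj
        have : i ≠ j := fun e => hi (e ▸ hj)
        simp [this]
  rw [← hc, hP, Polynomial.coeff_zero]

theorem poly_ext_ev {p q : V.poly} (h : ∀ τ : K, V.ev τ p = V.ev τ q) : p = q :=
  sub_eq_zero.mp (poly_eq_zero_of_ev fun τ => by rw [map_sub, h, sub_self])

end CharZero

theorem homogLin_ev (τ : K) : HomogLin V.poly V (V.ev τ) 0 := by
  intro n p hp
  rw [add_zero]
  exact Submodule.sum_mem _ fun i _ => Submodule.smul_mem _ _ (hp i)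

theorem homogLin_mono (i : ℕ) : HomogLin V V.poly (V.mono i) 0 := by
  intro n x hx j
  rw [add_zero]
  change (Finsupp.single i x) j ∈ _
  rw [Finsupp.single_apply]
  split_ifs
  exacts [hx, zero_mem _]

theorem homogLin_polyMap {L : V →ₗ[K] W} {q : ℤ} (hL : HomogLin V W L q) :
    HomogLin V.poly W.poly (V.polyMap L) q := fun n _ hp i => hL n _ (hp i)

theorem homogLin_deriv : HomogLin V.poly V.poly V.deriv 0 := by
  intro n p hp
  refine Submodule.sum_mem _ fun i _ => Submodule.smul_mem _ _ ?_
  exact V.homogLin_mono _ n _ (hp i)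

variable {V} in
theorem mem_poly_deg_of_ev [CharZero K] {p : V.poly} {n : ℤ} (h : ∀ τ : K, V.ev τ p ∈ V.deg n) :
    p ∈ V.poly.deg n := by
  have : p = V.polyMap (V.proj n) p := poly_ext_ev fun τ => by
    rw [ev_polyMap, V.proj_of_mem (h τ)]
  rw [this]
  intro i
  exact V.proj_mem n _

end GMod

/-! ### Extension of families to polynomial coefficients -/

namespace Fam

open GMod

variable {K : Type u} [Field K] {V : GMod.{u, v} K} {W : GMod.{u, w} K}

/-- The inclusion of polynomials into a tensor product. -/
noncomputable def polyToTensor (V : GMod.{u, v} K) : V.poly →ₗ[K] Polynomial K ⊗[K] V :=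
  Finsupp.lsum K fun i => TensorProduct.mk K (Polynomial K) V (Polynomial.X ^ i)

/-- The inverse of `polyToTensor`. -/
noncomputable def tensorToPoly (V : GMod.{u, v} K) : Polynomial K ⊗[K] V →ₗ[K] V.poly :=
  TensorProduct.lift (Polynomial.lsum fun i => LinearMap.toSpanSingleton K _ (V.mono i))

theorem polyToTensor_mono (i : ℕ) (x : V) :
    polyToTensor V (V.mono i x) = (Polynomial.X ^ i) ⊗ₜ x :=
  Finsupp.lsum_single K _ i x

theorem tensorToPoly_tmul (i : ℕ) (x : V) :
    tensorToPoly V ((Polynomial.X ^ i) ⊗ₜ x) = V.mono i x := by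
  rw [tensorToPoly, TensorProduct.lift.tmul, ← Polynomial.monomial_one_right_eq_X_pow]
  simp [Polynomial.lsum_apply]

/-- The extension of a multilinear map to polynomials. -/
noncomputable def polyExt {k : ℕ} (Φ : MultilinearMap K (fun _ : Fin k => V) W) :
    MultilinearMap K (fun _ : Fin k => V.poly) W.poly :=
  (tensorToPoly W).compMultilinearMap
    ((tens (Polynomial K) Φ).compLinearMap fun _ => polyToTensor V)

theorem polyExt_mono {k : ℕ} (Φ : MultilinearMap K (fun _ : Fin k => V) W) (i : Fin k → ℕ)
    (x : Fin k → V) : polyExt Φ (fun j => V.mono (i j) (x j)) = W.mono (∑ j, i j) (Φ x) := by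
  simp only [polyExt, LinearMap.compMultilinearMap_apply, MultilinearMap.compLinearMap_apply,
    polyToTensor_mono, tens_tmul]
  rw [List.prod_ofFn, Finset.prod_pow_eq_pow_sum, tensorToPoly_tmul]

theorem poly_multilinear_ext {k : ℕ} {X : Type*} [AddCommGroup X] [Module K X]
    {Φ Ψ : MultilinearMap K (fun _ : Fin k => V.poly) X}
    (h : ∀ (i : Fin k → ℕ) (x : Fin k → V), Φ (fun j => V.mono (i j) (x j)) =
      Ψ fun j => V.mono (i j) (x j)) : Φ = Ψ := by
  refine MultilinearMap.ext fun v => ?_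
  refine Φ.eq_of_forall_mem_span Ψ (fun _ => {q : V.poly | ∃ (i : ℕ) (x : V), q = V.mono i x})
    ?_ v fun _ => V.poly_mem_span _
  intro s hs
  choose i x hs using hs
  obtain rfl : s = fun j => V.mono (i j) (x j) := funext hs
  exact h i x

theorem ev_polyExt {k : ℕ} (Φ : MultilinearMap K (fun _ : Fin k => V) W) (τ : K)
    (p : Fin k → V.poly) : W.ev τ (polyExt Φ p) = Φ fun j => V.ev τ (p j) := by
  have : (W.ev τ).compMultilinearMap (polyExt Φ) = Φ.compLinearMap fun _ => V.ev τ :=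
    poly_multilinear_ext fun i x => by
      rw [LinearMap.compMultilinearMap_apply, polyExt_mono, MultilinearMap.compLinearMap_apply,
        ev_mono]
      simp only [ev_mono]
      rw [MultilinearMap.map_smul_univ, Finset.prod_pow_eq_pow_sum]
  exact MultilinearMap.congr_fun this p

theorem deriv_polyExt {k : ℕ} (Φ : MultilinearMap K (fun _ : Fin k => V) W) :
    W.deriv.compMultilinearMap (polyExt Φ) =
      ∑ j : Fin k, (polyExt Φ).compLinearMap fun i => if i = j then V.deriv else LinearMap.id := by
  refine poly_multilinear_ext fun i x => ?_
  rw [LinearMap.compMultilinearMap_apply, polyExt_mono, deriv_mono, sum_apply, Nat.cast_sum,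
    Finset.sum_smul]
  refine Finset.sum_congr rfl fun j _ => ?_
  rw [MultilinearMap.compLinearMap_apply]
  -- Exponent `0` is separate because `i j - 1` is then truncated; the factor `0` from
  -- differentiation makes the term vanish.
  rcases hij : i j with _ | m
  · have hz := (polyExt Φ).map_coord_zero (m := fun l =>
      (if l = j then V.deriv else LinearMap.id) (V.mono (i l) (x l))) j
      (by rw [if_pos rfl, deriv_mono, hij, Nat.cast_zero, zero_smul])
    rw [hz, Nat.cast_zero, zero_smul]
  have h : (fun l => (if l = j then V.deriv else LinearMap.id) (V.mono (i l) (x l))) =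
      fun l => (if l = j then (i j : K) else 1) • V.mono ((Function.update i j m) l) (x l) := by
    funext l
    by_cases hl : l = j
    · subst hl; simp [hij]
    · simp [hl]
  rw [h, MultilinearMap.map_smul_univ, polyExt_mono]
  simp only [Finset.prod_ite_eq', Finset.mem_univ, if_true]
  rw [hij]
  have hsum : ∑ l, i l - 1 = ∑ l, Function.update i j m l := by
    rw [← Finset.add_sum_erase _ i (Finset.mem_univ j), hij,
      ← Finset.add_sum_erase _ (Function.update i j m) (Finset.mem_univ j), Function.update_self,
      Finset.sum_congr rfl fun l hl => Function.update_of_ne (Finset.ne_of_mem_erase hl) m i]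
    rw [Nat.add_right_comm, Nat.add_sub_cancel]
  rw [hsum]

variable [CharZero K]

/-- The extension of a family to polynomials. -/
noncomputable def poly (F : Fam V W) : Fam V.poly W.poly where
  f k := polyExt (F.f k)
  symm k d a ha σ := poly_ext_ev fun τ => by
    rw [ev_polyExt, map_smul, ev_polyExt]
    exact F.symm k d (fun j => V.ev τ (a j)) (fun j => by simpa using V.homogLin_ev τ _ _ (ha j)) σ
  zero := by
    rw [F.zero]
    refine MultilinearMap.ext fun v => poly_ext_ev fun τ => ?_
    rw [ev_polyExt]
    exact (map_zero _).symm

theorem Homog.poly {F : Fam V W} {p : ℤ} (hF : F.Homog p) : F.poly.Homog p := by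
  intro k d a ha
  refine mem_poly_deg_of_ev fun τ => ?_
  change W.ev τ (polyExt (F.f k) a) ∈ _
  rw [ev_polyExt]
  exact hF k d _ fun j => by simpa using V.homogLin_ev τ _ _ (ha j)

/-- Evaluations at scalars are jointly injective, so an identity for extended families reduces to
the same identity for the original ones at each `t = τ`. -/
theorem post_ev_poly (F : Fam V W) (τ : K) :
    post (W.ev τ) F.poly = pre F (V.ev τ) (V.homogLin_ev τ) :=
  Fam.ext (funext fun k => MultilinearMap.ext fun a => ev_polyExt (F.f k) τ a)

theorem poly_ext {X : GMod.{u, x} K} {F G : Fam X W.poly}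
    (h : ∀ τ : K, post (W.ev τ) F = post (W.ev τ) G) : F = G := by
  refine Fam.ext (funext fun k => MultilinearMap.ext fun a => poly_ext_ev fun τ => ?_)
  exact congrArg (fun H : Fam X W => H.f k a) (h τ)

section Points

variable {𝔸 : PointAlg.{u} K}

theorem ev_val_poly (F : Fam V W) (τ : K) (v : 𝔸.A ⊗[K] V.poly) :
    (W.ev τ).lTensor 𝔸.A (F.poly.val v) = F.val ((V.ev τ).lTensor 𝔸.A v) := by
  rw [← val_post, post_ev_poly, val_pre]

theorem ev_D_poly (F : Fam V W) (τ : K) (v u : 𝔸.A ⊗[K] V.poly) :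
    (W.ev τ).lTensor 𝔸.A (F.poly.D v u) =
      F.D ((V.ev τ).lTensor 𝔸.A v) ((V.ev τ).lTensor 𝔸.A u) := by
  rw [← D_post, post_ev_poly, D_pre]

/-- The chain rule for the derivative with respect to the formal variable. -/
theorem deriv_val_poly (F : Fam V W) {v : 𝔸.A ⊗[K] V.poly} (hv : v ∈ 𝔸.pts V.poly 0) :
    W.deriv.lTensor 𝔸.A (F.poly.val v) = F.poly.D v (V.deriv.lTensor 𝔸.A v) := by
  have hdv : V.deriv.lTensor 𝔸.A v ∈ 𝔸.pts V.poly 0 := lTensor_mem_pts V.homogLin_deriv hv (by ring)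
  rw [D_apply, val_eq_sum _ hv (Nat.le_succ _), map_sum, Finset.sum_range_succ', F.poly.zero,
    tens_zero]
  have h0 : W.deriv.lTensor 𝔸.A (((Nat.factorial 0 : ℕ) : K)⁻¹ •
      (0 : MultilinearMap K (fun _ : Fin 0 => 𝔸.A ⊗[K] V.poly) (𝔸.A ⊗[K] W.poly)) fun _ => v) = 0 := by
    rw [zero_apply, smul_zero, map_zero]
  rw [h0, add_zero]
  refine Finset.sum_congr rfl fun k _ => ?_
  rw [map_smul, ← tens_postcomp]
  have h1 := deriv_polyExt (F.f (k + 1))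
  change W.deriv.compMultilinearMap (F.poly.f (k + 1)) = ∑ j, (F.poly.f (k + 1)).compLinearMap _ at h1
  rw [h1, tens_sum, sum_apply]
  -- The Leibniz rule differentiates one slot at a time; symmetry at points moves that slot to the
  -- front, so the `k + 1` terms agree.
  have h2 : ∀ j : Fin (k + 1), tens 𝔸.A ((F.poly.f (k + 1)).compLinearMap fun i =>
      if i = j then V.deriv else LinearMap.id) (fun _ => v) =
      tens 𝔸.A (F.poly.f (k + 1)) (Fin.cons (V.deriv.lTensor 𝔸.A v) fun _ => v) := by
    intro j
    rw [tens_precomp, ← tens_perm _ _ (Equiv.swap 0 j)]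
    · congr 1
      funext i
      refine Fin.cases ?_ (fun i => ?_) i
      · simp
      · rw [if_neg, Fin.cons_succ, LinearMap.lTensor_id, LinearMap.id_apply]
        intro h
        have h' : Equiv.swap 0 j i.succ = Equiv.swap 0 j 0 := by rw [h, Equiv.swap_apply_left]
        exact Fin.succ_ne_zero i ((Equiv.swap 0 j).injective h')
    · intro i
      split_ifs
      · exact hdv
      · simpa using hv
  simp only [h2]
  rw [Finset.sum_const, Finset.card_univ, Fintype.card_fin, ← Nat.cast_smul_eq_nsmul K, smul_smul,
    Nat.factorial_succ, Nat.cast_mul, mul_inv, mul_right_comm,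
    inv_mul_cancel₀ (by exact_mod_cast k.succ_ne_zero), one_mul]

end Points

theorem Codiff.poly {l : Fam V V} (h : l.Codiff) : l.poly.Codiff := by
  have h0 : ins l.poly l.poly = 0 := poly_ext fun τ => eq_of_val fun 𝔸 v hv => by
    have hv' : (V.ev τ).lTensor 𝔸.A v ∈ 𝔸.pts V 0 := lTensor_mem_pts (V.homogLin_ev τ) hv (by ring)
    rw [val_post, val_post, val_ins _ _ h.homog.poly hv, ev_D_poly, ev_val_poly, h.D_val hv',
      val_zero, map_zero]
  refine codiff_of_top h.homog.poly fun 𝔸 v hv => ?_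
  rw [← val_ins _ _ h.homog.poly hv, h0, val_zero, map_zero]

end Fam

/-! ### Linear components -/

namespace Fam

variable {K : Type u} [Field K] {V : GMod.{u, v} K} {W : GMod.{u, w} K} {X : GMod.{u, x} K}

/-- The linear component of a family. -/
def lin1 (F : Fam V W) : V →ₗ[K] W where
  toFun x := F.f 1 fun _ => x
  map_add' := ((MultilinearMap.ofSubsingleton K V W (0 : Fin 1)).symm (F.f 1)).map_add'
  map_smul' := ((MultilinearMap.ofSubsingleton K V W (0 : Fin 1)).symm (F.f 1)).map_smul'

theorem Homog.lin1 {F : Fam V W} {p : ℤ} (hF : F.Homog p) : GMod.HomogLin V W F.lin1 p := by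
  intro n x hx
  have := hF 1 (fun _ => n) (fun _ => x) fun _ => hx
  rwa [Fin.sum_univ_one] at this

@[simp] theorem lin1_lin (L : V →ₗ[K] W) : (lin L).lin1 = L := rfl

@[simp] theorem lin1_add (F G : Fam V W) : (F + G).lin1 = F.lin1 + G.lin1 := rfl

@[simp] theorem lin1_sub (F G : Fam V W) : (F - G).lin1 = F.lin1 - G.lin1 := rfl

@[simp] theorem lin1_post (L : W →ₗ[K] X) (F : Fam V W) : (post L F).lin1 = L ∘ₗ F.lin1 := rfl

@[simp] theorem lin1_pre (F : Fam W X) (L : V →ₗ[K] W) (hL : GMod.HomogLin V W L 0) :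
    (pre F L hL).lin1 = F.lin1 ∘ₗ L := rfl

/-- With a single generator of square zero, every term of arity at least two repeats it. Such points
detect exactly linear components. -/
theorem D_single (F : Fam V W) (d : Fin 1 → ℤ) (a b : V) :
    F.D (univGen K d 0 ⊗ₜ a) (univGen K d 0 ⊗ₜ b) = univGen K d 0 ⊗ₜ F.lin1 b := by
  have h : ∀ k, tens (univAlg K d).A (F.f (k + 1))
      (Fin.cons (univGen K d 0 ⊗ₜ b) fun _ => univGen K d 0 ⊗ₜ a) =
      (List.ofFn fun _ : Fin (k + 1) => univGen K d 0).prod ⊗ₜ[K] F.f (k + 1) (Fin.cons b fun _ => a) := by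
    intro k
    rw [← tens_tmul]
    congr 1
    funext i
    refine Fin.cases ?_ (fun i => ?_) i <;> simp
  rw [D_apply, Finset.sum_eq_single_of_mem 0 (by simpa using (univAlg K d).N_pos)]
  · rw [h]
    simp only [Nat.factorial_zero, Nat.cast_one, inv_one, one_smul, zero_add, List.ofFn_succ,
      List.ofFn_zero, List.prod_singleton]
    refine congrArg (fun y => univGen K d 0 ⊗ₜ[K] F.f 1 y) (funext fun i => ?_)
    obtain rfl : i = 0 := Fin.ext (by omega)
    rfl
  · intro k _ hk
    rw [h, prod_univGen_eq_zero d (fun _ : Fin (k + 1) => (0 : Fin 1)), TensorProduct.zero_tmul,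
      smul_zero]
    intro hi
    have := Fintype.card_le_of_injective _ hi
    simp only [Fintype.card_fin] at this
    omega

theorem univPt_one (d : Fin 1 → ℤ) (a : V) :
    univPt d (fun _ => a) = univGen K d 0 ⊗ₜ[K] a := by simp [univPt]

section CharZero

variable [CharZero K]

theorem val_single (F : Fam V W) (d : Fin 1 → ℤ) {a : V} (ha : a ∈ V.deg (d 0)) :
    F.val (univGen K d 0 ⊗ₜ a) = univGen K d 0 ⊗ₜ F.lin1 a := by
  have := val_univPt F (d := d) (a := fun _ => a) (fun j => by rwa [Subsingleton.elim j 0])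
    fun k hk => by obtain rfl : k = 0 := by omega
                   exact F.zero
  rw [univPt_one] at this
  rw [this]
  simp only [List.ofFn_succ, List.ofFn_zero, List.prod_singleton]
  rfl

omit [CharZero K] in
theorem single_mem (d : Fin 1 → ℤ) {a : V} (ha : a ∈ V.deg (d 0)) :
    univGen K d 0 ⊗ₜ a ∈ (univAlg K d).pts V 0 :=
  tmul_mem_pts (univGen_mem d 0) (by simpa using ha)

omit [CharZero K] in
theorem single_injective {W : GMod.{u, w} K} (d : Fin 1 → ℤ) {x y : W}
    (h : univGen K d 0 ⊗ₜ[K] x = univGen K d 0 ⊗ₜ[K] y) : x = y := by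
  refine sub_eq_zero.mp (eq_zero_of_univGen (K := K) (W := W) d ?_)
  simp only [List.ofFn_succ, List.ofFn_zero, List.prod_singleton]
  rw [TensorProduct.tmul_sub, h, sub_self, map_zero]

theorem lin1_ext {F : Fam V W} {L : V →ₗ[K] W} (h : ∀ (d : Fin 1 → ℤ) (a : V), a ∈ V.deg (d 0) →
    F.val (univGen K d 0 ⊗ₜ a) = univGen K d 0 ⊗ₜ L a) : F.lin1 = L := by
  refine V.linearMap_ext fun n x hx => single_injective (K := K) (W := W) (fun _ => n) (x := F.lin1 x) (y := L x) ?_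
  rw [← val_single F (fun _ => n) hx, h (fun _ => n) x hx]

theorem lin1_comp (G : Fam W X) (F : Fam V W) (hF : F.Homog 0) :
    (comp G F).lin1 = G.lin1 ∘ₗ F.lin1 := by
  refine lin1_ext fun d a ha => ?_
  have h := hF.lin1 _ _ ha
  rw [add_zero] at h
  rw [val_comp G F hF (single_mem d ha), val_single F d ha, val_single G d h]
  rfl

theorem lin1_ins (F : Fam V W) (l : Fam V V) {p : ℤ} (hl : l.Homog p) :
    (ins F l).lin1 = F.lin1 ∘ₗ l.lin1 := by
  refine lin1_ext fun d a ha => ?_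
  rw [val_ins F l hl (single_mem d ha), val_single l d ha, D_single]
  rfl

theorem lin1_der (F : Fam V W) : (der F).lin1 = F.lin1 ∘ₗ V.tanSnd := by
  refine lin1_ext fun d a ha => ?_
  rw [val_der F (single_mem d ha), LinearMap.lTensor_tmul, LinearMap.lTensor_tmul, D_single]
  rfl

theorem lin1_poly (F : Fam V W) : F.poly.lin1 = V.polyMap F.lin1 := by
  refine LinearMap.ext fun p => GMod.poly_ext_ev fun τ => ?_
  rw [GMod.ev_polyMap]
  exact ev_polyExt (F.f 1) τ fun _ => p

theorem Codiff.lin1_lin1 {l : Fam V V} (h : l.Codiff) (x : V) : l.lin1 (l.lin1 x) = 0 := by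
  have := lin1_ins l l h.homog
  rw [h.ins_eq_zero] at this
  exact (LinearMap.congr_fun this x).symm

theorem Mor.lin1_comm {l : Fam V V} {l' : Fam W W} {f : Fam V W} (hl : l.Homog 1)
    (h : Mor l l' f) (x : V) : f.lin1 (l.lin1 x) = l'.lin1 (f.lin1 x) := by
  have h1 := lin1_ins f l hl
  rw [h.ins_eq_comp hl, lin1_comp l' f h.homog] at h1
  exact (LinearMap.congr_fun h1 x).symm

theorem mor_lin_of_val {l : Fam V V} {l' : Fam W W} (hl : l.Homog 1) {L : V →ₗ[K] W}
    (hL : GMod.HomogLin V W L 0) (h : ∀ (𝔸 : PointAlg.{u} K) (v : 𝔸.A ⊗[K] V), v ∈ 𝔸.pts V 0 →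
      L.lTensor 𝔸.A (l.val v) = l'.val (L.lTensor 𝔸.A v)) : Mor l l' (lin L) :=
  mor_lin hl hL <| eq_of_val fun 𝔸 v hv => by rw [val_post, val_pre, h 𝔸 v hv]

theorem mor_zero {l : Fam V V} {l' : Fam W W} (hl : l.Homog 1) :
    Mor l l' (lin (0 : V →ₗ[K] W)) := by
  refine mor_lin_of_val hl (fun n x _ => zero_mem _) fun 𝔸 v hv => ?_
  rw [LinearMap.lTensor_zero, LinearMap.zero_apply, LinearMap.zero_apply, val_at_zero]

theorem mor_id {l : Fam V V} (hl : l.Homog 1) : Mor l l (lin LinearMap.id) :=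
  mor_lin_of_val hl (fun n x hx => by simpa using hx) fun 𝔸 v hv => by simp

end CharZero

end Fam

/-! ### Path objects -/

namespace GMod

variable {K : Type u} [Field K] (V : GMod.{u, v} K) {W : GMod.{u, w} K}

/-- Polynomial differential forms on the interval with coefficients in `V`. -/
noncomputable abbrev path : GMod.{u, v} K := V.poly.tan

/-- Evaluation of a form at `t = τ`. -/
noncomputable def pathEv (τ : K) : V.path →ₗ[K] V := V.ev τ ∘ₗ V.poly.tanFst

/-- The form `t^i x`. -/
noncomputable def pathMono (i : ℕ) : V →ₗ[K] V.path := V.poly.tanInl ∘ₗ V.mono i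

/-- Coefficientwise application of a linear map of degree zero to a form. -/
noncomputable def pathMap (L : V →ₗ[K] W) : V.path →ₗ[K] W.path :=
  W.poly.tanInl ∘ₗ V.polyMap L ∘ₗ V.poly.tanFst + W.poly.tanInr ∘ₗ V.polyMap L ∘ₗ V.poly.tanSnd

theorem HomogLin.comp {V : GMod.{u, v} K} {W : GMod.{u, w} K} {X : GMod.{u, x} K} {L : V →ₗ[K] W}
    {M : W →ₗ[K] X} {p q r : ℤ} (hM : HomogLin W X M q) (hL : HomogLin V W L p) (h : r = p + q) :
    HomogLin V X (M ∘ₗ L) r := by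
  subst h
  intro n x hx
  rw [← add_assoc]
  exact hM _ _ (hL _ _ hx)

theorem HomogLin.add {V : GMod.{u, v} K} {W : GMod.{u, w} K} {L M : V →ₗ[K] W}
    {p : ℤ} (hL : HomogLin V W L p) (hM : HomogLin V W M p) : HomogLin V W (L + M) p :=
  fun n x hx => add_mem (hL n x hx) (hM n x hx)

theorem HomogLin.sub {V : GMod.{u, v} K} {W : GMod.{u, w} K} {L M : V →ₗ[K] W}
    {p : ℤ} (hL : HomogLin V W L p) (hM : HomogLin V W M p) : HomogLin V W (L - M) p :=
  fun n x hx => sub_mem (hL n x hx) (hM n x hx)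

theorem homogLin_id : HomogLin V V LinearMap.id 0 := fun n x hx => by simpa using hx

theorem homogLin_pathEv (τ : K) : HomogLin V.path V (V.pathEv τ) 0 :=
  (V.homogLin_ev τ).comp V.poly.homogLin_tanFst (by ring)

theorem homogLin_pathMono (i : ℕ) : HomogLin V V.path (V.pathMono i) 0 :=
  V.poly.homogLin_tanInl.comp (V.homogLin_mono i) (by ring)

theorem homogLin_pathMap {L : V →ₗ[K] W} (hL : HomogLin V W L 0) :
    HomogLin V.path W.path (V.pathMap L) 0 :=
  (W.poly.homogLin_tanInl.comp ((homogLin_polyMap V hL).comp V.poly.homogLin_tanFst rfl) rfl).add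
    (W.poly.homogLin_tanInr.comp ((homogLin_polyMap V hL).comp V.poly.homogLin_tanSnd rfl) rfl)

theorem pathEv_comp_pathMono (τ : K) (i : ℕ) :
    V.pathEv τ ∘ₗ V.pathMono i = τ ^ i • LinearMap.id :=
  LinearMap.ext fun x => V.ev_mono τ i x

theorem pathEv_comp_pathMap (L : V →ₗ[K] W) (τ : K) :
    W.pathEv τ ∘ₗ V.pathMap L = L ∘ₗ V.pathEv τ := by
  refine LinearMap.ext fun x => ?_
  change W.ev τ (V.polyMap L (V.poly.tanFst x) + 0) = L (V.ev τ (V.poly.tanFst x))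
  rw [add_zero, ev_polyMap]

theorem pathMap_comp_pathMono (L : V →ₗ[K] W) (i : ℕ) :
    V.pathMap L ∘ₗ V.pathMono i = W.pathMono i ∘ₗ L := by
  refine LinearMap.ext fun x => Prod.ext ?_ ?_
  · change V.polyMap L (V.mono i x) + 0 = W.mono i (L x)
    rw [polyMap_mono, add_zero]
  · change 0 + V.polyMap L 0 = 0
    rw [map_zero, add_zero]

end GMod

/-! ### The structure on polynomial forms -/

namespace Fam

open GMod

section

variable {K : Type u} [Field K] {V : GMod.{u, v} K} {W : GMod.{u, w} K}

theorem tan_ext {A : Type*} [Ring A] [Algebra K A] {x y : A ⊗[K] V.tan}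
    (h1 : V.tanFst.lTensor A x = V.tanFst.lTensor A y)
    (h2 : V.tanSnd.lTensor A x = V.tanSnd.lTensor A y) : x = y := by
  have key : ∀ z : A ⊗[K] V.tan, z = V.tanInl.lTensor A (V.tanFst.lTensor A z) +
      V.tanInr.lTensor A (V.tanSnd.lTensor A z) := by
    intro z
    have := congrArg (fun L : V.tan →ₗ[K] V.tan => L.lTensor A z) V.tanInl_add_tanInr
    simp only [LinearMap.lTensor_add, LinearMap.lTensor_comp, LinearMap.lTensor_id] at this
    exact this.symm
  rw [key x, key y, h1, h2]

variable {A : Type*} [Ring A] [Algebra K A]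

@[simp] theorem tanFst_tanInl (x : A ⊗[K] V) : V.tanFst.lTensor A (V.tanInl.lTensor A x) = x := by
  rw [← LinearMap.comp_apply, ← LinearMap.lTensor_comp, tanFst_comp_tanInl, LinearMap.lTensor_id]
  rfl

@[simp] theorem tanFst_tanInr (x : A ⊗[K] V) : V.tanFst.lTensor A (V.tanInr.lTensor A x) = 0 := by
  rw [← LinearMap.comp_apply, ← LinearMap.lTensor_comp, tanFst_comp_tanInr, LinearMap.lTensor_zero]
  rfl

@[simp] theorem tanSnd_tanInl (x : A ⊗[K] V) : V.tanSnd.lTensor A (V.tanInl.lTensor A x) = 0 := by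
  rw [← LinearMap.comp_apply, ← LinearMap.lTensor_comp, tanSnd_comp_tanInl, LinearMap.lTensor_zero]
  rfl

@[simp] theorem tanSnd_tanInr (x : A ⊗[K] V) : V.tanSnd.lTensor A (V.tanInr.lTensor A x) = x := by
  rw [← LinearMap.comp_apply, ← LinearMap.lTensor_comp, tanSnd_comp_tanInr, LinearMap.lTensor_id]
  rfl

end

variable {K : Type u} [Field K] [CharZero K] {V : GMod.{u, v} K} {W : GMod.{u, w} K}

/-- The `L_∞[1]`-structure on polynomial forms. -/
noncomputable def path (l : Fam V V) : Fam V.path V.path :=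
  post V.poly.tanInl (pre l.poly V.poly.tanFst V.poly.homogLin_tanFst) +
    post V.poly.tanInr (lin (V.deriv ∘ₗ V.poly.tanFst) - der l.poly)

theorem Homog.path {l : Fam V V} (hl : l.Homog 1) : l.path.Homog 1 :=
  ((hl.poly.pre V.poly.homogLin_tanFst).post V.poly.homogLin_tanInl rfl).add
    (((homog_lin (V.homogLin_deriv.comp V.poly.homogLin_tanFst rfl)).sub (hl.poly.der rfl)).post
      V.poly.homogLin_tanInr rfl)

section Points

variable {𝔸 : PointAlg.{u} K}

theorem fst_val_path (l : Fam V V) (x : 𝔸.A ⊗[K] V.path) :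
    V.poly.tanFst.lTensor 𝔸.A (l.path.val x) = l.poly.val (V.poly.tanFst.lTensor 𝔸.A x) := by
  rw [path, val_add, val_post, val_post, map_add, tanFst_tanInl, tanFst_tanInr, add_zero, val_pre]

/-- The first term is the de Rham differential; the minus sign comes from moving the odd operation
past `dt`. -/
theorem snd_val_path (l : Fam V V) {x : 𝔸.A ⊗[K] V.path} (hx : x ∈ 𝔸.pts V.path 0) :
    V.poly.tanSnd.lTensor 𝔸.A (l.path.val x) =
      V.deriv.lTensor 𝔸.A (V.poly.tanFst.lTensor 𝔸.A x) -
        l.poly.D (V.poly.tanFst.lTensor 𝔸.A x) (V.poly.tanSnd.lTensor 𝔸.A x) := by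
  rw [path, val_add, val_post, val_post, map_add, tanSnd_tanInl, tanSnd_tanInr, zero_add, val_sub,
    val_lin _ hx, val_der _ hx, LinearMap.lTensor_comp]
  rfl

end Points

/-- The derivative of an `L_∞[1]`-structure along its flow. -/
theorem Codiff.lmul_D_flow {l : Fam V V} (h : l.Codiff) {𝔸 : PointAlg.{u} K} {v q : 𝔸.A ⊗[K] V}
    (hv : v ∈ 𝔸.pts V 0) (hq : q ∈ 𝔸.pts V (-1)) :
    lmul V 𝔸.θ (l.D (v + lmul V 𝔸.η (l.val v)) (q - lmul V 𝔸.η (l.D v q))) =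
      lmul V 𝔸.θ (l.D v q) := by
  have hlv := val_mem h.homog hv
  have hDq := D_mem h.homog hv hq rfl
  have hv' : v + lmul V 𝔸.θ q ∈ 𝔸.pts V 0 := add_mem hv (lmul_mem_pts 𝔸.θ_mem hq (by ring))
  have hw : v + lmul V 𝔸.η (l.val v) ∈ 𝔸.pts V 0 := add_mem hv (lmul_mem_pts 𝔸.η_mem hlv (by ring))
  have hq' : q - lmul V 𝔸.η (l.D v q) ∈ 𝔸.pts V (-1) :=
    sub_mem hq (lmul_mem_pts 𝔸.η_mem hDq (by ring))
  -- Use flow invariance at the displaced point `v + θ q` and compare the parts containing `θ`; the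
  -- sign in the conclusion is that of `η θ = -θ η`.
  have h1 := h.sq 𝔸 _ hv'
  rw [val_add_lmul l 𝔸.θ_mem 𝔸.θ_mul_θ hv hq] at h1
  have e : v + lmul V 𝔸.θ q + lmul V 𝔸.η (l.val v + lmul V 𝔸.θ (l.D v q)) =
      v + lmul V 𝔸.η (l.val v) + lmul V 𝔸.θ (q - lmul V 𝔸.η (l.D v q)) := by
    rw [map_add, map_sub, lmul_lmul, lmul_lmul, 𝔸.η_mul_θ, lmul_neg]
    abel
  rw [e, val_add_lmul l 𝔸.θ_mem 𝔸.θ_mul_θ hw hq', h.sq 𝔸 v hv, add_right_inj] at h1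
  exact h1

/-- It suffices to prove flow invariance up to the factor `θ`. The function part is invariance of
`l.poly`. In the form part, the chain rule applied to that invariance handles `p'`, and
`lmul_D_flow` handles `Dl(p)[r]`. -/
theorem Codiff.path {l : Fam V V} (h : l.Codiff) : l.path.Codiff := by
  refine codiff_of_top h.homog.path fun 𝔸 x hx => PointAlg.top_of_θη ?_
  have hQ := val_mem h.homog.path hx
  have hx' : x + lmul _ 𝔸.η (l.path.val x) ∈ 𝔸.pts V.path 0 :=
    add_mem hx (lmul_mem_pts 𝔸.η_mem hQ (by ring))
  have hP : V.poly.tanFst.lTensor 𝔸.A x ∈ 𝔸.pts V.poly 0 :=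
    lTensor_mem_pts V.poly.homogLin_tanFst hx (by ring)
  have hq : V.poly.tanSnd.lTensor 𝔸.A x ∈ 𝔸.pts V.poly (-1) :=
    lTensor_mem_pts V.poly.homogLin_tanSnd hx (by ring)
  have hlP := val_mem h.homog.poly hP
  have hP' : V.poly.tanFst.lTensor 𝔸.A x + lmul _ 𝔸.η (l.poly.val (V.poly.tanFst.lTensor 𝔸.A x)) ∈
    𝔸.pts V.poly 0 := add_mem hP (lmul_mem_pts 𝔸.η_mem hlP (by ring))
  have hexp := val_add_lmul l.path 𝔸.η_mem 𝔸.η_mul_η hx hQ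
  rw [← sub_eq_iff_eq_add'] at hexp
  rw [← hexp, map_sub, sub_eq_zero]
  refine tan_ext ?_ ?_
  · rw [lTensor_lmul, lTensor_lmul, fst_val_path, fst_val_path, map_add, lTensor_lmul, fst_val_path,
      h.poly.sq 𝔸 _ hP]
  · have hs : V.poly.tanSnd.lTensor 𝔸.A (x + lmul _ 𝔸.η (l.path.val x)) =
        V.poly.tanSnd.lTensor 𝔸.A x + lmul _ 𝔸.η
          (V.deriv.lTensor 𝔸.A (V.poly.tanFst.lTensor 𝔸.A x) -
            l.poly.D (V.poly.tanFst.lTensor 𝔸.A x) (V.poly.tanSnd.lTensor 𝔸.A x)) := by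
      rw [map_add, lTensor_lmul, snd_val_path l hx]
    have hf : V.poly.tanFst.lTensor 𝔸.A (x + lmul _ 𝔸.η (l.path.val x)) =
        V.poly.tanFst.lTensor 𝔸.A x +
          lmul _ 𝔸.η (l.poly.val (V.poly.tanFst.lTensor 𝔸.A x)) := by
      rw [map_add, lTensor_lmul, fst_val_path]
    rw [lTensor_lmul, lTensor_lmul, snd_val_path l hx', snd_val_path l hx, hs, hf]
    set P := V.poly.tanFst.lTensor 𝔸.A x
    set q := V.poly.tanSnd.lTensor 𝔸.A x
    set P' := P + lmul _ 𝔸.η (l.poly.val P)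
    have h1 : lmul _ 𝔸.θ (l.poly.D P' (q - lmul _ 𝔸.η (l.poly.D P q))) =
        lmul _ 𝔸.θ (l.poly.D P q) := h.poly.lmul_D_flow hP hq
    have h2 := deriv_val_poly l hP'
    rw [h.poly.sq 𝔸 _ hP] at h2
    have h3 : lmul _ 𝔸.η (l.poly.D P' (V.deriv.lTensor 𝔸.A P)) =
        lmul _ 𝔸.η (V.deriv.lTensor 𝔸.A (l.poly.val P)) := by
      rw [h2, map_add, lTensor_lmul, map_add, D_lmul, map_add, lmul_lmul, 𝔸.η_mul_η, lmul_zero,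
        add_zero]
    -- The `η`-part of the derivative of `P'` cancels against the derivative of the operation in
    -- direction `P'_t`, by `h3`; only the term treated by `lmul_D_flow` remains.
    have h4 : V.deriv.lTensor 𝔸.A P' - l.poly.D P' (q + lmul _ 𝔸.η
        (V.deriv.lTensor 𝔸.A P - l.poly.D P q)) =
        V.deriv.lTensor 𝔸.A P - l.poly.D P' (q - lmul _ 𝔸.η (l.poly.D P q)) := by
      rw [map_add, lTensor_lmul, map_add, map_sub, map_sub, map_sub, ← h3]
      simp only [D_lmul]
      abel
    rw [h4, map_sub (lmul _ 𝔸.θ), map_sub (lmul _ 𝔸.θ), h1]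

theorem mor_pathEv {l : Fam V V} (hl : l.Homog 1) (τ : K) : Mor l.path l (lin (V.pathEv τ)) := by
  refine mor_lin_of_val hl.path (V.homogLin_pathEv τ) fun 𝔸 x hx => ?_
  rw [pathEv, LinearMap.lTensor_comp, LinearMap.comp_apply, LinearMap.comp_apply, fst_val_path,
    ev_val_poly]

theorem mor_pathMono_zero {l : Fam V V} (hl : l.Homog 1) : Mor l l.path (lin (V.pathMono 0)) := by
  refine mor_lin_of_val hl (V.homogLin_pathMono 0) fun 𝔸 v hv => ?_
  have h0 : pre l.poly (V.mono 0) (V.homogLin_mono 0) = post (V.mono 0) l :=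
    poly_ext fun τ => eq_of_val fun 𝔸 v hv => by
      rw [val_post, val_pre, ev_val_poly, val_post, val_post]
      have : V.ev τ ∘ₗ V.mono 0 = LinearMap.id := LinearMap.ext fun x => by simp
      have h : ∀ z : 𝔸.A ⊗[K] V, (V.ev τ).lTensor 𝔸.A ((V.mono 0).lTensor 𝔸.A z) = z := fun z => by
        rw [← LinearMap.comp_apply, ← LinearMap.lTensor_comp, this, LinearMap.lTensor_id]; rfl
      rw [h, h]
  have h1 : ∀ z, V.poly.tanFst.lTensor 𝔸.A ((V.pathMono 0).lTensor 𝔸.A z) =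
      (V.mono 0).lTensor 𝔸.A z := fun z => by
    rw [pathMono, LinearMap.lTensor_comp, LinearMap.comp_apply, tanFst_tanInl]
  have h2 : ∀ z, V.poly.tanSnd.lTensor 𝔸.A ((V.pathMono 0).lTensor 𝔸.A z) = 0 := fun z => by
    rw [pathMono, LinearMap.lTensor_comp, LinearMap.comp_apply, tanSnd_tanInl]
  have hm : (V.pathMono 0).lTensor 𝔸.A v ∈ 𝔸.pts V.path 0 :=
    lTensor_mem_pts (V.homogLin_pathMono 0) hv (by ring)
  refine tan_ext ?_ ?_
  · rw [h1, fst_val_path, h1, ← val_pre _ _ (V.homogLin_mono 0), h0, val_post]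
  · rw [h2, snd_val_path l hm, h1, h2, map_zero, sub_zero]
    have : V.deriv ∘ₗ V.mono 0 = 0 := LinearMap.ext fun x => by simp
    rw [← LinearMap.comp_apply, ← LinearMap.lTensor_comp, this, LinearMap.lTensor_zero]
    rfl

/-- The function part is checked by evaluating at each `τ`; the form part also uses that
differentiation in `t` commutes with coefficientwise maps. -/
theorem mor_pathMap {l : Fam V V} {l' : Fam W W} (hl : l.Homog 1) {L : V →ₗ[K] W}
    (hL : HomogLin V W L 0) (h : Mor l l' (lin L)) : Mor l.path l'.path (lin (V.pathMap L)) := by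
  refine mor_lin_of_val hl.path (V.homogLin_pathMap hL) fun 𝔸 v hv => ?_
  have hpL := homogLin_polyMap V hL
  have h0 : post (V.polyMap L) l.poly = pre l'.poly (V.polyMap L) hpL :=
    poly_ext fun τ => eq_of_val fun 𝔸 v hv => by
      have hv' : (V.ev τ).lTensor 𝔸.A v ∈ 𝔸.pts V 0 := lTensor_mem_pts (V.homogLin_ev τ) hv (by ring)
      have : W.ev τ ∘ₗ V.polyMap L = L ∘ₗ V.ev τ := LinearMap.ext fun x => V.ev_polyMap L τ x
      have h' : ∀ z : 𝔸.A ⊗[K] V.poly, (W.ev τ).lTensor 𝔸.A ((V.polyMap L).lTensor 𝔸.A z) =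
          L.lTensor 𝔸.A ((V.ev τ).lTensor 𝔸.A z) := fun z => by
        rw [← LinearMap.comp_apply, ← LinearMap.lTensor_comp, this, LinearMap.lTensor_comp]; rfl
      rw [val_post, val_post, val_post, val_pre, h', ev_val_poly, ev_val_poly, h', h.lin_val hl hv']
  have h1 : ∀ z, W.poly.tanFst.lTensor 𝔸.A ((V.pathMap L).lTensor 𝔸.A z) =
      (V.polyMap L).lTensor 𝔸.A (V.poly.tanFst.lTensor 𝔸.A z) := fun z => by
    rw [pathMap, LinearMap.lTensor_add, LinearMap.lTensor_comp, LinearMap.lTensor_comp,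
      LinearMap.lTensor_comp, LinearMap.lTensor_comp, LinearMap.add_apply, map_add]
    simp
  have h2 : ∀ z, W.poly.tanSnd.lTensor 𝔸.A ((V.pathMap L).lTensor 𝔸.A z) =
      (V.polyMap L).lTensor 𝔸.A (V.poly.tanSnd.lTensor 𝔸.A z) := fun z => by
    rw [pathMap, LinearMap.lTensor_add, LinearMap.lTensor_comp, LinearMap.lTensor_comp,
      LinearMap.lTensor_comp, LinearMap.lTensor_comp, LinearMap.add_apply, map_add]
    simp
  have h3 : ∀ z : 𝔸.A ⊗[K] V.poly, W.deriv.lTensor 𝔸.A ((V.polyMap L).lTensor 𝔸.A z) =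
      (V.polyMap L).lTensor 𝔸.A (V.deriv.lTensor 𝔸.A z) := fun z => by
    have : W.deriv ∘ₗ V.polyMap L = V.polyMap L ∘ₗ V.deriv :=
      LinearMap.ext fun x => V.deriv_polyMap L x
    rw [← LinearMap.comp_apply, ← LinearMap.lTensor_comp, this, LinearMap.lTensor_comp]; rfl
  have hm : (V.pathMap L).lTensor 𝔸.A v ∈ 𝔸.pts W.path 0 :=
    lTensor_mem_pts (V.homogLin_pathMap hL) hv (by ring)
  refine tan_ext ?_ ?_
  · rw [h1, fst_val_path, fst_val_path, h1, ← val_post, h0, val_pre]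
  · rw [h2, snd_val_path l hv, snd_val_path l' hm, h1, h2, h3, map_sub, ← D_post, h0, D_pre]

/-- The differential on forms. -/
theorem lin1_path (l : Fam V V) (p q : V.poly) :
    l.path.lin1 ((p, q) : V.poly × V.poly) =
      ((V.polyMap l.lin1 p, V.deriv p - V.polyMap l.lin1 q) : V.poly × V.poly) := by
  have : l.path.lin1 = V.poly.tanInl ∘ₗ (V.polyMap l.lin1 ∘ₗ V.poly.tanFst) +
      V.poly.tanInr ∘ₗ (V.deriv ∘ₗ V.poly.tanFst - V.polyMap l.lin1 ∘ₗ V.poly.tanSnd) := by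
    rw [path, lin1_add, lin1_post, lin1_post, lin1_pre, lin1_sub, lin1_lin, lin1_der, lin1_poly]
  rw [this]
  refine Prod.ext ?_ ?_
  · change V.polyMap l.lin1 p + 0 = _
    rw [add_zero]
  · change 0 + (V.deriv p - V.polyMap l.lin1 q) = _
    rw [zero_add]

end Fam

/-! ### Products and kernels -/

namespace GMod

variable {K : Type u} [Field K] (V : GMod.{u, v} K) (W : GMod.{u, w} K)

/-- The first projection of a product. -/
def prodFst : V.prod W →ₗ[K] V := LinearMap.fst K V W

/-- The second projection of a product. -/
def prodSnd : V.prod W →ₗ[K] W := LinearMap.snd K V W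

/-- The first inclusion into a product. -/
def prodInl : V →ₗ[K] V.prod W := LinearMap.inl K V W

/-- The second inclusion into a product. -/
def prodInr : W →ₗ[K] V.prod W := LinearMap.inr K V W

variable {V W}

/-- The map into a product with given components. -/
def prodLift {X : GMod.{u, x} K} (L : X →ₗ[K] V) (M : X →ₗ[K] W) : X →ₗ[K] V.prod W :=
  LinearMap.prod L M

theorem homogLin_prodFst : HomogLin (V.prod W) V (V.prodFst W) 0 := by
  intro n x hx; rw [add_zero]; exact hx.1

theorem homogLin_prodSnd : HomogLin (V.prod W) W (V.prodSnd W) 0 := by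
  intro n x hx; rw [add_zero]; exact hx.2

theorem homogLin_prodInl : HomogLin V (V.prod W) (V.prodInl W) 0 := by
  intro n x hx; rw [add_zero]; exact ⟨hx, zero_mem _⟩

theorem homogLin_prodInr : HomogLin W (V.prod W) (V.prodInr W) 0 := by
  intro n x hx; rw [add_zero]; exact ⟨zero_mem _, hx⟩

theorem HomogLin.prodLift {X : GMod.{u, x} K} {L : X →ₗ[K] V} {M : X →ₗ[K] W} {p : ℤ}
    (hL : HomogLin X V L p) (hM : HomogLin X W M p) :
    HomogLin X (V.prod W) (GMod.prodLift L M) p := fun n x hx => ⟨hL n x hx, hM n x hx⟩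

theorem prodInl_add_prodInr :
    V.prodInl W ∘ₗ V.prodFst W + V.prodInr W ∘ₗ V.prodSnd W = LinearMap.id := by
  refine LinearMap.ext fun x => Prod.ext ?_ ?_
  · exact add_zero _
  · exact zero_add _

theorem HomogLin.map_proj {L : V →ₗ[K] W} {p : ℤ} (hL : HomogLin V W L p) (n : ℤ) (x : V) :
    L (V.proj n x) = W.proj (n + p) (L x) := by
  have : L ∘ₗ V.proj n = W.proj (n + p) ∘ₗ L := by
    refine V.linearMap_ext fun m x hx => ?_
    have hLx := hL m x hx
    simp only [LinearMap.comp_apply]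
    by_cases h : m = n
    · subst h; rw [V.proj_of_mem hx, W.proj_of_mem hLx]
    · rw [V.proj_of_mem_ne hx h, W.proj_of_mem_ne hLx (by omega), map_zero]
  exact LinearMap.congr_fun this x

/-- The kernel of a homogeneous linear map. -/
def ker (L : V →ₗ[K] W) (hL : HomogLin V W L 0) : GMod.{u, v} K :=
  V.sub (LinearMap.ker L) fun n x hx => by
    rw [LinearMap.mem_ker] at hx ⊢
    rw [hL.map_proj, hx, map_zero]

/-- The inclusion of the kernel. -/
def kerIncl (L : V →ₗ[K] W) (hL : HomogLin V W L 0) : ker L hL →ₗ[K] V := (LinearMap.ker L).subtype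

theorem homogLin_kerIncl (L : V →ₗ[K] W) (hL : HomogLin V W L 0) :
    HomogLin (ker L hL) V (kerIncl L hL) 0 := by
  intro n x hx; rw [add_zero]; exact hx

theorem kerIncl_injective (L : V →ₗ[K] W) (hL : HomogLin V W L 0) :
    Function.Injective (kerIncl L hL) := Subtype.val_injective

end GMod

section LTensor

variable {K : Type u} [Field K] {A : Type*} [Ring A] [Algebra K A] {V W X : Type*}
  [AddCommGroup V] [Module K V] [AddCommGroup W] [Module K W] [AddCommGroup X] [Module K X]

theorem LinearMap.lTensor_of_comp_eq_id {L : W →ₗ[K] V} {M : V →ₗ[K] W}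
    (h : L ∘ₗ M = LinearMap.id) (z : A ⊗[K] V) : L.lTensor A (M.lTensor A z) = z := by
  rw [← LinearMap.lTensor_comp_apply, h, LinearMap.lTensor_id]; rfl

theorem LinearMap.lTensor_of_comp_eq_zero {L : W →ₗ[K] X} {M : V →ₗ[K] W}
    (h : L ∘ₗ M = 0) (z : A ⊗[K] V) : L.lTensor A (M.lTensor A z) = 0 := by
  rw [← LinearMap.lTensor_comp_apply, h, LinearMap.lTensor_zero]; rfl

theorem LinearMap.lTensor_of_comp_eq_comp {Y : Type*} [AddCommGroup Y] [Module K Y] {L : W →ₗ[K] X}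
    {M : V →ₗ[K] W} {L' : Y →ₗ[K] X} {M' : V →ₗ[K] Y} (h : L ∘ₗ M = L' ∘ₗ M') (z : A ⊗[K] V) :
    L.lTensor A (M.lTensor A z) = L'.lTensor A (M'.lTensor A z) := by
  rw [← LinearMap.lTensor_comp_apply, h, LinearMap.lTensor_comp_apply]

end LTensor

namespace Fam

open GMod

section

variable {K : Type u} [Field K] {V : GMod.{u, v} K} {W : GMod.{u, w} K} {X : GMod.{u, x} K}

theorem prod_ext {A : Type*} [Ring A] [Algebra K A] {x y : A ⊗[K] (V.prod W)}
    (h1 : (V.prodFst W).lTensor A x = (V.prodFst W).lTensor A y)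
    (h2 : (V.prodSnd W).lTensor A x = (V.prodSnd W).lTensor A y) : x = y := by
  have key : ∀ z : A ⊗[K] (V.prod W), z = (V.prodInl W).lTensor A ((V.prodFst W).lTensor A z) +
      (V.prodInr W).lTensor A ((V.prodSnd W).lTensor A z) := by
    intro z
    have := congrArg (fun L : V.prod W →ₗ[K] V.prod W => L.lTensor A z)
      (prodInl_add_prodInr (V := V) (W := W))
    simp only [LinearMap.lTensor_add, LinearMap.lTensor_comp, LinearMap.lTensor_id] at this
    exact this.symm
  rw [key x, key y, h1, h2]

variable {A : Type*} [Ring A] [Algebra K A]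

@[simp] theorem prodFst_prodInl (x : A ⊗[K] V) :
    (V.prodFst W).lTensor A ((V.prodInl W).lTensor A x) = x :=
  LinearMap.lTensor_of_comp_eq_id rfl x

@[simp] theorem prodFst_prodInr (x : A ⊗[K] W) :
    (V.prodFst W).lTensor A ((V.prodInr W).lTensor A x) = 0 :=
  LinearMap.lTensor_of_comp_eq_zero rfl x

@[simp] theorem prodSnd_prodInl (x : A ⊗[K] V) :
    (V.prodSnd W).lTensor A ((V.prodInl W).lTensor A x) = 0 :=
  LinearMap.lTensor_of_comp_eq_zero rfl x

@[simp] theorem prodSnd_prodInr (x : A ⊗[K] W) :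
    (V.prodSnd W).lTensor A ((V.prodInr W).lTensor A x) = x :=
  LinearMap.lTensor_of_comp_eq_id rfl x

theorem kerIncl_lTensor_injective (L : V →ₗ[K] W) (hL : HomogLin V W L 0) :
    Function.Injective ((kerIncl L hL).lTensor A) :=
  Module.Flat.lTensor_preserves_injective_linearMap _ (kerIncl_injective L hL)

/-- Restriction of the codomain of a family to a kernel. -/
def kerLift (L : V →ₗ[K] W) (hL : HomogLin V W L 0) (F : Fam X V) (h : post L F = 0) :
    Fam X (ker L hL) where
  f k := (F.f k).codRestrict (LinearMap.ker L) fun v =>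
    congrArg (fun G : Fam X W => G.f k v) h
  symm k d a ha σ := Subtype.ext (F.symm k d a ha σ)
  zero := MultilinearMap.ext fun v => Subtype.ext (MultilinearMap.congr_fun F.zero v)

theorem post_kerIncl_kerLift (L : V →ₗ[K] W) (hL : HomogLin V W L 0) (F : Fam X V)
    (h : post L F = 0) : post (kerIncl L hL) (kerLift L hL F h) = F := rfl

theorem Homog.kerLift {L : V →ₗ[K] W} {hL : HomogLin V W L 0} {F : Fam X V} {h : Fam.post L F = 0}
    {p : ℤ} (hF : F.Homog p) : (Fam.kerLift L hL F h).Homog p := fun k d a ha => hF k d a ha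

end

section Prod

variable {K : Type u} [Field K] [CharZero K] {V : GMod.{u, v} K} {W : GMod.{u, w} K}

/-- The product of two `L_∞[1]`-structures. -/
def prod (l : Fam V V) (l' : Fam W W) : Fam (V.prod W) (V.prod W) :=
  post (V.prodInl W) (pre l (V.prodFst W) homogLin_prodFst) +
    post (V.prodInr W) (pre l' (V.prodSnd W) homogLin_prodSnd)

omit [CharZero K] in
theorem Homog.prod {l : Fam V V} {l' : Fam W W} {p : ℤ} (hl : l.Homog p) (hl' : l'.Homog p) :
    (Fam.prod l l').Homog p :=
  ((hl.pre homogLin_prodFst).post homogLin_prodInl (by ring)).add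
    ((hl'.pre homogLin_prodSnd).post homogLin_prodInr (by ring))

omit [CharZero K] in
theorem fst_val_prod (l : Fam V V) (l' : Fam W W) {𝔸 : PointAlg.{u} K}
    (x : 𝔸.A ⊗[K] (V.prod W)) : (V.prodFst W).lTensor 𝔸.A ((prod l l').val x) =
      l.val ((V.prodFst W).lTensor 𝔸.A x) := by
  rw [prod, val_add, val_post, val_post, map_add, prodFst_prodInl, prodFst_prodInr, val_pre,
    add_zero]

omit [CharZero K] in
theorem snd_val_prod (l : Fam V V) (l' : Fam W W) {𝔸 : PointAlg.{u} K}
    (x : 𝔸.A ⊗[K] (V.prod W)) : (V.prodSnd W).lTensor 𝔸.A ((prod l l').val x) =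
      l'.val ((V.prodSnd W).lTensor 𝔸.A x) := by
  rw [prod, val_add, val_post, val_post, map_add, prodSnd_prodInl, prodSnd_prodInr, val_pre,
    zero_add]

omit [CharZero K] in
theorem Codiff.prod {l : Fam V V} {l' : Fam W W} (h : l.Codiff) (h' : l'.Codiff) :
    (Fam.prod l l').Codiff := by
  refine ⟨h.homog.prod h'.homog, fun 𝔸 v hv => ?_⟩
  have h1 := lTensor_mem_pts (homogLin_prodFst (V := V) (W := W)) hv (r := 0) (by ring)
  have h2 := lTensor_mem_pts (homogLin_prodSnd (V := V) (W := W)) hv (r := 0) (by ring)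
  refine prod_ext ?_ ?_
  · rw [fst_val_prod, map_add, lTensor_lmul, fst_val_prod, h.sq 𝔸 _ h1]
  · rw [snd_val_prod, map_add, lTensor_lmul, snd_val_prod, h'.sq 𝔸 _ h2]

theorem mor_prodFst {l : Fam V V} {l' : Fam W W} (h : l.Homog 1) (h' : l'.Homog 1) :
    Mor (prod l l') l (lin (V.prodFst W)) :=
  mor_lin_of_val (h.prod h') homogLin_prodFst fun _ v _ => fst_val_prod l l' v

theorem mor_prodSnd {l : Fam V V} {l' : Fam W W} (h : l.Homog 1) (h' : l'.Homog 1) :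
    Mor (prod l l') l' (lin (V.prodSnd W)) :=
  mor_lin_of_val (h.prod h') homogLin_prodSnd fun _ v _ => snd_val_prod l l' v

end Prod

end Fam

/-! ### Path spaces with prescribed endpoints -/

set_option linter.checkUnivs false in
open GMod Fam in
/-- Two morphisms `φ₀, φ₁ : Z → X` that agree after composition with a strict morphism
`q : X → B`. -/
structure PathData (K : Type u) [Field K] where
  Z : GMod.{u, v} K
  X : GMod.{u, w} K
  B : GMod.{u, x} K
  lZ : Fam Z Z
  lX : Fam X X
  lB : Fam B B
  φ₀ : Fam Z X
  φ₁ : Fam Z X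
  q : X →ₗ[K] B
  hZ : lZ.Codiff
  hX : lX.Codiff
  hB : lB.Homog 1
  hq : HomogLin X B q 0
  mor_q : Mor lX lB (lin q)
  mor₀ : Mor lZ lX φ₀
  mor₁ : Mor lZ lX φ₁
  post_eq : post q φ₀ = post q φ₁

namespace PathData

open GMod Fam

variable {K : Type u} [Field K] (𝔇 : PathData.{u, v, w, x} K)

/-- The conditions on a form: vanishing at the endpoints and after applying `q`. -/
noncomputable def cond : 𝔇.X.path →ₗ[K] (𝔇.X.prod 𝔇.X).prod 𝔇.B.path :=
  prodLift (prodLift (𝔇.X.pathEv 0) (𝔇.X.pathEv 1)) (𝔇.X.pathMap 𝔇.q)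

theorem homogLin_cond : HomogLin 𝔇.X.path ((𝔇.X.prod 𝔇.X).prod 𝔇.B.path) 𝔇.cond 0 :=
  ((𝔇.X.homogLin_pathEv 0).prodLift (𝔇.X.homogLin_pathEv 1)).prodLift (𝔇.X.homogLin_pathMap 𝔇.hq)

/-- Forms vanishing at the endpoints and after applying `q`. -/
noncomputable abbrev loops : GMod.{u, w} K := ker 𝔇.cond 𝔇.homogLin_cond

/-- The inclusion of loops into all forms. -/
noncomputable abbrev incl : 𝔇.loops →ₗ[K] 𝔇.X.path := kerIncl 𝔇.cond 𝔇.homogLin_cond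

/-- The space of paths from `φ₀ z` to `φ₁ z` over `B`, presented as `Z × loops`. -/
noncomputable abbrev total : GMod.{u, max v w} K := 𝔇.Z.prod 𝔇.loops

/-- The projection to `Z`. -/
noncomputable def toZ : 𝔇.total →ₗ[K] 𝔇.Z := 𝔇.Z.prodFst 𝔇.loops

/-- The projection to the loop component. -/
noncomputable def toLoop : 𝔇.total →ₗ[K] 𝔇.X.path := 𝔇.incl ∘ₗ 𝔇.Z.prodSnd 𝔇.loops

theorem homogLin_toZ : HomogLin 𝔇.total 𝔇.Z 𝔇.toZ 0 := homogLin_prodFst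

theorem homogLin_toLoop : HomogLin 𝔇.total 𝔇.X.path 𝔇.toLoop 0 :=
  (homogLin_kerIncl _ _).comp homogLin_prodSnd (by ring)

theorem pathEv_zero_toLoop : 𝔇.X.pathEv 0 ∘ₗ 𝔇.toLoop = 0 :=
  LinearMap.ext fun x => congrArg (fun y => y.1.1) x.2.2

theorem pathEv_one_toLoop : 𝔇.X.pathEv 1 ∘ₗ 𝔇.toLoop = 0 :=
  LinearMap.ext fun x => congrArg (fun y => y.1.2) x.2.2

theorem pathMap_toLoop : 𝔇.X.pathMap 𝔇.q ∘ₗ 𝔇.toLoop = 0 :=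
  LinearMap.ext fun x => congrArg (fun y => y.2) x.2.2

end PathData

/-! ### Linear interpolation between endpoints -/

namespace GMod

variable {K : Type u} [Field K] (V : GMod.{u, v} K) {W : GMod.{u, w} K}

/-- The form `(1 - t) x`. -/
noncomputable def seg₀ : V →ₗ[K] V.path := V.pathMono 0 - V.pathMono 1

/-- The form `t x`. -/
noncomputable def seg₁ : V →ₗ[K] V.path := V.pathMono 1

theorem homogLin_seg₀ : HomogLin V V.path V.seg₀ 0 :=
  (V.homogLin_pathMono 0).sub (V.homogLin_pathMono 1)

theorem homogLin_seg₁ : HomogLin V V.path V.seg₁ 0 := V.homogLin_pathMono 1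

theorem pathEv_zero_seg₀ : V.pathEv 0 ∘ₗ V.seg₀ = LinearMap.id := by
  rw [seg₀, LinearMap.comp_sub, pathEv_comp_pathMono, pathEv_comp_pathMono]; simp

theorem pathEv_one_seg₀ : V.pathEv 1 ∘ₗ V.seg₀ = 0 := by
  rw [seg₀, LinearMap.comp_sub, pathEv_comp_pathMono, pathEv_comp_pathMono]; simp

theorem pathEv_zero_seg₁ : V.pathEv 0 ∘ₗ V.seg₁ = 0 := by
  rw [seg₁, pathEv_comp_pathMono]; simp

theorem pathEv_one_seg₁ : V.pathEv 1 ∘ₗ V.seg₁ = LinearMap.id := by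
  rw [seg₁, pathEv_comp_pathMono]; simp

theorem pathMap_seg₀ (L : V →ₗ[K] W) : V.pathMap L ∘ₗ V.seg₀ = W.seg₀ ∘ₗ L := by
  rw [seg₀, seg₀, LinearMap.comp_sub, LinearMap.sub_comp, pathMap_comp_pathMono,
    pathMap_comp_pathMono]

theorem pathMap_seg₁ (L : V →ₗ[K] W) : V.pathMap L ∘ₗ V.seg₁ = W.seg₁ ∘ₗ L :=
  pathMap_comp_pathMono V L 1

theorem seg₀_add_seg₁ {A : Type*} [Ring A] [Algebra K A] (z : A ⊗[K] V) :
    V.seg₀.lTensor A z + V.seg₁.lTensor A z = (V.pathMono 0).lTensor A z := by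
  rw [← LinearMap.add_apply, ← LinearMap.lTensor_add, seg₀, seg₁, sub_add_cancel]

end GMod

/-! ### The structure on the space of paths -/

namespace PathData

open GMod Fam

variable {K : Type u} [Field K] [CharZero K] (𝔇 : PathData.{u, v, w, x} K)

/-- The path of a point of the path space. -/
noncomputable def path : Fam 𝔇.total 𝔇.X.path :=
  pre (post 𝔇.X.seg₀ 𝔇.φ₀ + post 𝔇.X.seg₁ 𝔇.φ₁) 𝔇.toZ 𝔇.homogLin_toZ + lin 𝔇.toLoop

/-- The loop component of the structure on the path space, as forms. -/
noncomputable def loopOp : Fam 𝔇.total 𝔇.X.path :=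
  comp 𝔇.lX.path 𝔇.path -
    pre (post 𝔇.X.seg₀ (comp 𝔇.lX 𝔇.φ₀) + post 𝔇.X.seg₁ (comp 𝔇.lX 𝔇.φ₁)) 𝔇.toZ 𝔇.homogLin_toZ

omit [CharZero K] in
theorem homog_path : 𝔇.path.Homog 0 :=
  (((𝔇.mor₀.homog.post 𝔇.X.homogLin_seg₀ rfl).add
    (𝔇.mor₁.homog.post 𝔇.X.homogLin_seg₁ rfl)).pre 𝔇.homogLin_toZ).add (homog_lin 𝔇.homogLin_toLoop)

theorem homog_loopOp : 𝔇.loopOp.Homog 1 :=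
  (𝔇.hX.homog.path.comp 𝔇.homog_path).sub
    ((((𝔇.hX.homog.comp 𝔇.mor₀.homog).post 𝔇.X.homogLin_seg₀ rfl).add
    ((𝔇.hX.homog.comp 𝔇.mor₁.homog).post 𝔇.X.homogLin_seg₁ rfl)).pre 𝔇.homogLin_toZ)

variable {𝔸 : PointAlg.{u} K}

omit [CharZero K] in
theorem toZ_mem {x : 𝔸.A ⊗[K] 𝔇.total} (hx : x ∈ 𝔸.pts 𝔇.total 0) :
    𝔇.toZ.lTensor 𝔸.A x ∈ 𝔸.pts 𝔇.Z 0 := lTensor_mem_pts 𝔇.homogLin_toZ hx (by ring)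

omit [CharZero K] in
theorem val_path {x : 𝔸.A ⊗[K] 𝔇.total} (hx : x ∈ 𝔸.pts 𝔇.total 0) : 𝔇.path.val x =
    𝔇.X.seg₀.lTensor 𝔸.A (𝔇.φ₀.val (𝔇.toZ.lTensor 𝔸.A x)) +
      𝔇.X.seg₁.lTensor 𝔸.A (𝔇.φ₁.val (𝔇.toZ.lTensor 𝔸.A x)) + 𝔇.toLoop.lTensor 𝔸.A x := by
  rw [path, val_add, val_pre, val_add, val_post, val_post, val_lin _ hx]

theorem val_loopOp {x : 𝔸.A ⊗[K] 𝔇.total} (hx : x ∈ 𝔸.pts 𝔇.total 0) :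
    𝔇.loopOp.val x = 𝔇.lX.path.val (𝔇.path.val x) -
      (𝔇.X.seg₀.lTensor 𝔸.A (𝔇.lX.val (𝔇.φ₀.val (𝔇.toZ.lTensor 𝔸.A x))) +
        𝔇.X.seg₁.lTensor 𝔸.A (𝔇.lX.val (𝔇.φ₁.val (𝔇.toZ.lTensor 𝔸.A x)))) := by
  have hz := 𝔇.toZ_mem hx
  rw [loopOp, val_sub, val_comp _ _ 𝔇.homog_path hx, val_pre, val_add, val_post, val_post,
    val_comp _ _ 𝔇.mor₀.homog hz, val_comp _ _ 𝔇.mor₁.homog hz]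

omit [CharZero K] in
theorem pathEv_zero_val_path {x : 𝔸.A ⊗[K] 𝔇.total} (hx : x ∈ 𝔸.pts 𝔇.total 0) :
    (𝔇.X.pathEv 0).lTensor 𝔸.A (𝔇.path.val x) = 𝔇.φ₀.val (𝔇.toZ.lTensor 𝔸.A x) := by
  rw [𝔇.val_path hx, map_add, map_add, LinearMap.lTensor_of_comp_eq_id 𝔇.X.pathEv_zero_seg₀,
    LinearMap.lTensor_of_comp_eq_zero 𝔇.X.pathEv_zero_seg₁,
    LinearMap.lTensor_of_comp_eq_zero 𝔇.pathEv_zero_toLoop, add_zero, add_zero]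

omit [CharZero K] in
theorem pathEv_one_val_path {x : 𝔸.A ⊗[K] 𝔇.total} (hx : x ∈ 𝔸.pts 𝔇.total 0) :
    (𝔇.X.pathEv 1).lTensor 𝔸.A (𝔇.path.val x) = 𝔇.φ₁.val (𝔇.toZ.lTensor 𝔸.A x) := by
  rw [𝔇.val_path hx, map_add, map_add, LinearMap.lTensor_of_comp_eq_zero 𝔇.X.pathEv_one_seg₀,
    LinearMap.lTensor_of_comp_eq_id 𝔇.X.pathEv_one_seg₁,
    LinearMap.lTensor_of_comp_eq_zero 𝔇.pathEv_one_toLoop, add_zero, zero_add]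

omit [CharZero K] in
theorem pathMap_val_path {x : 𝔸.A ⊗[K] 𝔇.total} (hx : x ∈ 𝔸.pts 𝔇.total 0) :
    (𝔇.X.pathMap 𝔇.q).lTensor 𝔸.A (𝔇.path.val x) =
      (𝔇.B.pathMono 0).lTensor 𝔸.A (𝔇.q.lTensor 𝔸.A (𝔇.φ₀.val (𝔇.toZ.lTensor 𝔸.A x))) := by
  rw [𝔇.val_path hx, map_add, map_add, LinearMap.lTensor_of_comp_eq_comp (𝔇.X.pathMap_seg₀ 𝔇.q),
    LinearMap.lTensor_of_comp_eq_comp (𝔇.X.pathMap_seg₁ 𝔇.q),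
    LinearMap.lTensor_of_comp_eq_zero 𝔇.pathMap_toLoop, add_zero, ← val_post 𝔇.q 𝔇.φ₁, ← 𝔇.post_eq,
    val_post, seg₀_add_seg₁]

/-- Endpoint evaluations and `pathMap q` are strict morphisms. Hence the operation applied to the
path, and the interpolation of the operations at its endpoints, have the same endpoints and the same
image in `B`. That image is constant because `φ₀` and `φ₁` agree after `q`. -/
theorem post_cond_loopOp : post 𝔇.cond 𝔇.loopOp = 0 := by
  refine eq_of_val fun 𝔸 x hx => ?_
  have hz := 𝔇.toZ_mem hx
  have hp := val_mem 𝔇.homog_path hx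
  have h0 := val_mem 𝔇.mor₀.homog hz
  have h1 := val_mem 𝔇.mor₁.homog hz
  have e1 : 𝔇.X.prodFst 𝔇.X ∘ₗ (𝔇.X.prod 𝔇.X).prodFst 𝔇.B.path ∘ₗ 𝔇.cond = 𝔇.X.pathEv 0 := rfl
  have e2 : 𝔇.X.prodSnd 𝔇.X ∘ₗ (𝔇.X.prod 𝔇.X).prodFst 𝔇.B.path ∘ₗ 𝔇.cond = 𝔇.X.pathEv 1 := rfl
  have e3 : (𝔇.X.prod 𝔇.X).prodSnd 𝔇.B.path ∘ₗ 𝔇.cond = 𝔇.X.pathMap 𝔇.q := rfl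
  rw [val_zero, val_post]
  refine prod_ext (prod_ext ?_ ?_) ?_
  · rw [← LinearMap.lTensor_comp_apply, ← LinearMap.lTensor_comp_apply, map_zero, map_zero]
    refine (congrArg (fun L : 𝔇.X.path →ₗ[K] 𝔇.X => L.lTensor 𝔸.A (𝔇.loopOp.val x)) e1).trans ?_
    rw [𝔇.val_loopOp hx, map_sub, (mor_pathEv 𝔇.hX.homog 0).lin_val 𝔇.hX.homog.path hp,
      𝔇.pathEv_zero_val_path hx, map_add, LinearMap.lTensor_of_comp_eq_id 𝔇.X.pathEv_zero_seg₀,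
      LinearMap.lTensor_of_comp_eq_zero 𝔇.X.pathEv_zero_seg₁, add_zero, sub_self]
  · rw [← LinearMap.lTensor_comp_apply, ← LinearMap.lTensor_comp_apply, map_zero, map_zero]
    refine (congrArg (fun L : 𝔇.X.path →ₗ[K] 𝔇.X => L.lTensor 𝔸.A (𝔇.loopOp.val x)) e2).trans ?_
    rw [𝔇.val_loopOp hx, map_sub, (mor_pathEv 𝔇.hX.homog 1).lin_val 𝔇.hX.homog.path hp,
      𝔇.pathEv_one_val_path hx, map_add, LinearMap.lTensor_of_comp_eq_id 𝔇.X.pathEv_one_seg₁,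
      LinearMap.lTensor_of_comp_eq_zero 𝔇.X.pathEv_one_seg₀, zero_add, sub_self]
  · rw [← LinearMap.lTensor_comp_apply, map_zero, e3, 𝔇.val_loopOp hx, map_sub,
      (mor_pathMap 𝔇.hX.homog 𝔇.hq 𝔇.mor_q).lin_val 𝔇.hX.homog.path hp, 𝔇.pathMap_val_path hx,
      map_add, LinearMap.lTensor_of_comp_eq_comp (𝔇.X.pathMap_seg₀ 𝔇.q),
      LinearMap.lTensor_of_comp_eq_comp (𝔇.X.pathMap_seg₁ 𝔇.q),
      𝔇.mor_q.lin_val 𝔇.hX.homog h0, 𝔇.mor_q.lin_val 𝔇.hX.homog h1, ← val_post 𝔇.q 𝔇.φ₁,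
      ← 𝔇.post_eq, val_post, seg₀_add_seg₁,
      ← (mor_pathMono_zero 𝔇.hB).lin_val 𝔇.hB (lTensor_mem_pts 𝔇.hq h0 (by ring)), sub_self]

/-- The `L_∞[1]`-structure on the path space. -/
noncomputable def op : Fam 𝔇.total 𝔇.total :=
  post (𝔇.Z.prodInl 𝔇.loops) (pre 𝔇.lZ 𝔇.toZ 𝔇.homogLin_toZ) +
    post (𝔇.Z.prodInr 𝔇.loops) (kerLift 𝔇.cond 𝔇.homogLin_cond 𝔇.loopOp 𝔇.post_cond_loopOp)

theorem homog_op : 𝔇.op.Homog 1 :=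
  ((𝔇.hZ.homog.pre 𝔇.homogLin_toZ).post homogLin_prodInl rfl).add
    (𝔇.homog_loopOp.kerLift.post homogLin_prodInr rfl)

theorem toZ_val_op (x : 𝔸.A ⊗[K] 𝔇.total) :
    𝔇.toZ.lTensor 𝔸.A (𝔇.op.val x) = 𝔇.lZ.val (𝔇.toZ.lTensor 𝔸.A x) := by
  rw [op, val_add, val_post, val_post, map_add]
  refine (congrArg₂ (· + ·) (prodFst_prodInl _) (prodFst_prodInr _)).trans ?_
  rw [add_zero, val_pre]

theorem toLoop_val_op (x : 𝔸.A ⊗[K] 𝔇.total) :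
    𝔇.toLoop.lTensor 𝔸.A (𝔇.op.val x) = 𝔇.loopOp.val x := by
  rw [op, val_add, val_post, val_post, map_add, toLoop]
  rw [LinearMap.lTensor_comp_apply, LinearMap.lTensor_comp_apply]
  refine (congrArg₂ (· + ·) (congrArg _ (prodSnd_prodInl _))
    (congrArg _ (prodSnd_prodInr _))).trans ?_
  rw [map_zero, zero_add, ← val_post, post_kerIncl_kerLift]

omit [CharZero K] in
theorem total_ext {x y : 𝔸.A ⊗[K] 𝔇.total} (h1 : 𝔇.toZ.lTensor 𝔸.A x = 𝔇.toZ.lTensor 𝔸.A y)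
    (h2 : 𝔇.toLoop.lTensor 𝔸.A x = 𝔇.toLoop.lTensor 𝔸.A y) : x = y := by
  refine prod_ext h1 (kerIncl_lTensor_injective _ _ ?_)
  rw [toLoop, LinearMap.lTensor_comp_apply, LinearMap.lTensor_comp_apply] at h2
  exact h2

/-- The interpolation subtracted in `loopOp` is exactly what the endpoint terms gain along the flow,
as `φ₀` and `φ₁` are morphisms. So `op` is the operation on paths expressed in the coordinates `Z ×
loops`. -/
theorem path_flow {x : 𝔸.A ⊗[K] 𝔇.total} (hx : x ∈ 𝔸.pts 𝔇.total 0) :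
    𝔇.path.val (x + lmul _ 𝔸.η (𝔇.op.val x)) =
      𝔇.path.val x + lmul _ 𝔸.η (𝔇.lX.path.val (𝔇.path.val x)) := by
  have hx' : x + lmul _ 𝔸.η (𝔇.op.val x) ∈ 𝔸.pts 𝔇.total 0 :=
    add_mem hx (lmul_mem_pts 𝔸.η_mem (val_mem 𝔇.homog_op hx) (by ring))
  have hz := 𝔇.toZ_mem hx
  have e : 𝔇.path.val (x + lmul _ 𝔸.η (𝔇.op.val x)) = 𝔇.path.val x +
      lmul _ 𝔸.η (𝔇.X.seg₀.lTensor 𝔸.A (𝔇.lX.val (𝔇.φ₀.val (𝔇.toZ.lTensor 𝔸.A x))) +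
        𝔇.X.seg₁.lTensor 𝔸.A (𝔇.lX.val (𝔇.φ₁.val (𝔇.toZ.lTensor 𝔸.A x))) + 𝔇.loopOp.val x) := by
    rw [𝔇.val_path hx', 𝔇.val_path hx, map_add (𝔇.toLoop.lTensor 𝔸.A), map_add (𝔇.toZ.lTensor 𝔸.A),
      lTensor_lmul, lTensor_lmul, toZ_val_op, toLoop_val_op, 𝔇.mor₀.comm 𝔸 _ hz,
      𝔇.mor₁.comm 𝔸 _ hz, map_add, map_add, lTensor_lmul, lTensor_lmul, map_add (lmul _ 𝔸.η),
      map_add (lmul _ 𝔸.η)]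
    abel
  rw [e, 𝔇.val_loopOp hx, add_sub_cancel]

/-- Along the flow, the base point, its two images and the path move by their own flows, and `op` is
assembled from operations that are invariant under these. -/
theorem codiff_op : 𝔇.op.Codiff := by
  refine ⟨𝔇.homog_op, fun 𝔸 x hx => ?_⟩
  have hx' : x + lmul _ 𝔸.η (𝔇.op.val x) ∈ 𝔸.pts 𝔇.total 0 :=
    add_mem hx (lmul_mem_pts 𝔸.η_mem (val_mem 𝔇.homog_op hx) (by ring))
  have hz := 𝔇.toZ_mem hx
  refine 𝔇.total_ext ?_ ?_
  · rw [toZ_val_op, toZ_val_op, map_add, lTensor_lmul, toZ_val_op, 𝔇.hZ.sq 𝔸 _ hz]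
  · rw [toLoop_val_op, toLoop_val_op, 𝔇.val_loopOp hx', 𝔇.val_loopOp hx, 𝔇.path_flow hx,
      𝔇.hX.path.sq 𝔸 _ (val_mem 𝔇.homog_path hx), map_add, lTensor_lmul, toZ_val_op,
      𝔇.mor₀.comm 𝔸 _ hz, 𝔇.mor₁.comm 𝔸 _ hz, 𝔇.hX.sq 𝔸 _ (val_mem 𝔇.mor₀.homog hz),
      𝔇.hX.sq 𝔸 _ (val_mem 𝔇.mor₁.homog hz)]

theorem mor_path : Mor 𝔇.op 𝔇.lX.path 𝔇.path := ⟨𝔇.homog_path, fun _ _ hx => 𝔇.path_flow hx⟩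

theorem mor_toZ : Mor 𝔇.op 𝔇.lZ (lin 𝔇.toZ) :=
  mor_lin_of_val 𝔇.homog_op 𝔇.homogLin_toZ fun _ x _ => 𝔇.toZ_val_op x

theorem toZ_lin1_op (x : 𝔇.total) : 𝔇.toZ (𝔇.op.lin1 x) = 𝔇.lZ.lin1 (𝔇.toZ x) :=
  add_zero _

theorem path_lin1_op (x : 𝔇.total) :
    𝔇.path.lin1 (𝔇.op.lin1 x) = 𝔇.lX.path.lin1 (𝔇.path.lin1 x) :=
  𝔇.mor_path.lin1_comm 𝔇.homog_op x

end PathData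

/-! ### Sections of morphisms with contractible kernel -/

namespace Fam

variable {K : Type u} [Field K] {V : GMod.{u, v} K} {W : GMod.{u, w} K} {X : GMod.{u, x} K}

/-- If `N` has no linear component, the arity `k` part of `N ∘ F` only involves the components of
`F` of lower arity. -/
theorem comp_f_congr {N : Fam W X} (hN : N.f 1 = 0) {F G : Fam V W} {k : ℕ}
    (h : ∀ j < k, F.f j = G.f j) : (comp N F).f k = (comp N G).f k := by
  refine congrArg gsym (Finset.sum_congr rfl fun c _ => congrArg _ ?_)
  by_cases hc : ∀ i, c.blocksFun i < k
  · refine MultilinearMap.ext fun a => ?_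
    rw [compAlong_apply, compAlong_apply]
    exact congrArg _ (funext fun i => by rw [h _ (hc i)])
  -- A block of size `k` leaves no room for another block, so the composition has length at most
  -- one, where `N` vanishes.
  · have h0 : N.f c.length = 0 := by
      push Not at hc
      obtain ⟨i, hi⟩ := hc
      have h1 : c.length ≤ 1 := by
        by_contra hlt
        push Not at hlt
        obtain ⟨j, hj⟩ : ∃ j : Fin c.length, j ≠ i := by
          have : Nontrivial (Fin c.length) := Fin.nontrivial_iff_two_le.mpr hlt
          exact exists_ne i
        have hs := c.sum_blocksFun
        have h2 : c.blocksFun i + c.blocksFun j ≤ ∑ i, c.blocksFun i := by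
          rw [← Finset.sum_pair hj.symm]
          exact Finset.sum_le_sum_of_subset (Finset.subset_univ _)
        have := c.one_le_blocksFun j
        omega
      have key : ∀ m ≤ 1, N.f m = 0 := by
        intro m hm
        interval_cases m
        exacts [N.zero, hN]
      exact key _ h1
    rw [h0]
    rfl

/-- The span of the tensors annihilated by the product of the universal generators. -/
noncomputable def univAnn (V : GMod.{u, v} K) {n : ℕ} (d : Fin n → ℤ) : Submodule K ((univAlg K d).A ⊗[K] V) :=
  Submodule.span K {t | ∃ (e : (univAlg K d).A) (x : V),
    (List.ofFn (univGen K d)).prod * e = 0 ∧ e ⊗ₜ x = t}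

/-- Every coefficient occurring in the value contains a universal generator, and the product of all
generators annihilates each of them. -/
theorem val_univPt_mem (F : Fam V W) {n : ℕ} (d : Fin n → ℤ) (a : Fin n → V) :
    F.val (univPt d a) ∈ univAnn W d := by
  refine Submodule.sum_mem _ fun k _ => Submodule.smul_mem _ _ ?_
  rcases k with _ | k
  · rw [F.zero, tens_zero]; exact zero_mem _
  refine MultilinearMap.map_mem_of_forall_mem_span _
    (fun _ => {t | ∃ j, univGen K d j ⊗ₜ a j = t}) _ (fun s hs => ?_) _ fun _ =>
      Submodule.sum_mem _ fun j _ => Submodule.subset_span ⟨j, rfl⟩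
  choose j hj using hs
  obtain rfl : (fun i => univGen K d (j i) ⊗ₜ a (j i)) = s := funext hj
  rw [tens_tmul]
  refine Submodule.subset_span ⟨_, _, ?_, rfl⟩
  rw [List.ofFn_succ, List.prod_cons, ← mul_assoc]
  -- Listing all generators and then `j 0` once more gives `n + 1` indices among `n`, so one is
  -- repeated.
  have h := prod_univGen_eq_zero (K := K) d (Fin.snoc id (j 0) : Fin (n + 1) → Fin n) fun hi => by
    have := Fintype.card_le_of_injective _ hi
    simp only [Fintype.card_fin] at this
    omega
  rw [List.ofFn_succ', List.concat_eq_append, List.prod_append] at h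
  simp only [Fin.snoc_castSucc, Fin.snoc_last, List.prod_singleton, id] at h
  rw [h, zero_mul]

/-- The first slot already carries the product of all generators, which annihilates every
coefficient of `z`; only the linear term survives. This isolates the differential when a leading
component is tested. -/
theorem D_univAnn (F : Fam V W) {n : ℕ} {d : Fin n → ℤ} {z : (univAlg K d).A ⊗[K] V}
    (hz : z ∈ univAnn V d) (y : V) : F.D z ((List.ofFn (univGen K d)).prod ⊗ₜ y) =
      (List.ofFn (univGen K d)).prod ⊗ₜ F.lin1 y := by
  set P := (List.ofFn (univGen K d)).prod with hP
  rw [D_apply, Finset.sum_eq_single_of_mem 0 (by simpa using (univAlg K d).N_pos)]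
  · have e : (Fin.cons (P ⊗ₜ[K] y) fun _ => z : Fin (0 + 1) → (univAlg K d).A ⊗[K] V) =
        fun i => P ⊗ₜ[K] y := funext fun i => by
      obtain rfl : i = 0 := Fin.ext (by omega)
      rfl
    rw [e, tens_tmul]
    simp only [Nat.factorial_zero, Nat.cast_one, inv_one, one_smul, zero_add, List.ofFn_succ,
      List.ofFn_zero, List.prod_singleton]
    rfl
  · intro k _ hk
    obtain ⟨k, rfl⟩ := Nat.exists_eq_succ_of_ne_zero hk
    have : tens (univAlg K d).A (F.f (k + 1 + 1)) (Fin.cons (P ⊗ₜ[K] y) fun _ => z) ∈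
        (⊥ : Submodule K _) := by
      refine MultilinearMap.map_mem_of_forall_mem_span _ (Fin.cons {t | t = P ⊗ₜ[K] y} fun _ =>
        {t | ∃ (e : (univAlg K d).A) (x : V), P * e = 0 ∧ e ⊗ₜ x = t} :
          Fin (k + 1 + 1) → Set ((univAlg K d).A ⊗[K] V)) _ (fun s hs => ?_) _ fun i => ?_
      · have h0 : s 0 = P ⊗ₜ[K] y := hs 0
        have h1 : ∀ i : Fin (k + 1), ∃ (e : (univAlg K d).A) (x : V), P * e = 0 ∧ e ⊗ₜ x = s i.succ :=
          fun i => hs i.succ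
        choose e x he hx using h1
        obtain rfl : (fun i => (Fin.cons P e : Fin (k + 1 + 1) → (univAlg K d).A) i ⊗ₜ[K]
            (Fin.cons y x : Fin (k + 1 + 1) → V) i) = s := by
          funext i
          refine Fin.cases ?_ (fun i => ?_) i
          · rw [h0]; rfl
          · exact hx i
        rw [tens_tmul, List.ofFn_succ, List.prod_cons, Fin.cons_zero, List.ofFn_succ,
          List.prod_cons, ← mul_assoc, Fin.cons_succ, he, zero_mul, TensorProduct.zero_tmul]
        exact zero_mem _
      · refine Fin.cases ?_ (fun i => ?_) i
        · exact Submodule.subset_span rfl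
        · exact hz
    rw [Submodule.mem_bot] at this
    rw [this, smul_zero]

end Fam

open GMod in
/-- A contraction of a complex `(E, d)` onto the target of a map `q : E → B`. -/
structure Contraction {K : Type u} [Field K] {E : GMod.{u, v} K} {B : GMod.{u, w} K}
    (d : E →ₗ[K] E) (q : E →ₗ[K] B) where
  σ : B →ₗ[K] E
  h : E →ₗ[K] E
  homogLin_σ : HomogLin B E σ 0
  homogLin_h : HomogLin E E h (-1)
  q_σ : q ∘ₗ σ = LinearMap.id
  q_h : q ∘ₗ h = 0
  h_h : h ∘ₗ h = 0
  h_σ : h ∘ₗ σ = 0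
  contract : ∀ x, q x = 0 → d (h x) + h (d x) = x

/-! ### Recursive construction of the nonlinear section -/

namespace Contraction

open Fam GMod

variable {K : Type u} [Field K] [CharZero K] {E : GMod.{u, v} K} {B : GMod.{u, w} K}
  {lE : Fam E E} {lB : Fam B B} {q : E →ₗ[K] B} (𝔠 : Contraction lE.lin1 q)

/-- The corrected linear section. -/
def base : B →ₗ[K] E := 𝔠.σ - 𝔠.h ∘ₗ lE.lin1 ∘ₗ 𝔠.σ

/-- Approximations of the nonlinear section. -/
noncomputable def approx : ℕ → Fam B E
  | 0 => 0
  | n + 1 => lin 𝔠.base - post 𝔠.h (comp (lE - lin lE.lin1) (approx n))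

omit [CharZero K] in
theorem _root_.Fam.sub_lin_lin1_one {V : GMod.{u, v} K} {W : GMod.{u, w} K} (F : Fam V W) :
    (F - lin F.lin1).f 1 = 0 := by
  refine MultilinearMap.ext fun a => ?_
  refine sub_eq_zero.mpr ((congrArg (F.f 1) (funext fun i => ?_)).trans (lin_one F.lin1 a).symm)
  rw [Subsingleton.elim i 0]

-- The nonlinear part in arity `k` reads only components of lower arity, so each iteration makes one
-- more arity final.
omit [CharZero K] in
theorem approx_stable (n k : ℕ) (hk : k ≤ n) : (𝔠.approx (n + 1)).f k = (𝔠.approx (k + 1)).f k := by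
  induction n generalizing k with
  | zero => rw [Nat.le_zero.mp hk]
  | succ n ih =>
    rcases hk.eq_or_lt with rfl | hk
    · rfl
    have step : ∀ m j, j ≤ m → (𝔠.approx (m + 2)).f j = (𝔠.approx (m + 1)).f j := by
      intro m
      induction m with
      | zero =>
        intro j hj
        obtain rfl := Nat.le_zero.mp hj
        rw [(𝔠.approx _).zero, (𝔠.approx _).zero]
      | succ m ihm =>
        intro j hj
        change (lin 𝔠.base).f j - 𝔠.h.compMultilinearMap ((comp _ (𝔠.approx (m + 2))).f j) =
          (lin 𝔠.base).f j - 𝔠.h.compMultilinearMap ((comp _ (𝔠.approx (m + 1))).f j)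
        rw [comp_f_congr lE.sub_lin_lin1_one fun i hi => ihm i (by omega)]
    rw [step n k (by omega), ih k (by omega)]

/-- The nonlinear section. -/
noncomputable def sect : Fam B E where
  f k := (𝔠.approx (k + 1)).f k
  symm k := (𝔠.approx (k + 1)).symm k
  zero := (𝔠.approx 1).zero

omit [CharZero K] in
theorem sect_eq : 𝔠.sect = lin 𝔠.base - post 𝔠.h (comp (lE - lin lE.lin1) 𝔠.sect) := by
  refine Fam.ext (funext fun k => ?_)
  change (lin 𝔠.base).f k - 𝔠.h.compMultilinearMap ((comp _ (𝔠.approx k)).f k) =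
    (lin 𝔠.base).f k - 𝔠.h.compMultilinearMap ((comp _ 𝔠.sect).f k)
  rw [comp_f_congr lE.sub_lin_lin1_one fun j hj => ?_]
  obtain ⟨k, rfl⟩ := Nat.exists_eq_succ_of_ne_zero (Nat.ne_zero_of_lt hj)
  exact 𝔠.approx_stable k j (by omega)

omit [CharZero K] in
theorem homogLin_base (hE : lE.Homog 1) : HomogLin B E 𝔠.base 0 :=
  𝔠.homogLin_σ.sub (𝔠.homogLin_h.comp (hE.lin1.comp 𝔠.homogLin_σ rfl) (by ring))

omit [CharZero K] in
theorem homog_sect (hE : lE.Homog 1) : 𝔠.sect.Homog 0 := by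
  have h : ∀ n, (𝔠.approx n).Homog 0 := by
    intro n
    induction n with
    | zero => exact zero_homog 0
    | succ n ih =>
      exact (homog_lin (𝔠.homogLin_base hE)).sub
        (((hE.sub (homog_lin hE.lin1)).comp ih).post 𝔠.homogLin_h (by ring))
  exact fun k => h (k + 1) k

section Points

variable {𝔸 : PointAlg.{u} K} {v : 𝔸.A ⊗[K] B}

theorem val_sect (hE : lE.Homog 1) (hv : v ∈ 𝔸.pts B 0) : 𝔠.sect.val v = 𝔠.base.lTensor 𝔸.A v -
    𝔠.h.lTensor 𝔸.A (lE.val (𝔠.sect.val v) - lE.lin1.lTensor 𝔸.A (𝔠.sect.val v)) := by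
  conv_lhs => rw [𝔠.sect_eq]
  rw [val_sub, val_lin _ hv, val_post, val_comp _ _ (𝔠.homog_sect hE) hv, val_sub,
    val_lin _ (val_mem (𝔠.homog_sect hE) hv)]

omit [CharZero K] in
theorem q_base : q ∘ₗ 𝔠.base = LinearMap.id := by
  rw [base, LinearMap.comp_sub, 𝔠.q_σ, ← LinearMap.comp_assoc, 𝔠.q_h, LinearMap.zero_comp, sub_zero]

omit [CharZero K] in
theorem h_base : 𝔠.h ∘ₗ 𝔠.base = 0 := by
  rw [base, LinearMap.comp_sub, 𝔠.h_σ, ← LinearMap.comp_assoc, 𝔠.h_h, LinearMap.zero_comp, sub_zero]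

-- Apply the contraction identity to `h x`, which lies in the kernel of `q`, and use `h² = 0`.
omit [CharZero K] in
theorem h_d_h : 𝔠.h ∘ₗ lE.lin1 ∘ₗ 𝔠.h = 𝔠.h := by
  refine LinearMap.ext fun x => ?_
  have h1 := 𝔠.contract (𝔠.h x) (LinearMap.congr_fun 𝔠.q_h x)
  have h2 : 𝔠.h (𝔠.h x) = 0 := LinearMap.congr_fun 𝔠.h_h x
  rw [h2, map_zero, zero_add] at h1
  exact h1

-- The correction `h d σ` in `base` serves this purpose: `h d h = h` makes the two terms cancel.
omit [CharZero K] in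
theorem h_d_base : 𝔠.h ∘ₗ lE.lin1 ∘ₗ 𝔠.base = 0 := by
  have : 𝔠.h ∘ₗ lE.lin1 ∘ₗ 𝔠.base =
      𝔠.h ∘ₗ lE.lin1 ∘ₗ 𝔠.σ - (𝔠.h ∘ₗ lE.lin1 ∘ₗ 𝔠.h) ∘ₗ lE.lin1 ∘ₗ 𝔠.σ := by
    rw [base, LinearMap.comp_sub, LinearMap.comp_sub]; rfl
  rw [this, h_d_h, sub_self]

theorem post_q_sect (hE : lE.Homog 1) : post q 𝔠.sect = lin LinearMap.id := by
  refine eq_of_val fun 𝔸 v hv => ?_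
  rw [val_post, 𝔠.val_sect hE hv, map_sub, LinearMap.lTensor_of_comp_eq_id 𝔠.q_base,
    LinearMap.lTensor_of_comp_eq_zero 𝔠.q_h, sub_zero, val_lin _ hv, LinearMap.lTensor_id]
  rfl

theorem post_h_sect (hE : lE.Homog 1) : post 𝔠.h 𝔠.sect = 0 := by
  refine eq_of_val fun 𝔸 v hv => ?_
  rw [val_post, 𝔠.val_sect hE hv, map_sub, LinearMap.lTensor_of_comp_eq_zero 𝔠.h_base,
    LinearMap.lTensor_of_comp_eq_zero 𝔠.h_h, sub_zero, val_zero]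

/-- The operations of `E` at points of the section are annihilated by the homotopy. -/
theorem h_val_sect (hE : lE.Homog 1) (hv : v ∈ 𝔸.pts B 0) :
    𝔠.h.lTensor 𝔸.A (lE.val (𝔠.sect.val v)) = 0 := by
  -- Apply `h d` to the fixed point equation. Since `h d base = 0` and `h d h = h`, what remains is
  -- `h d s = -h (l - d)(s)`, that is, `h l(s) = 0`.
  have h1 := congrArg (fun z => 𝔠.h.lTensor 𝔸.A (lE.lin1.lTensor 𝔸.A z)) (𝔠.val_sect hE hv)
  have e1 := fun z : 𝔸.A ⊗[K] E => congrArg (fun L : E →ₗ[K] E => L.lTensor 𝔸.A z) 𝔠.h_d_h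
  have e2 := fun z : 𝔸.A ⊗[K] B => congrArg (fun L : B →ₗ[K] E => L.lTensor 𝔸.A z) 𝔠.h_d_base
  simp only [LinearMap.lTensor_comp_apply, LinearMap.lTensor_zero, LinearMap.zero_apply] at e1 e2
  simp only [map_sub, e1, e2, zero_sub, neg_sub] at h1
  exact sub_eq_self.mp h1.symm

end Points

/-- The obstruction for the section to be a morphism. -/
noncomputable def defect (lB : Fam B B) : Fam B E := ins 𝔠.sect lB - comp lE 𝔠.sect

section Defect

variable {𝔸 : PointAlg.{u} K} {v : 𝔸.A ⊗[K] B}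

theorem val_defect (hE : lE.Homog 1) (hB : lB.Homog 1) (hv : v ∈ 𝔸.pts B 0) :
    (𝔠.defect lB).val v = 𝔠.sect.D v (lB.val v) - lE.val (𝔠.sect.val v) := by
  rw [defect, val_sub, val_ins _ _ hB hv, val_comp _ _ (𝔠.homog_sect hE) hv]

/-- Since `q` is strict and `q s = id`, both terms of the defect are sent to `lB(v)`. -/
theorem post_q_defect (hE : lE.Homog 1) (hB : lB.Homog 1)
    (hm : Mor lE lB (lin q)) : post q (𝔠.defect lB) = 0 := by
  refine eq_of_val fun 𝔸 v hv => ?_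
  have hs := val_mem (𝔠.homog_sect hE) hv
  have e : q.lTensor 𝔸.A (𝔠.sect.val v) = v := by
    rw [← val_post, 𝔠.post_q_sect hE, val_lin _ hv, LinearMap.lTensor_id]; rfl
  rw [val_post, 𝔠.val_defect hE hB hv, map_sub, ← D_post, 𝔠.post_q_sect hE, D_lin,
    hm.lin_val hE hs, e, LinearMap.lTensor_id, LinearMap.id_apply, sub_self, val_zero]

theorem post_h_defect (hE : lE.Homog 1) (hB : lB.Homog 1) : post 𝔠.h (𝔠.defect lB) = 0 := by
  refine eq_of_val fun 𝔸 v hv => ?_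
  rw [val_post, 𝔠.val_defect hE hB hv, map_sub, ← D_post, 𝔠.post_h_sect hE, D_zero,
    𝔠.h_val_sect hE hv, val_zero, LinearMap.zero_apply, sub_zero]

/-- A Bianchi identity: differentiate `h l(s(v)) = 0` in the direction `lB(v)`, and subtract
`Dl(s)[l(s)] = 0`, the structure equation of `E`. -/
theorem lmul_h_D_defect (hE : lE.Codiff) (hB : lB.Homog 1) (hv : v ∈ 𝔸.pts B 0) :
    lmul E 𝔸.η (𝔠.h.lTensor 𝔸.A (lE.D (𝔠.sect.val v) ((𝔠.defect lB).val v))) = 0 := by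
  have hs := 𝔠.homog_sect hE.homog
  have hl := val_mem hB hv
  have hD : 𝔠.sect.D v (lB.val v) ∈ 𝔸.pts E 1 := D_mem hs hv hl (by ring)
  have h1 := 𝔠.h_val_sect hE.homog (add_mem hv (lmul_mem_pts 𝔸.η_mem hl (by ring)))
  rw [val_add_lmul _ 𝔸.η_mem 𝔸.η_mul_η hv hl, val_add_lmul _ 𝔸.η_mem 𝔸.η_mul_η (val_mem hs hv) hD,
    map_add, 𝔠.h_val_sect hE.homog hv, zero_add, lTensor_lmul] at h1
  rw [𝔠.val_defect hE.homog hB hv, map_sub (lE.D _), hE.D_val (val_mem hs hv), sub_zero, h1]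

end Defect

/-- In the lowest arity where the defect could be nonzero, the Bianchi identity reads `h d (defect)
= 0`. As `q` and `h` also kill the defect, the contraction identity shows that it vanishes. -/
theorem defect_eq_zero (hE : lE.Codiff) (hB : lB.Homog 1)
    (hm : Mor lE lB (lin q)) : 𝔠.defect lB = 0 := by
  have key : ∀ n, (𝔠.defect lB).f n = 0 := by
    intro n
    induction n using Nat.strong_induction_on with
    | _ n ih =>
      refine B.multilinear_ext fun d a ha => ?_
      have h1 := 𝔠.lmul_h_D_defect hE hB (univPt_mem ha)
      rw [val_univPt _ ha ih, D_univAnn _ (val_univPt_mem _ d a), LinearMap.lTensor_tmul] at h1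
      have h2 := eq_zero_of_univGen (K := K) (W := E) d (PointAlg.top_of_η h1)
      have h3 : 𝔠.h ((𝔠.defect lB).f n a) = 0 :=
        congrArg (fun F : Fam B E => F.f n a) (𝔠.post_h_defect hE.homog hB)
      have h4 : q ((𝔠.defect lB).f n a) = 0 :=
        congrArg (fun F : Fam B B => F.f n a) (𝔠.post_q_defect hE.homog hB hm)
      have h5 := 𝔠.contract _ h4
      rw [h2, h3, map_zero, add_zero] at h5
      exact h5.symm
  exact Fam.ext (funext key)

theorem mor_sect (hE : lE.Codiff) (hB : lB.Homog 1)
    (hm : Mor lE lB (lin q)) : Mor lB lE 𝔠.sect := by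
  refine mor_of_top hB (𝔠.homog_sect hE.homog) fun 𝔸 v hv => ?_
  rw [← 𝔠.val_defect hE.homog hB hv, 𝔠.defect_eq_zero hE hB hm, val_zero, map_zero]

end Contraction

/-! ### Existence of contractions -/

theorem LinearMap.exists_section_on_range {K A C : Type*} [Field K] [AddCommGroup A] [Module K A]
    [AddCommGroup C] [Module K C] (f : A →ₗ[K] C) :
    ∃ g : C →ₗ[K] A, ∀ x, f (g (f x)) = f x := by
  obtain ⟨g₀, hg₀⟩ := f.rangeRestrict.exists_rightInverse_of_surjective
    (LinearMap.range_eq_top.mpr f.surjective_rangeRestrict)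
  obtain ⟨g, hg⟩ := g₀.exists_extend
  refine ⟨g, fun x => ?_⟩
  have h1 : g (f x) = g₀ (f.rangeRestrict x) := LinearMap.congr_fun hg (f.rangeRestrict x)
  rw [h1]
  exact congrArg Subtype.val (LinearMap.congr_fun hg₀ (f.rangeRestrict x))

namespace GMod

variable {K : Type u} [Field K] {V : GMod.{u, v} K} {W : GMod.{u, w} K}

/-- A homogeneous right inverse on a graded subspace of a homogeneous linear map. -/
theorem exists_homogLin_section {L : V →ₗ[K] W} {p : ℤ} {S : Submodule K V} {R : Submodule K W}
    (hR : ∀ n, ∀ y ∈ R, W.proj n y ∈ R)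
    (h : ∀ n, ∀ y ∈ W.deg n, y ∈ R → ∃ x ∈ V.deg (n - p), x ∈ S ∧ L x = y) :
    ∃ M : W →ₗ[K] V, HomogLin W V M (-p) ∧ (∀ y, M y ∈ S) ∧ ∀ y ∈ R, L (M y) = y := by
  have key : ∀ n, ∃ M : W →ₗ[K] (V.deg (n - p) ⊓ S : Submodule K V),
      ∀ y ∈ W.deg n, y ∈ R → L (M y) = y := fun n => by
    obtain ⟨M, hM⟩ := LinearMap.exists_section_on_range
      (L ∘ₗ (V.deg (n - p) ⊓ S : Submodule K V).subtype)
    refine ⟨M, fun y hy hyR => ?_⟩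
    obtain ⟨x, hx, hxS, rfl⟩ := h n y hy hyR
    exact hM ⟨x, hx, hxS⟩
  choose M hM using key
  let N : W →ₗ[K] V := W.lift fun n => Submodule.subtype _ ∘ₗ M n ∘ₗ Submodule.subtype _
  have hN : ∀ n, ∀ y ∈ W.deg n, N y = M n y := fun n y hy => W.lift_of_mem _ hy
  refine ⟨N, fun n y hy => ?_, fun y => ?_, fun y hy => ?_⟩
  · rw [hN n y hy, ← sub_eq_add_neg]
    exact (M n y).2.1
  · obtain ⟨s, hs⟩ := W.exists_sum_proj y
    rw [hs, map_sum]
    refine Submodule.sum_mem _ fun n _ => ?_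
    rw [hN n _ (W.proj_mem n y)]
    exact (M n _).2.2
  · obtain ⟨s, hs⟩ := W.exists_sum_proj y
    rw [hs, map_sum, map_sum]
    refine Finset.sum_congr rfl fun n _ => ?_
    rw [hN n _ (W.proj_mem n y), hM n _ (W.proj_mem n y) (hR n y hy)]

/-- Choose a homogeneous section `σ` of `q` and a homogeneous `g` providing primitives of cycles in
`ker q`, and put `h = g (1 - g d)(1 - σ q)`. The last factor projects to `ker q` and gives `h σ =
0`. On `ker q` the middle factor produces cycles, so `d h = 1 - g d` there, which yields both `h² =
0` and the contraction identity. -/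
theorem exists_contraction {E : GMod.{u, v} K} {B : GMod.{u, w} K} {d : E →ₗ[K] E} {q : E →ₗ[K] B}
    (hd : HomogLin E E d 1) (hq : HomogLin E B q 0) (hdd : ∀ x, d (d x) = 0)
    (hdq : ∀ x, q x = 0 → q (d x) = 0) (hsurj : ∀ y, ∃ x, q x = y)
    (hac : ∀ x, q x = 0 → d x = 0 → ∃ y, q y = 0 ∧ d y = x) : Nonempty (Contraction d q) := by
  obtain ⟨σ, hσ, -, hqσ⟩ := exists_homogLin_section (V := E) (W := B) (L := q) (p := 0) (S := ⊤)
    (R := ⊤) (fun _ _ _ => trivial) fun n y hy _ => by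
      obtain ⟨x, rfl⟩ := hsurj y
      refine ⟨E.proj n x, by simpa using E.proj_mem n x, trivial, ?_⟩
      rw [hq.map_proj, add_zero, B.proj_of_mem hy]
  obtain ⟨g, hg, hgS, hdg⟩ := exists_homogLin_section (V := E) (W := E) (L := d) (p := 1)
    (S := LinearMap.ker q) (R := LinearMap.ker q ⊓ LinearMap.ker d) (fun n y hy => by
      refine Submodule.mem_inf.mpr ⟨?_, ?_⟩
      · rw [LinearMap.mem_ker, hq.map_proj, LinearMap.mem_ker.mp hy.1, map_zero]
      · rw [LinearMap.mem_ker, hd.map_proj, LinearMap.mem_ker.mp hy.2, map_zero]) fun n y hy hyR => by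
      obtain ⟨x, hx, rfl⟩ := hac y hyR.1 hyR.2
      refine ⟨E.proj (n - 1) x, E.proj_mem _ x, ?_, ?_⟩
      · rw [LinearMap.mem_ker, hq.map_proj, hx, map_zero]
      · rw [hd.map_proj, sub_add_cancel, E.proj_of_mem hy]
  have hqσ' : ∀ y, q (σ y) = y := fun y => hqσ y trivial
  have hqg : ∀ y, q (g y) = 0 := fun y => hgS y
  have hdg' : ∀ y, q y = 0 → d y = 0 → d (g y) = y := fun y h1 h2 => hdg y ⟨h1, h2⟩
  have hF : ∀ x, q x = 0 → d (g (x - g (d x))) = x - g (d x) := fun x hx => by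
    refine hdg' _ ?_ ?_
    · rw [map_sub, hx, hqg, sub_zero]
    · rw [map_sub, hdg' _ (hdq x hx) (hdd x), sub_self]
  have hh : ∀ x, q x = 0 → (g ∘ₗ (LinearMap.id - g ∘ₗ d) ∘ₗ (LinearMap.id - σ ∘ₗ q)) x =
      g (x - g (d x)) := fun x hx => by
    simp only [LinearMap.comp_apply, LinearMap.sub_apply, LinearMap.id_apply, hx, map_zero, sub_zero]
  refine ⟨⟨σ, g ∘ₗ (LinearMap.id - g ∘ₗ d) ∘ₗ (LinearMap.id - σ ∘ₗ q), by simpa using hσ, ?_, ?_, ?_,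
    ?_, ?_, ?_⟩⟩
  · refine hg.comp ((E.homogLin_id.sub (hg.comp hd (by ring))).comp
      (E.homogLin_id.sub (HomogLin.comp (by simpa using hσ) hq rfl)) rfl) (by ring)
  · exact LinearMap.ext hqσ'
  · exact LinearMap.ext fun x => hqg _
  · refine LinearMap.ext fun x => ?_
    refine (hh _ (hqg _)).trans ?_
    obtain ⟨y, hy⟩ : ∃ y, y = x - σ (q x) := ⟨_, rfl⟩
    have hqy : q y = 0 := by rw [hy, map_sub, hqσ', sub_self]
    change g (g (x - σ (q x) - g (d (x - σ (q x)))) - g (d (g (x - σ (q x) -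
      g (d (x - σ (q x))))))) = 0
    rw [← hy, hF y hqy, sub_self, map_zero]
  · refine LinearMap.ext fun x => ?_
    simp only [LinearMap.comp_apply, LinearMap.sub_apply, LinearMap.id_apply, hqσ', sub_self,
      map_zero, LinearMap.zero_apply]
  · intro x hx
    rw [hh x hx, hh _ (hdq x hx), hF x hx, hdd, map_zero, sub_zero, sub_add_cancel]

end GMod

/-! ### Quasi-isomorphisms -/

theorem LInftyChainMap.isQuasiIso_iff {K : Type u} [Field K] {C : LInftyAlgebra.{u, v} K}
    {C' : LInftyAlgebra.{u, w} K} (φ : LInftyChainMap C C') : φ.IsQuasiIso ↔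
      (∀ x, C.d x = 0 → ∀ y, C'.d y = φ.toLinearMap x → ∃ z, C.d z = x) ∧
      ∀ y, C'.d y = 0 → ∃ x z, C.d x = 0 ∧ y = φ.toLinearMap x + C'.d z := by
  refine and_congr ?_ ?_
  · rw [injective_iff_map_eq_zero]
    constructor
    · intro h x hx y hy
      have := h (Submodule.Quotient.mk ⟨x, hx⟩)
        ((Submodule.Quotient.mk_eq_zero _).mpr ⟨y, hy⟩)
      exact (Submodule.Quotient.mk_eq_zero _).mp this
    · intro h z hz
      obtain ⟨⟨x, hx⟩, rfl⟩ := Submodule.Quotient.mk_surjective _ z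
      obtain ⟨y, hy⟩ := (Submodule.Quotient.mk_eq_zero _).mp hz
      exact (Submodule.Quotient.mk_eq_zero _).mpr (h x hx y hy)
  · constructor
    · intro h y hy
      obtain ⟨z, hz⟩ := h (Submodule.Quotient.mk ⟨y, hy⟩)
      obtain ⟨⟨x, hx⟩, rfl⟩ := Submodule.Quotient.mk_surjective _ z
      obtain ⟨w, hw⟩ := (Submodule.Quotient.eq _).mp hz
      refine ⟨x, -w, hx, ?_⟩
      rw [map_neg, hw]
      exact (sub_eq_iff_eq_add'.mp (by simp [LinearMap.restrict_apply]))
    · intro h z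
      obtain ⟨⟨y, hy⟩, rfl⟩ := Submodule.Quotient.mk_surjective _ z
      obtain ⟨x, w, hx, e⟩ := h y hy
      refine ⟨Submodule.Quotient.mk ⟨x, hx⟩, (Submodule.Quotient.eq _).mpr ⟨-w, ?_⟩⟩
      rw [map_neg, neg_eq_iff_add_eq_zero]
      change C'.d w + (φ.toLinearMap x - y) = 0
      rw [e]; abel

/-! ### The model of polynomial forms -/

section Model

variable {K : Type u} [Field K] [CharZero K]

open Fam GMod

/-- The Poincaré lemma on the interval. -/
theorem Fam.path_closed {V : GMod.{u, v} K} (l : Fam V V) {x : V.path} (hx : l.path.lin1 x = 0)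
    (τ : K) : ∃ z, x = V.pathMono 0 (V.pathEv τ x) + l.path.lin1 z := by
  obtain ⟨p, r⟩ := x
  rw [lin1_path] at hx
  have hr : V.deriv p = V.polyMap l.lin1 r := sub_eq_zero.mp (congrArg Prod.snd hx)
  -- The primitive is the function `∫_τ^t r`, without a `dt` part.
  refine ⟨((V.integ r - V.mono 0 (V.ev τ (V.integ r)), 0) : V.poly × V.poly), ?_⟩
  rw [lin1_path]
  refine Prod.ext ?_ ?_
  · change p = V.mono 0 (V.ev τ p) + V.polyMap l.lin1 _
    rw [map_sub, ← integ_polyMap, polyMap_mono, ← ev_polyMap V l.lin1, ← integ_polyMap, ← hr, integ_deriv,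
      map_sub, map_sub, ev_mono, pow_zero, one_smul]
    abel
  · change r = 0 + (V.deriv _ - V.polyMap l.lin1 0)
    rw [map_zero, sub_zero, zero_add, map_sub, deriv_integ, deriv_mono]
    simp

/-- The model of `Δ¹ × C` given by polynomial forms. -/
noncomputable def LInftyAlgebra.pathModel (C : LInftyAlgebra.{u, v} K) : LInftyModel C where
  alg := C.fam_codiff.path.alg
  eval j := Fam.Mor.hom (C := C.fam_codiff.path.alg) (mor_pathEv C.fam_homog ((j : ℕ) : K))
  incl :=
    { toLinearMap := C.toGMod.pathMono 0
      map_mem := fun n x hx => by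
        have := C.toGMod.homogLin_pathMono 0 n x hx
        rwa [add_zero] at this
      comm := (mor_pathMono_zero C.fam_homog).lin1_comm C.fam_homog }
  eval_isQuasiIso j := by
    refine (LInftyChainMap.isQuasiIso_iff _).mpr ⟨fun x hx y hy => ?_, fun y hy => ?_⟩
    -- A closed form is cohomologous to the constant form on its value at the chosen endpoint; a
    -- primitive of that value gives a primitive of the form.
    · obtain ⟨z, hz⟩ := C.fam.path_closed hx ((j : ℕ) : K)
      refine ⟨C.toGMod.pathMono 0 y + z, ?_⟩
      refine (map_add C.fam.path.lin1 _ _).trans ?_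
      refine (congrArg (fun w : C.toGMod.path => w + C.fam.path.lin1 z)
        ((mor_pathMono_zero C.fam_homog).lin1_comm C.fam_homog y).symm).trans ?_
      exact (congrArg (fun w : C => (C.toGMod.pathMono 0 w + C.fam.path.lin1 z : C.toGMod.path))
        hy).trans hz.symm
    · refine ⟨C.toGMod.pathMono 0 y, 0, ?_, ?_⟩
      · refine ((mor_pathMono_zero C.fam_homog).lin1_comm C.fam_homog y).symm.trans ?_
        exact (congrArg (C.toGMod.pathMono 0) hy).trans (map_zero _)
      · rw [map_zero, add_zero]
        refine Eq.symm ((C.toGMod.ev_mono _ 0 y).trans ?_)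
        rw [pow_zero, one_smul]
  incl_isQuasiIso := by
    refine (LInftyChainMap.isQuasiIso_iff _).mpr ⟨fun x hx y hy => ?_, fun y hy => ?_⟩
    · refine ⟨C.toGMod.pathEv 0 y, ?_⟩
      refine ((mor_pathEv C.fam_homog 0).lin1_comm C.fam_homog.path y).symm.trans ?_
      refine (congrArg (C.toGMod.pathEv 0) hy).trans ((C.toGMod.ev_mono 0 0 x).trans ?_)
      rw [pow_zero, one_smul]
    · obtain ⟨z, hz⟩ := C.fam.path_closed hy 0
      refine ⟨C.toGMod.pathEv 0 y, z, ?_, hz⟩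
      refine ((mor_pathEv C.fam_homog 0).lin1_comm C.fam_homog.path y).symm.trans ?_
      exact (congrArg (C.toGMod.pathEv 0) hy).trans (map_zero _)
  eval_incl j x := (C.toGMod.ev_mono _ 0 x).trans (by rw [pow_zero, one_smul])
  surjective := by
    rintro ⟨a, b⟩
    -- The linear path `(1 - t) a + t b` has the prescribed endpoints.
    refine ⟨C.toGMod.seg₀ a + C.toGMod.seg₁ b, Prod.ext ?_ ?_⟩
    · change C.toGMod.pathEv ((0 : ℕ) : K) (C.toGMod.seg₀ a + C.toGMod.seg₁ b) = a
      rw [Nat.cast_zero, map_add]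
      exact (congrArg₂ (· + ·) (LinearMap.congr_fun C.toGMod.pathEv_zero_seg₀ a)
        (LinearMap.congr_fun C.toGMod.pathEv_zero_seg₁ b)).trans (add_zero a)
    · change C.toGMod.pathEv ((1 : ℕ) : K) (C.toGMod.seg₀ a + C.toGMod.seg₁ b) = b
      rw [Nat.cast_one, map_add]
      exact (congrArg₂ (· + ·) (LinearMap.congr_fun C.toGMod.pathEv_one_seg₀ a)
        (LinearMap.congr_fun C.toGMod.pathEv_one_seg₁ b)).trans (zero_add b)

/-- A morphism to polynomial forms is a homotopy between its endpoints. -/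
theorem LInftyHom.homotopic_of_mor {C : LInftyAlgebra.{u, v} K} {C' : LInftyAlgebra.{u, w} K}
    {f g : LInftyHom C C'} {H : Fam C.toGMod C'.toGMod.path} (hH : Mor C.fam C'.fam.path H)
    (h0 : post (C'.toGMod.pathEv 0) H = f.fam) (h1 : post (C'.toGMod.pathEv 1) H = g.fam) :
    f.Homotopic g := by
  have e : ∀ τ : K, comp (lin (C'.toGMod.pathEv τ)) H = post (C'.toGMod.pathEv τ) H := fun τ =>
    eq_of_val fun 𝔸 v hv => by
      rw [val_comp _ _ hH.homog hv, val_lin _ (val_mem hH.homog hv), val_post]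
  refine ⟨C'.pathModel, Fam.Mor.hom (C' := C'.fam_codiff.path.alg) hH, isComp_of_fam ?_,
    isComp_of_fam ?_⟩
  · change f.fam = comp (lin (C'.toGMod.pathEv ((0 : ℕ) : K))) H
    rw [e, Nat.cast_zero, h0]
  · change g.fam = comp (lin (C'.toGMod.pathEv ((1 : ℕ) : K))) H
    rw [e, Nat.cast_one, h1]

end Model

/-! ### Linear components of the space of paths -/

namespace PathData

open GMod Fam

variable {K : Type u} [Field K] [CharZero K] (𝔇 : PathData.{u, v, w, x} K)

omit [CharZero K] in
theorem _root_.GMod.seg₀_add_seg₁_apply (V : GMod.{u, v} K) (x : V) :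
    V.seg₀ x + V.seg₁ x = V.pathMono 0 x := sub_add_cancel (V.pathMono 0 x) (V.pathMono 1 x)

omit [CharZero K] in
theorem q_φ₁ (z : 𝔇.Z) : 𝔇.q (𝔇.φ₁.lin1 z) = 𝔇.q (𝔇.φ₀.lin1 z) :=
  (LinearMap.congr_fun (congrArg Fam.lin1 𝔇.post_eq) z).symm

omit [CharZero K] in
theorem path_lin1_apply (x : 𝔇.total) : 𝔇.path.lin1 x = 𝔇.X.seg₀ (𝔇.φ₀.lin1 (𝔇.toZ x)) +
    𝔇.X.seg₁ (𝔇.φ₁.lin1 (𝔇.toZ x)) + 𝔇.toLoop x := rfl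

omit [CharZero K] in
theorem pathEv_zero_path_lin1 (x : 𝔇.total) :
    𝔇.X.pathEv 0 (𝔇.path.lin1 x) = 𝔇.φ₀.lin1 (𝔇.toZ x) := by
  have h1 := LinearMap.congr_fun 𝔇.X.pathEv_zero_seg₀
  have h2 := LinearMap.congr_fun 𝔇.X.pathEv_zero_seg₁
  have h3 := LinearMap.congr_fun 𝔇.pathEv_zero_toLoop
  simp only [LinearMap.comp_apply, LinearMap.id_apply, LinearMap.zero_apply] at h1 h2 h3
  rw [path_lin1_apply, map_add, map_add, h1, h2, h3, add_zero, add_zero]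

omit [CharZero K] in
theorem pathEv_one_path_lin1 (x : 𝔇.total) :
    𝔇.X.pathEv 1 (𝔇.path.lin1 x) = 𝔇.φ₁.lin1 (𝔇.toZ x) := by
  have h1 := LinearMap.congr_fun 𝔇.X.pathEv_one_seg₀
  have h2 := LinearMap.congr_fun 𝔇.X.pathEv_one_seg₁
  have h3 := LinearMap.congr_fun 𝔇.pathEv_one_toLoop
  simp only [LinearMap.comp_apply, LinearMap.id_apply, LinearMap.zero_apply] at h1 h2 h3
  rw [path_lin1_apply, map_add, map_add, h1, h2, h3, add_zero, zero_add]

omit [CharZero K] in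
theorem pathMap_path_lin1 (x : 𝔇.total) :
    𝔇.X.pathMap 𝔇.q (𝔇.path.lin1 x) = 𝔇.B.pathMono 0 (𝔇.q (𝔇.φ₀.lin1 (𝔇.toZ x))) := by
  have h1 := LinearMap.congr_fun (𝔇.X.pathMap_seg₀ 𝔇.q)
  have h2 := LinearMap.congr_fun (𝔇.X.pathMap_seg₁ 𝔇.q)
  have h3 := LinearMap.congr_fun 𝔇.pathMap_toLoop
  simp only [LinearMap.comp_apply, LinearMap.zero_apply] at h1 h2 h3
  rw [path_lin1_apply, map_add, map_add, h1, h2, h3, add_zero, q_φ₁, seg₀_add_seg₁_apply]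

-- A path with the right endpoints and image in `B` differs from the linear interpolation by a loop.
-- Together with `eq_of_path_lin1`, this lets acyclicity be checked on actual paths instead of on
-- loop coordinates.
omit [CharZero K] in
theorem exists_total {z : 𝔇.Z} {w : 𝔇.X.path} (h0 : 𝔇.X.pathEv 0 w = 𝔇.φ₀.lin1 z)
    (h1 : 𝔇.X.pathEv 1 w = 𝔇.φ₁.lin1 z)
    (hq : 𝔇.X.pathMap 𝔇.q w = 𝔇.B.pathMono 0 (𝔇.q (𝔇.φ₀.lin1 z))) :
    ∃ e, 𝔇.toZ e = z ∧ 𝔇.path.lin1 e = w := by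
  let e₀ : 𝔇.total := 𝔇.Z.prodInl 𝔇.loops z
  have e₀Z : 𝔇.toZ e₀ = z := rfl
  have k0 := 𝔇.pathEv_zero_path_lin1 e₀
  have k1 := 𝔇.pathEv_one_path_lin1 e₀
  have kq := 𝔇.pathMap_path_lin1 e₀
  rw [e₀Z] at k0 k1 kq
  have hw : 𝔇.cond (w - 𝔇.path.lin1 e₀) = 0 := by
    refine Prod.ext (Prod.ext ?_ ?_) ?_
    · change 𝔇.X.pathEv 0 _ = 0
      rw [map_sub, h0, k0, sub_self]
    · change 𝔇.X.pathEv 1 _ = 0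
      rw [map_sub, h1, k1, sub_self]
    · change 𝔇.X.pathMap 𝔇.q _ = 0
      rw [map_sub, hq, kq, sub_self]
  let e₁ : 𝔇.total := 𝔇.Z.prodInr 𝔇.loops (⟨w - 𝔇.path.lin1 e₀, hw⟩ : LinearMap.ker 𝔇.cond)
  have e₁Z : 𝔇.toZ e₁ = 0 := rfl
  have e₁L : 𝔇.toLoop e₁ = w - 𝔇.path.lin1 e₀ := rfl
  refine ⟨e₀ + e₁, ?_, ?_⟩
  · rw [map_add, e₀Z, e₁Z, add_zero]
  · rw [map_add, 𝔇.path_lin1_apply e₁, e₁L, e₁Z]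
    simp only [map_zero, zero_add, add_sub_cancel]

omit [CharZero K] in
theorem eq_of_path_lin1 {x y : 𝔇.total} (h1 : 𝔇.toZ x = 𝔇.toZ y)
    (h2 : 𝔇.path.lin1 x = 𝔇.path.lin1 y) : x = y := by
  rw [path_lin1_apply, path_lin1_apply, h1, add_right_inj] at h2
  exact Prod.ext h1 (kerIncl_injective _ _ h2)

end PathData

namespace Fam

open GMod

section

variable {K : Type u} [Field K] [CharZero K] {V : GMod.{u, v} K} {W : GMod.{u, w} K}
  {X : GMod.{u, x} K}

theorem comp_lin_eq_post {F : Fam V W} (hF : F.Homog 0) (L : W →ₗ[K] X) :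
    comp (lin L) F = post L F :=
  eq_of_val fun 𝔸 v hv => by rw [val_comp _ _ hF hv, val_lin _ (val_mem hF hv), val_post]

theorem comp_lin_eq_pre (F : Fam W X) {L : V →ₗ[K] W} (hL : HomogLin V W L 0) :
    comp F (lin L) = pre F L hL :=
  eq_of_val fun 𝔸 v hv => by rw [val_comp _ _ (homog_lin hL) hv, val_lin _ hv, val_pre]

theorem post_lin {L : V →ₗ[K] W} (M : W →ₗ[K] X) : post M (lin L) = lin (M ∘ₗ L) :=
  eq_of_val fun 𝔸 v hv => by
    rw [val_post, val_lin _ hv, val_lin _ hv, LinearMap.lTensor_comp_apply]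

variable {lV : Fam V V} {lW : Fam W W} {lX : Fam X X}

theorem Mor.post {L : W →ₗ[K] X} {F : Fam V W} (hV : lV.Homog 1)
    (h : Mor lW lX (lin L)) (hF : Mor lV lW F) : Mor lV lX (Fam.post L F) := by
  rw [← comp_lin_eq_post hF.homog]
  exact h.comp hV hF

end

end Fam

/-! ### The mapping path space -/

section MappingPath

open GMod Fam

variable {K : Type u} [Field K] [CharZero K] {V₁ : GMod.{u, v} K} {V₂ : GMod.{u, w} K}
  {l₁ : Fam V₁ V₁} {l₂ : Fam V₂ V₂} {φ : Fam V₁ V₂}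

omit [CharZero K] in
theorem GMod.polyMap_zero {V : GMod.{u, v} K} {W : GMod.{u, w} K} :
    V.polyMap (0 : V →ₗ[K] W) = 0 :=
  V.poly_linearMap_ext fun i x => by rw [polyMap_mono]; simp

omit [CharZero K] in
theorem GMod.pathMap_zero {V : GMod.{u, v} K} {W : GMod.{u, w} K} :
    V.pathMap (0 : V →ₗ[K] W) = 0 := by
  rw [pathMap, polyMap_zero]; simp

omit [CharZero K] in
theorem Fam.fst_lin1_prod (x : V₁.prod V₂) :
    V₁.prodFst V₂ ((Fam.prod l₁ l₂).lin1 x) = l₁.lin1 (V₁.prodFst V₂ x) := add_zero _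

omit [CharZero K] in
theorem Fam.snd_lin1_prod (x : V₁.prod V₂) :
    V₁.prodSnd V₂ ((Fam.prod l₁ l₂).lin1 x) = l₂.lin1 (V₁.prodSnd V₂ x) := zero_add _

variable (h₁ : l₁.Codiff) (h₂ : l₂.Codiff) (hφ : Mor l₁ l₂ φ)

/-- The data of paths from `φ x` to `y`. -/
noncomputable abbrev mapPath : PathData.{u, max v w, w, w} K where
  Z := V₁.prod V₂
  X := V₂
  B := V₂
  lZ := Fam.prod l₁ l₂
  lX := l₂
  lB := l₂
  φ₀ := comp φ (lin (V₁.prodFst V₂))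
  φ₁ := lin (V₁.prodSnd V₂)
  -- The zero map imposes no condition over the base, so the choice of `B` is immaterial.
  q := 0
  hZ := h₁.prod h₂
  hX := h₂
  hB := h₂.homog
  hq := fun _ _ _ => zero_mem _
  mor_q := mor_zero h₂.homog
  mor₀ := hφ.comp (h₁.prod h₂).homog (mor_prodFst h₁.homog h₂.homog)
  mor₁ := mor_prodSnd h₁.homog h₂.homog
  post_eq := rfl

/-- The first projection of the mapping path space. -/
noncomputable def mapPathFst : (mapPath h₁ h₂ hφ).total →ₗ[K] V₁ :=
  V₁.prodFst V₂ ∘ₗ (mapPath h₁ h₂ hφ).toZ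

/-- The second projection of the mapping path space. -/
noncomputable def mapPathSnd : (mapPath h₁ h₂ hφ).total →ₗ[K] V₂ :=
  V₁.prodSnd V₂ ∘ₗ (mapPath h₁ h₂ hφ).toZ

theorem homogLin_mapPathFst :
    HomogLin (mapPath h₁ h₂ hφ).total V₁ (mapPathFst h₁ h₂ hφ) 0 :=
  homogLin_prodFst.comp (mapPath h₁ h₂ hφ).homogLin_toZ rfl

theorem homogLin_mapPathSnd :
    HomogLin (mapPath h₁ h₂ hφ).total V₂ (mapPathSnd h₁ h₂ hφ) 0 :=
  homogLin_prodSnd.comp (mapPath h₁ h₂ hφ).homogLin_toZ rfl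

theorem mor_mapPathFst : Mor (mapPath h₁ h₂ hφ).op l₁ (lin (mapPathFst h₁ h₂ hφ)) := by
  rw [mapPathFst, ← post_lin]
  exact (mor_prodFst h₁.homog h₂.homog).post (mapPath h₁ h₂ hφ).homog_op (mapPath h₁ h₂ hφ).mor_toZ

theorem mor_mapPathSnd : Mor (mapPath h₁ h₂ hφ).op l₂ (lin (mapPathSnd h₁ h₂ hφ)) := by
  rw [mapPathSnd, ← post_lin]
  exact (mor_prodSnd h₁.homog h₂.homog).post (mapPath h₁ h₂ hφ).homog_op (mapPath h₁ h₂ hφ).mor_toZ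

theorem pathEv_zero_mapPath : post (V₂.pathEv 0) (mapPath h₁ h₂ hφ).path =
    pre φ (mapPathFst h₁ h₂ hφ) (homogLin_mapPathFst h₁ h₂ hφ) := by
  refine eq_of_val fun 𝔸 x hx => ?_
  have hz := (mapPath h₁ h₂ hφ).toZ_mem hx
  rw [val_post, (mapPath h₁ h₂ hφ).pathEv_zero_val_path hx, val_pre, mapPathFst,
    LinearMap.lTensor_comp_apply, val_comp _ _ (homog_lin homogLin_prodFst) hz, val_lin _ hz]

theorem pathEv_one_mapPath : post (V₂.pathEv 1) (mapPath h₁ h₂ hφ).path =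
    lin (mapPathSnd h₁ h₂ hφ) := by
  refine eq_of_val fun 𝔸 x hx => ?_
  have hz := (mapPath h₁ h₂ hφ).toZ_mem hx
  rw [val_post, (mapPath h₁ h₂ hφ).pathEv_one_val_path hx, val_lin _ hz, val_lin _ hx, mapPathSnd,
    LinearMap.lTensor_comp_apply]

/-- The inclusion of the source into the mapping path space by constant paths. -/
noncomputable def mapPathIncl : Fam V₁ (mapPath h₁ h₂ hφ).total :=
  post ((V₁.prod V₂).prodInl (mapPath h₁ h₂ hφ).loops)
    (lin (V₁.prodInl V₂) + post (V₁.prodInr V₂) φ)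

theorem homog_mapPathIncl : (mapPathIncl h₁ h₂ hφ).Homog 0 :=
  ((homog_lin homogLin_prodInl).add (hφ.homog.post homogLin_prodInr rfl)).post homogLin_prodInl rfl

section

variable {𝔸 : PointAlg.{u} K} {c : 𝔸.A ⊗[K] V₁} (hc : c ∈ 𝔸.pts V₁ 0)
include hc

theorem toZ_val_mapPathIncl :
    (mapPath h₁ h₂ hφ).toZ.lTensor 𝔸.A ((mapPathIncl h₁ h₂ hφ).val c) =
      (V₁.prodInl V₂).lTensor 𝔸.A c + (V₁.prodInr V₂).lTensor 𝔸.A (φ.val c) := by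
  rw [mapPathIncl, val_post]
  refine (prodFst_prodInl _).trans ?_
  rw [val_add, val_lin _ hc, val_post]

omit hc in
theorem toLoop_val_mapPathIncl :
    (mapPath h₁ h₂ hφ).toLoop.lTensor 𝔸.A ((mapPathIncl h₁ h₂ hφ).val c) = 0 := by
  rw [mapPathIncl, val_post]
  exact LinearMap.lTensor_of_comp_eq_zero (LinearMap.ext fun x => map_zero (mapPath h₁ h₂ hφ).incl) _

theorem fst_val_mapPathIncl :
    (mapPathFst h₁ h₂ hφ).lTensor 𝔸.A ((mapPathIncl h₁ h₂ hφ).val c) = c := by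
  rw [mapPathFst, LinearMap.lTensor_comp_apply, toZ_val_mapPathIncl h₁ h₂ hφ hc, map_add,
    prodFst_prodInl, prodFst_prodInr, add_zero]

theorem snd_val_mapPathIncl :
    (mapPathSnd h₁ h₂ hφ).lTensor 𝔸.A ((mapPathIncl h₁ h₂ hφ).val c) = φ.val c := by
  rw [mapPathSnd, LinearMap.lTensor_comp_apply, toZ_val_mapPathIncl h₁ h₂ hφ hc, map_add,
    prodSnd_prodInl, prodSnd_prodInr, zero_add]

/-- The path in question is the constant one at `φ(c)`, since the two interpolation terms add up to
it. Constant paths are preserved by the operations, so no loop part appears. -/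
theorem loopOp_val_mapPathIncl :
    (mapPath h₁ h₂ hφ).loopOp.val ((mapPathIncl h₁ h₂ hφ).val c) = 0 := by
  have hi := val_mem (homog_mapPathIncl h₁ h₂ hφ) hc
  have hz := (mapPath h₁ h₂ hφ).toZ_mem hi
  have hφc := val_mem hφ.homog hc
  have e0 : (comp φ (lin (V₁.prodFst V₂))).val
      ((mapPath h₁ h₂ hφ).toZ.lTensor 𝔸.A ((mapPathIncl h₁ h₂ hφ).val c)) = φ.val c := by
    rw [val_comp _ _ (homog_lin homogLin_prodFst) hz, val_lin _ hz]
    refine congrArg φ.val (Eq.trans ?_ (fst_val_mapPathIncl h₁ h₂ hφ hc))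
    rw [mapPathFst, LinearMap.lTensor_comp_apply]
  have e1 : (lin (V₁.prodSnd V₂)).val
      ((mapPath h₁ h₂ hφ).toZ.lTensor 𝔸.A ((mapPathIncl h₁ h₂ hφ).val c)) = φ.val c := by
    rw [val_lin _ hz]
    refine Eq.trans ?_ (snd_val_mapPathIncl h₁ h₂ hφ hc)
    rw [mapPathSnd, LinearMap.lTensor_comp_apply]
  rw [(mapPath h₁ h₂ hφ).val_loopOp hi, (mapPath h₁ h₂ hφ).val_path hi, e0, e1,
    toLoop_val_mapPathIncl h₁ h₂ hφ, add_zero, seg₀_add_seg₁, seg₀_add_seg₁,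
    ← (mor_pathMono_zero h₂.homog).lin_val h₂.homog hφc, sub_self]

end

theorem mor_mapPathIncl : Mor l₁ (mapPath h₁ h₂ hφ).op (mapPathIncl h₁ h₂ hφ) := by
  refine ⟨homog_mapPathIncl h₁ h₂ hφ, fun 𝔸 c hc => ?_⟩
  have hc' := add_mem hc (lmul_mem_pts 𝔸.η_mem (val_mem h₁.homog hc) (by ring))
  refine (mapPath h₁ h₂ hφ).total_ext ?_ ?_
  · rw [toZ_val_mapPathIncl h₁ h₂ hφ hc', map_add ((mapPath h₁ h₂ hφ).toZ.lTensor 𝔸.A),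
      lTensor_lmul, PathData.toZ_val_op, toZ_val_mapPathIncl h₁ h₂ hφ hc, hφ.comm 𝔸 c hc]
    refine prod_ext ?_ ?_
    · simp only [map_add, lTensor_lmul, fst_val_prod, prodFst_prodInl, prodFst_prodInr, add_zero,
        map_zero]
    · simp only [map_add, lTensor_lmul, snd_val_prod, prodSnd_prodInl, prodSnd_prodInr, zero_add,
        map_zero]
  · rw [toLoop_val_mapPathIncl h₁ h₂ hφ, map_add ((mapPath h₁ h₂ hφ).toLoop.lTensor 𝔸.A),
      lTensor_lmul, PathData.toLoop_val_op, toLoop_val_mapPathIncl h₁ h₂ hφ,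
      loopOp_val_mapPathIncl h₁ h₂ hφ hc, map_zero, add_zero]

/-- The second projection of the mapping path space of a quasi-isomorphism is contractible. -/
theorem mapPath_contraction (hinj : ∀ x, l₁.lin1 x = 0 → ∀ y, l₂.lin1 y = φ.lin1 x →
      ∃ z, l₁.lin1 z = x)
    (hsurj : ∀ y, l₂.lin1 y = 0 → ∃ x z, l₁.lin1 x = 0 ∧ y = φ.lin1 x + l₂.lin1 z) :
    Nonempty (Contraction (mapPath h₁ h₂ hφ).op.lin1 (mapPathSnd h₁ h₂ hφ)) := by
  have hcodiff := (mapPath h₁ h₂ hφ).codiff_op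
  have hφ0 : ∀ z : V₁.prod V₂, (comp φ (lin (V₁.prodFst V₂))).lin1 z = φ.lin1 (V₁.prodFst V₂ z) :=
    fun z => LinearMap.congr_fun (lin1_comp φ _ (homog_lin homogLin_prodFst)) z
  refine exists_contraction hcodiff.homog.lin1 (homogLin_mapPathSnd h₁ h₂ hφ) hcodiff.lin1_lin1
    (fun x hx => ?_) (fun y => ⟨(V₁.prod V₂).prodInl (mapPath h₁ h₂ hφ).loops (V₁.prodInr V₂ y), rfl⟩)
    fun e he hde => ?_
  · have := (mor_mapPathSnd h₁ h₂ hφ).lin1_comm hcodiff.homog x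
    refine this.trans ?_
    rw [lin1_lin, hx, map_zero]
  have hZ := (mapPath h₁ h₂ hφ).toZ_lin1_op e
  have hP := (mapPath h₁ h₂ hφ).path_lin1_op e
  have hE0 := (mapPath h₁ h₂ hφ).pathEv_zero_path_lin1 e
  have hE1 := (mapPath h₁ h₂ hφ).pathEv_one_path_lin1 e
  rw [hde, map_zero] at hZ hP
  obtain ⟨⟨p, r⟩, hpr⟩ : ∃ w : V₂.path, w = (mapPath h₁ h₂ hφ).path.lin1 e := ⟨_, rfl⟩
  rw [← hpr] at hP hE0 hE1
  have hP' : ((0, 0) : V₂.poly × V₂.poly) = _ := hP.trans (lin1_path l₂ p r)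
  have hdp : V₂.polyMap l₂.lin1 p = 0 := (congrArg Prod.fst hP').symm
  have hdr : V₂.deriv p = V₂.polyMap l₂.lin1 r := sub_eq_zero.mp (congrArg Prod.snd hP').symm
  obtain ⟨z, hz⟩ : ∃ z, z = (mapPath h₁ h₂ hφ).toZ e := ⟨_, rfl⟩
  rw [← hz] at hZ hE0 hE1
  set c := V₁.prodFst V₂ z with hc
  have hE0' : V₂.ev 0 p = φ.lin1 c := hE0.trans (hφ0 z)
  have hz2 : V₁.prodSnd V₂ z = 0 := by rw [hz]; exact he
  have hE1' : V₂.ev 1 p = 0 := hE1.trans hz2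
  have hdc : l₁.lin1 c = 0 := by
    rw [hc, ← fst_lin1_prod (l₂ := l₂)]
    exact (congrArg (V₁.prodFst V₂) hZ.symm).trans (map_zero _)
  -- Integrate `p' = d r` over the interval: `d ∫ r = p(1) - p(0) = -φ(c)`. Injectivity on
  -- cohomology then yields `a` with `d a = c`.
  have hint : l₂.lin1 (V₂.ev 1 (V₂.integ r)) = -φ.lin1 c := by
    rw [← ev_polyMap, ← integ_polyMap, ← hdr, integ_deriv, map_sub, hE1', ev_mono, hE0']
    simp
  obtain ⟨a, ha⟩ := hinj c hdc (-V₂.ev 1 (V₂.integ r)) (by rw [map_neg, hint, neg_neg])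
  have hφd : ∀ x, φ.lin1 (l₁.lin1 x) = l₂.lin1 (φ.lin1 x) := hφ.lin1_comm h₁.homog
  -- Now `φ(a) + ∫ r` is closed but need not be exact. Surjectivity on cohomology gives a cycle `a'`
  -- such that subtracting `φ(a')` makes it exact, with primitive `k`.
  obtain ⟨a', k, ha', hk⟩ := hsurj (φ.lin1 a + V₂.ev 1 (V₂.integ r)) (by
    rw [map_add, ← hφd, ha, hint, add_neg_cancel])
  have hα : φ.lin1 (a - a') + V₂.ev 1 (V₂.integ r) = l₂.lin1 k := by
    rw [map_sub, sub_add_eq_add_sub, hk, add_sub_cancel_left]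
  -- The primitive has base point `(a - a', 0)` and path `∫_0^t r + φ(a - a') - t d k - k dt`. The
  -- term `t d k` makes it vanish at `t = 1`; the term `-k dt` compensates the derivative of `t d
  -- k`.
  obtain ⟨e', he'Z, he'P⟩ := (mapPath h₁ h₂ hφ).exists_total (z := V₁.prodInl V₂ (a - a'))
    (w := ((V₂.integ r + V₂.mono 0 (φ.lin1 (a - a')) - V₂.mono 1 (l₂.lin1 k), -V₂.mono 0 k) :
      V₂.poly × V₂.poly)) (by
      refine Eq.trans ?_ (hφ0 _).symm
      change V₂.ev 0 (_ - _) = φ.lin1 (a - a')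
      rw [map_sub, map_add, ev_zero_integ, ev_mono, ev_mono]
      simp) (by
      change V₂.ev 1 (_ - _) = 0
      rw [map_sub, map_add, ev_mono, ev_mono, one_pow, one_pow, one_smul, one_smul, ← hα]
      abel) (by
      change V₂.pathMap 0 _ = V₂.pathMono 0 0
      rw [pathMap_zero, map_zero]; rfl)
  refine ⟨e', ?_, (mapPath h₁ h₂ hφ).eq_of_path_lin1 ?_ ?_⟩
  · rw [mapPathSnd, LinearMap.comp_apply, he'Z]; rfl
  · rw [PathData.toZ_lin1_op, he'Z, ← hz]
    refine Prod.ext ?_ ?_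
    · refine (fst_lin1_prod _).trans ?_
      change l₁.lin1 (a - a') = c
      rw [map_sub, ha, ha', sub_zero]
    · refine (snd_lin1_prod _).trans ?_
      refine Eq.trans ?_ hz2.symm
      exact map_zero l₂.lin1
  · rw [PathData.path_lin1_op, he'P, ← hpr]
    refine (lin1_path l₂ _ _).trans (Prod.ext ?_ ?_)
    · change V₂.polyMap l₂.lin1 (_ - _) = p
      rw [map_sub, map_add, ← integ_polyMap, ← hdr, integ_deriv, polyMap_mono, polyMap_mono,
        h₂.lin1_lin1, map_zero, sub_zero, ← hφd, map_sub l₁.lin1, ha, ha', sub_zero, hE0',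
        sub_add_cancel]
    · change V₂.deriv (_ - _) - V₂.polyMap l₂.lin1 (-_) = r
      rw [map_sub, map_add, deriv_integ, deriv_mono, deriv_mono, map_neg, polyMap_mono]
      simp

end MappingPath

/-! ### Sections are homotopy inverses -/

section SectPath

open GMod Fam

variable {K : Type u} [Field K] [CharZero K] {E : GMod.{u, v} K} {B : GMod.{u, w} K}
  {lE : Fam E E} {lB : Fam B B} {q : E →ₗ[K] B} {s : Fam B E}

omit [CharZero K] in
theorem GMod.pathMap_apply (L : E →ₗ[K] B) (p r : E.poly) :
    E.pathMap L ((p, r) : E.poly × E.poly) =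
      ((E.polyMap L p, E.polyMap L r) : B.poly × B.poly) :=
  Prod.ext (add_zero _) (zero_add _)

variable (hE : lE.Codiff) (hB : lB.Codiff) (hq : HomogLin E B q 0) (hm : Mor lE lB (lin q))
  (hs : Mor lB lE s) (hqs : post q s = lin LinearMap.id)

/-- The data of paths from `s (q x)` to `x` over `q x`. -/
noncomputable abbrev sectPath : PathData.{u, v, v, w} K where
  Z := E
  X := E
  B := B
  lZ := lE
  lX := lE
  lB := lB
  φ₀ := pre s q hq
  φ₁ := lin LinearMap.id
  q := q
  hZ := hE
  hX := hE
  hB := hB.homog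
  hq := hq
  mor_q := hm
  mor₀ := by rw [← comp_lin_eq_pre]; exact hs.comp hE.homog hm
  mor₁ := mor_id hE.homog
  post_eq := eq_of_val fun 𝔸 v hv => by
    rw [val_post, val_pre, ← val_post, hqs, val_lin _ (lTensor_mem_pts hq hv (by ring)), val_post,
      val_lin _ hv, LinearMap.lTensor_id, LinearMap.lTensor_id]
    rfl

/-- An element of the kernel of `toZ` is a form that vanishes at both endpoints and is killed by
`q`. Applying the contraction `h` to its coefficients, with a minus sign on the `dt` part, respects
these conditions and gives primitives of cycles. -/
theorem sectPath_contraction (𝔠 : Contraction lE.lin1 q) : Nonempty (Contraction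
    (sectPath hE hB hq hm hs hqs).op.lin1 (sectPath hE hB hq hm hs hqs).toZ) := by
  have hcodiff := (sectPath hE hB hq hm hs hqs).codiff_op
  refine exists_contraction hcodiff.homog.lin1 (sectPath hE hB hq hm hs hqs).homogLin_toZ
    hcodiff.lin1_lin1 (fun x hx => ?_)
    (fun y => ⟨E.prodInl (sectPath hE hB hq hm hs hqs).loops y, rfl⟩) fun e he hde => ?_
  · rw [PathData.toZ_lin1_op, hx, map_zero]
  have hP := (sectPath hE hB hq hm hs hqs).path_lin1_op e
  have hE0 := (sectPath hE hB hq hm hs hqs).pathEv_zero_path_lin1 e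
  have hE1 := (sectPath hE hB hq hm hs hqs).pathEv_one_path_lin1 e
  have hQ := (sectPath hE hB hq hm hs hqs).pathMap_path_lin1 e
  rw [hde, map_zero] at hP
  rw [he, map_zero] at hE0 hE1 hQ
  rw [map_zero, map_zero] at hQ
  obtain ⟨⟨p, r⟩, hpr⟩ : ∃ w : E.path, w = (sectPath hE hB hq hm hs hqs).path.lin1 e := ⟨_, rfl⟩
  rw [← hpr] at hP hE0 hE1 hQ
  have hP' : ((0, 0) : E.poly × E.poly) = _ := hP.trans (lin1_path lE p r)
  have hdp : E.polyMap lE.lin1 p = 0 := (congrArg Prod.fst hP').symm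
  have hdr : E.deriv p = E.polyMap lE.lin1 r := sub_eq_zero.mp (congrArg Prod.snd hP').symm
  have hQ' : (_ : B.poly × B.poly) = (0, 0) := (pathMap_apply q p r).symm.trans hQ
  have hqp : E.polyMap q p = 0 := congrArg Prod.fst hQ'
  have hqr : E.polyMap q r = 0 := congrArg Prod.snd hQ'
  have contr : ∀ p : E.poly, E.polyMap q p = 0 →
      E.polyMap lE.lin1 (E.polyMap 𝔠.h p) + E.polyMap 𝔠.h (E.polyMap lE.lin1 p) = p := fun p hp =>
    poly_ext_ev (V := E) fun τ => by
      rw [map_add]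
      simp only [ev_polyMap]
      exact 𝔠.contract _ (by rw [← ev_polyMap, hp, map_zero])
  have hqh : ∀ p : E.poly, E.polyMap q (E.polyMap 𝔠.h p) = 0 := fun p =>
    poly_ext_ev (V := B) fun τ => by
      rw [ev_polyMap, ev_polyMap, map_zero]
      exact LinearMap.congr_fun 𝔠.q_h _
  obtain ⟨e', he'Z, he'P⟩ := (sectPath hE hB hq hm hs hqs).exists_total (z := 0)
    (w := ((E.polyMap 𝔠.h p, -E.polyMap 𝔠.h r) : E.poly × E.poly)) (by
      rw [map_zero]
      refine (E.ev_polyMap 𝔠.h 0 p).trans ((congrArg 𝔠.h hE0).trans (map_zero _))) (by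
      rw [map_zero]
      refine (E.ev_polyMap 𝔠.h 1 p).trans ((congrArg 𝔠.h hE1).trans (map_zero _))) (by
      rw [map_zero, map_zero, map_zero]
      refine (pathMap_apply q _ _).trans (Prod.ext (hqh p) ?_)
      refine (map_neg (E.polyMap q) _).trans ?_
      rw [hqh, neg_zero]; rfl)
  refine ⟨e', he'Z, (sectPath hE hB hq hm hs hqs).eq_of_path_lin1 ?_ ?_⟩
  · rw [PathData.toZ_lin1_op, he'Z, he, map_zero]
  · rw [PathData.path_lin1_op, he'P, ← hpr]
    refine (lin1_path lE _ _).trans (Prod.ext ?_ ?_)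
    · have := contr p hqp
      rwa [hdp, map_zero, add_zero] at this
    · change E.deriv (E.polyMap 𝔠.h p) - E.polyMap lE.lin1 (-E.polyMap 𝔠.h r) = r
      rw [map_neg, sub_neg_eq_add, deriv_polyMap, hdr, add_comm, contr r hqr]

include hE hB hm hs hqs in
/-- If the kernel of `q` is contractible, `s ∘ q` is homotopic to the identity. -/
theorem exists_homotopy_of_section (𝔠 : Contraction lE.lin1 q) : ∃ H : Fam E E.path,
    Mor lE lE.path H ∧ post (E.pathEv 0) H = pre s q hq ∧
      post (E.pathEv 1) H = lin LinearMap.id := by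
  obtain ⟨𝔠'⟩ := sectPath_contraction hE hB hq hm hs hqs 𝔠
  have hcodiff := (sectPath hE hB hq hm hs hqs).codiff_op
  have hs' := 𝔠'.mor_sect hcodiff hE.homog (sectPath hE hB hq hm hs hqs).mor_toZ
  have hv' : ∀ (𝔸 : PointAlg.{u} K) (v : 𝔸.A ⊗[K] E), v ∈ 𝔸.pts E 0 →
      (sectPath hE hB hq hm hs hqs).toZ.lTensor 𝔸.A (𝔠'.sect.val v) = v := fun 𝔸 v hv => by
    rw [← val_post, 𝔠'.post_q_sect hcodiff.homog, val_lin _ hv, LinearMap.lTensor_id]; rfl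
  refine ⟨comp (sectPath hE hB hq hm hs hqs).path 𝔠'.sect,
    (sectPath hE hB hq hm hs hqs).mor_path.comp hE.homog hs', eq_of_val fun 𝔸 v hv => ?_,
    eq_of_val fun 𝔸 v hv => ?_⟩
  · rw [val_post, val_comp _ _ hs'.homog hv,
      (sectPath hE hB hq hm hs hqs).pathEv_zero_val_path (val_mem hs'.homog hv), hv' 𝔸 v hv]
  · rw [val_post, val_comp _ _ hs'.homog hv,
      (sectPath hE hB hq hm hs hqs).pathEv_one_val_path (val_mem hs'.homog hv), hv' 𝔸 v hv]

end SectPath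

/-! ### The homotopy inverse -/

open Fam GMod in
theorem theorem2p12 {K : Type u} [Field K] [CharZero K]
    (C₁ : LInftyAlgebra.{u, v} K) (C₂ : LInftyAlgebra.{u, w} K)
    (f : LInftyHom C₁ C₂) (hf : f.IsQuasiIso) : f.IsHomotopyEquivalence := by
  have h₁ := C₁.fam_codiff
  have h₂ := C₂.fam_codiff
  have hφ := f.fam_mor
  obtain ⟨hinj, hsurj⟩ := (LInftyChainMap.isQuasiIso_iff _).mp hf
  obtain ⟨𝔠⟩ := mapPath_contraction h₁ h₂ hφ hinj hsurj
  have hop := (mapPath h₁ h₂ hφ).codiff_op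
  have hmq := mor_mapPathSnd h₁ h₂ hφ
  have hmp := mor_mapPathFst h₁ h₂ hφ
  have hhq := homogLin_mapPathSnd h₁ h₂ hφ
  have hhp := homogLin_mapPathFst h₁ h₂ hφ
  have hs := 𝔠.mor_sect hop h₂.homog hmq
  have hqs := 𝔠.post_q_sect hop.homog
  -- The inverse is the section of the projection to `C₂` followed by the projection to `C₁`.
  have hG := hmp.post h₂.homog hs
  have hi := mor_mapPathIncl h₁ h₂ hφ
  obtain ⟨H, hH, hH0, hH1⟩ := exists_homotopy_of_section hop h₂ hhq hmq hs hqs 𝔠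
  refine ⟨hG.hom, ⟨(hG.comp h₁.homog hφ).hom, LInftyHom.isComp_of_fam rfl, ?_⟩,
    ⟨(hφ.comp h₂.homog hG).hom, LInftyHom.isComp_of_fam rfl, ?_⟩⟩
  -- Restrict the homotopy `H` from `s q` to the identity along the constant paths `i`, and push it
  -- forward by `p`; its endpoints are `p s q i` and `p i`, with `q i = f` and `p i = id`.
  · have hm := mor_pathMap hop.homog hhp hmp
    refine LInftyHom.homotopic_of_mor (hm.post h₁.homog (hH.comp h₁.homog hi)) ?_ ?_
    · refine eq_of_val fun 𝔸 v hv => ?_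
      have hiv := val_mem hi.homog hv
      rw [val_post, val_post, val_comp _ _ hi.homog hv,
        LinearMap.lTensor_of_comp_eq_comp (pathEv_comp_pathMap _ _ _), ← val_post, hH0, val_pre,
        snd_val_mapPathIncl h₁ h₂ hφ hv, ← val_post]
      exact (val_comp _ _ hφ.homog hv).symm
    · refine eq_of_val fun 𝔸 v hv => ?_
      have hiv := val_mem hi.homog hv
      rw [val_post, val_post, val_comp _ _ hi.homog hv,
        LinearMap.lTensor_of_comp_eq_comp (pathEv_comp_pathMap _ _ _), ← val_post, hH1,
        val_lin _ hiv, LinearMap.lTensor_id, LinearMap.id_apply, fst_val_mapPathIncl h₁ h₂ hφ hv,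
        LInftyHom.id_fam, val_lin _ hv, LinearMap.lTensor_id, LinearMap.id_apply]
  -- The path component of `s(y)` starts at `f(p(s(y)))` and ends at `q(s(y)) = y`.
  · refine LInftyHom.homotopic_of_mor ((mapPath h₁ h₂ hφ).mor_path.comp h₂.homog hs) ?_ ?_
    · refine eq_of_val fun 𝔸 v hv => ?_
      rw [val_post, val_comp _ _ hs.homog hv, ← val_post, pathEv_zero_mapPath, val_pre, ← val_post]
      exact (val_comp _ _ hG.homog hv).symm
    · refine eq_of_val fun 𝔸 v hv => ?_
      rw [val_post, val_comp _ _ hs.homog hv, ← val_post, pathEv_one_mapPath,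
        val_lin _ (val_mem hs.homog hv), ← val_post, hqs]
      rfl
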